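/- Let $(M^{n+k},g)$ be a closed smooth Riemannian manifold and $\Sigma^n\subset M$ a closed embedded submanifold of codimension $k$. Let $\pi:\widetilde\Sigma=SN\Sigma\to\Sigma$ be its unit normal sphere bundle. The blow-up of $M$ along $\Sigma$ is $\widetilde M=(M\setminus\Sigma)\sqcup\widetilde\Sigma$, with blow-down map $\beta:\widetilde M\to M$ equal to the identity on $M\setminus\Sigma$ and to $\pi$ on $\widetilde\Sigma$; it is a smooth manifold with boundary $\widetilde\Sigma$, with charts those of $M\setminus\Sigma$ together with the polar coordinates $(x,\omega,t)=(x,y/|y|,|y|)\in\mathbb R^n\times\mathbb S^{k-1}\times[0,\infty)$ for the charts $(x,y)$ of $M$ in which $\Sigma=\{y=0\}$ (at a unit normal vector $v\in\widetilde\Sigma$ one has $t=0$ and $\omega=dy(v)/|dy(v)|$). For $f\in C^\infty(\widetilde M)$ and $v\in\widetilde\Sigma$, let $\frac{\partial^j f}{\partial t^j}\big|_{t=0}(v)$ be the $j$-th one-sided derivative at $t=0$ of $f$ along the lift to $\widetilde M$, starting at $v$, of the geodesic $t\mapsto\exp(tv)$; that is, $t$ is the distance to $\Sigma$ in polar Fermi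 coordinates. For $j\ge 0$ let $\mathcal H_j(\widetilde\Sigma)=\{h\in C^\infty(\widetilde\Sigma):\Delta_{\mathring b}h+j(j+k-2)h=0\}$, where $\Delta_{\mathring b}$ is the Laplacian of the round metric on the fibers of $\pi$, which are unit spheres $\mathbb S^{k-1}$ in the normal spaces. (If $k=1$, when the fibers are pairs of points $\pm v$ and $\Delta_{\mathring b}=0$, require in addition $h(-v)=(-1)^jh(v)$; for $k\ge2$ this holds automatically.) Let $$\mathcal Y_j(\widetilde\Sigma)=\bigoplus_{0\le m\le j,\ m\equiv j\,(\mathrm{mod}\ 2)}\mathcal H_m(\widetilde\Sigma).$$ Suppose $f\in C^\infty(\widetilde M)$. Then $f=\beta^*u$ for some $u\in C^\infty(M)$ if and only if $$\left.\frac{\partial^j f}{\partial t^j}\right|_{t=0}\in\mathcal Y_j(\widetilde\Sigma)\quad\text{for all } j\ge 0 .$$ -/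

import Mathlib

open scoped Manifold ContDiff Topology
open Bundle

noncomputable section

namespace SphericalBlowup

/-! ### Ambient manifold, slice charts, submanifolds -/

/-- The model space `ℝ^{n+k}`. -/
abbrev Model (n k : ℕ) := EuclideanSpace ℝ (Fin (n + k))

/-- The first `n` coordinates of a point of `ℝ^{n+k}`. -/
def tangentialCoord (n k : ℕ) : Model n k →L[ℝ] EuclideanSpace ℝ (Fin n) :=
  (ContinuousLinearMap.fst ℝ _ _).comp
    (EuclideanSpace.finAddEquivProd (𝕜 := ℝ) (n := n) (m := k)).toContinuousLinearMap

/-- The last `k` coordinates of a point of `ℝ^{n+k}`. -/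
def normalCoord (n k : ℕ) : Model n k →L[ℝ] EuclideanSpace ℝ (Fin k) :=
  (ContinuousLinearMap.snd ℝ _ _).comp
    (EuclideanSpace.finAddEquivProd (𝕜 := ℝ) (n := n) (m := k)).toContinuousLinearMap

/-- The point `(x, y)` of `ℝ^{n+k}` with `x ∈ ℝ^n` and `y ∈ ℝ^k`. -/
def joinCoord (n k : ℕ) (x : EuclideanSpace ℝ (Fin n)) (y : EuclideanSpace ℝ (Fin k)) :
    Model n k :=
  (EuclideanSpace.finAddEquivProd (𝕜 := ℝ) (n := n) (m := k)).symm (x, y)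

/-- A smooth Riemannian metric on an `(n+k)`-manifold `M`. -/
abbrev Metric (n k : ℕ) (M : Type*) [TopologicalSpace M] [ChartedSpace (Model n k) M]
    [IsManifold (𝓡 (n + k)) ∞ M] :=
  ContMDiffRiemannianMetric (𝓡 (n + k)) ∞ (Model n k)
    (fun x : M => TangentSpace (𝓡 (n + k)) x)

variable {n k : ℕ} {M : Type*} [TopologicalSpace M] [ChartedSpace (Model n k) M]

/-- A chart `φ = (x, y)` of the smooth structure of `M` in whose domain `S` is `{y = 0}`. -/
structure IsSliceChart (n k : ℕ) {M : Type*} [TopologicalSpace M] [ChartedSpace (Model n k) M]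
    (S : Set M) (φ : OpenPartialHomeomorph M (Model n k)) : Prop where
  mem_maximalAtlas : φ ∈ IsManifold.maximalAtlas (𝓡 (n + k)) ∞ M
  mem_iff : ∀ q ∈ φ.source, q ∈ S ↔ normalCoord n k (φ q) = 0

/-- `S` is an embedded `n`-dimensional submanifold (of codimension `k`) of `M`. -/
def IsEmbeddedSubmanifold (n k : ℕ) {M : Type*} [TopologicalSpace M]
    [ChartedSpace (Model n k) M] (S : Set M) : Prop :=
  ∀ p ∈ S, ∃ φ : OpenPartialHomeomorph M (Model n k), IsSliceChart n k S φ ∧ p ∈ φ.source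

/-- The differential at `p` of the `y`-coordinates of a chart `φ = (x, y)`. -/
def dNormal (φ : OpenPartialHomeomorph M (Model n k)) (p : M)
    (w : TangentSpace (𝓡 (n + k)) p) : EuclideanSpace ℝ (Fin k) :=
  normalCoord n k (mfderiv (𝓡 (n + k)) (𝓡 (n + k)) φ p w)

/-- `w ∈ T_pM` is tangent to `S`: in slice charts, its `y`-components vanish. -/
def IsTangent (S : Set M) (p : M) (w : TangentSpace (𝓡 (n + k)) p) : Prop :=
  ∀ φ : OpenPartialHomeomorph M (Model n k), IsSliceChart n k S φ → p ∈ φ.source →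
    dNormal φ p w = 0

variable [IsManifold (𝓡 (n + k)) ∞ M]

/-- `v ∈ T_pM` belongs to the normal space `N_pS = (T_pS)^⊥`. -/
def IsNormal (g : Metric n k M) (S : Set M) (p : M) (v : TangentSpace (𝓡 (n + k)) p) : Prop :=
  ∀ w : TangentSpace (𝓡 (n + k)) p, IsTangent S p w → g.inner p v w = 0

/-! ### The blow-up -/

/-- The unit normal sphere bundle of `S`. -/
def NormalSphere (g : Metric n k M) (S : Set M) : Type _ :=
  {v : TangentBundle (𝓡 (n + k)) M //
    v.proj ∈ S ∧ IsNormal g S v.proj v.snd ∧ g.inner v.proj v.snd v.snd = 1}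

/-- The antipodal map on the fibres of the unit normal sphere bundle. -/
def NormalSphere.neg {g : Metric n k M} {S : Set M} (v : NormalSphere g S) : NormalSphere g S :=
  ⟨⟨v.1.proj, -v.1.snd⟩, v.2.1, fun w hw => by
    have h := v.2.2.1 w hw
    simp only [map_neg, neg_apply, h, neg_zero], by
    have h := v.2.2.2
    simp only [map_neg, neg_apply, neg_neg, h]⟩

/-- The blow-up of `M` along `S`, as a set: `(M ∖ S) ⊔ SNS`. -/
def Blowup (g : Metric n k M) (S : Set M) : Type _ := {q : M // q ∉ S} ⊕ NormalSphere g S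

/-- The blow-down map. -/
def blowdown {g : Metric n k M} {S : Set M} : Blowup g S → M :=
  Sum.elim (fun q => q.1) (fun v => v.1.proj)

/-- The lift to the blow-up of a slice chart `φ = (x, y)`, in polar coordinates
`(x, ω, t) = (x, y/|y|, |y|)`. On the boundary, `t = 0` and `ω` is the direction of the
`y`-components of the unit normal vector. -/
def polarChart {g : Metric n k M} {S : Set M} (φ : OpenPartialHomeomorph M (Model n k)) :
    Blowup g S → EuclideanSpace ℝ (Fin n) × EuclideanSpace ℝ (Fin k) × ℝ :=
  Sum.elim
    (fun q => (tangentialCoord n k (φ q.1),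
      ‖normalCoord n k (φ q.1)‖⁻¹ • normalCoord n k (φ q.1), ‖normalCoord n k (φ q.1)‖))
    (fun v => (tangentialCoord n k (φ v.1.proj),
      ‖dNormal φ v.1.proj v.1.snd‖⁻¹ • dNormal φ v.1.proj v.1.snd, 0))

/-- The set of `(x, y, t)`, `y ≠ 0`, `t ≥ 0`, such that `(x, t y/|y|)` is in the range of `φ`.
Its part `{|y| = 1}` is the range of the polar chart. -/
def polarDomain (φ : OpenPartialHomeomorph M (Model n k)) :
    Set (EuclideanSpace ℝ (Fin n) × EuclideanSpace ℝ (Fin k) × ℝ) :=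
  {z | z.2.1 ≠ 0 ∧ 0 ≤ z.2.2 ∧
    joinCoord n k z.1 (z.2.2 • (‖z.2.1‖⁻¹ • z.2.1)) ∈ φ.target}

open Classical in
/-- The restriction to `M ∖ S` of a function on the blow-up (extended by `0` to `S`). -/
def interiorPart {g : Metric n k M} {S : Set M} (f : Blowup g S → ℝ) (q : M) : ℝ :=
  if h : q ∉ S then f (Sum.inl ⟨q, h⟩) else 0

/-- `f ∈ C^∞` on the blow-up, a manifold with boundary whose charts are the charts of `M ∖ S`
and the polar charts `(x, ω, t) ∈ ℝ^n × 𝕊^{k-1} × [0, ∞)` lifting the slice charts.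
Smoothness in `(x, ω, t)` on `ℝ^n × 𝕊^{k-1} × [0, ∞)`, up to the boundary `t = 0`, is expressed
by an extension to `ω ∈ ℝ^k ∖ {0}`. -/
def IsSmooth {g : Metric n k M} {S : Set M} (f : Blowup g S → ℝ) : Prop :=
  ContMDiffOn (𝓡 (n + k)) 𝓘(ℝ, ℝ) ∞ (interiorPart f) Sᶜ ∧
  ∀ φ : OpenPartialHomeomorph M (Model n k), IsSliceChart n k S φ →
    ∃ F : EuclideanSpace ℝ (Fin n) × EuclideanSpace ℝ (Fin k) × ℝ → ℝ,
      ContDiffOn ℝ ∞ F (polarDomain φ) ∧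
      ∀ q : Blowup g S, blowdown q ∈ φ.source → f q = F (polarChart φ q)

/-- `h ∈ C^∞` on the boundary `SNS` of the blow-up, read in the charts `(x, ω)` that the polar
charts induce on `{t = 0}`. -/
def IsSmoothOnSphere {g : Metric n k M} {S : Set M} (h : NormalSphere g S → ℝ) : Prop :=
  ∀ φ : OpenPartialHomeomorph M (Model n k), IsSliceChart n k S φ →
    ∃ F : EuclideanSpace ℝ (Fin n) × EuclideanSpace ℝ (Fin k) → ℝ,
      ContDiffOn ℝ ∞ F {z | z.2 ≠ 0 ∧ joinCoord n k z.1 0 ∈ φ.target} ∧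
      ∀ v : NormalSphere g S, v.1.proj ∈ φ.source →
        h v = F (tangentialCoord n k (φ v.1.proj),
          ‖dNormal φ v.1.proj v.1.snd‖⁻¹ • dNormal φ v.1.proj v.1.snd)

/-! ### Fibrewise spherical harmonics -/

/-- Extension of a function on the unit sphere of `ℝ^k` to `ℝ^k ∖ {0}`, constant on rays. -/
def radialExtension {k : ℕ} (u : Metric.sphere (0 : EuclideanSpace ℝ (Fin k)) 1 → ℝ)
    (y : EuclideanSpace ℝ (Fin k)) : ℝ :=
  open Classical in
  if h : y ≠ 0 then u ⟨‖y‖⁻¹ • y, by simp [norm_smul, h]⟩ else 0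

/-- The Laplacian of the round unit sphere `𝕊^{k-1} ⊆ ℝ^k`: the restriction to the sphere of the
Euclidean Laplacian of the extension that is constant on rays. -/
def sphericalLaplacian {k : ℕ} (u : Metric.sphere (0 : EuclideanSpace ℝ (Fin k)) 1 → ℝ)
    (ξ : Metric.sphere (0 : EuclideanSpace ℝ (Fin k)) 1) : ℝ :=
  Laplacian.laplacian (radialExtension u) (ξ : EuclideanSpace ℝ (Fin k))

/-- An orthonormal frame of `N_pS`, `p ∈ S`, as a linear isometry `ℝ^k → N_pS`. -/
structure NormalFrame (g : Metric n k M) (S : Set M) where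
  base : M
  base_mem : base ∈ S
  toLin : EuclideanSpace ℝ (Fin k) →ₗ[ℝ] TangentSpace (𝓡 (n + k)) base
  normal : ∀ y, IsNormal g S base (toLin y)
  isometry : ∀ y, g.inner base (toLin y) (toLin y) = ‖y‖ ^ 2

/-- The isometry of `𝕊^{k-1}` with the fibre of `SNS` over `p`, given by an orthonormal frame. -/
def NormalFrame.point {g : Metric n k M} {S : Set M} (A : NormalFrame g S)
    (ξ : Metric.sphere (0 : EuclideanSpace ℝ (Fin k)) 1) : NormalSphere g S :=
  ⟨⟨A.base, A.toLin ξ⟩, A.base_mem, A.normal ξ, by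
    have h := A.isometry ξ
    have h1 : ‖(ξ : EuclideanSpace ℝ (Fin k))‖ = 1 := norm_eq_of_mem_sphere ξ
    rw [h1, one_pow] at h
    exact h⟩

/-- `𝓗_j(SNS)`: the smooth functions `h` on the unit normal sphere bundle such that
`Δ h + j (j + k - 2) h = 0`, where `Δ` is the Laplacian of the round metric of the fibres.
On the two-point sphere `𝕊^0` (the case `k = 1`) the Laplacian is zero and does not separate the
degrees; there the spherical harmonics of degree `j` are in addition required to have the parity
of `j`, as they do automatically for `k ≥ 2`. -/
def sphericalHarmonics (g : Metric n k M) (S : Set M) (j : ℕ) : Set (NormalSphere g S → ℝ) :=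
  {h | IsSmoothOnSphere h ∧
    (∀ (A : NormalFrame g S) (ξ : Metric.sphere (0 : EuclideanSpace ℝ (Fin k)) 1),
      sphericalLaplacian (fun η => h (A.point η)) ξ
        + (j : ℝ) * ((j : ℝ) + (k : ℝ) - 2) * h (A.point ξ) = 0) ∧
    (k = 1 → ∀ v, h v.neg = (-1) ^ j * h v)}

/-- `𝓨_j(SNS)`: the sum of the `𝓗_m(SNS)` with `0 ≤ m ≤ j` and `m ≡ j (mod 2)`. -/
def parityHarmonics (g : Metric n k M) (S : Set M) (j : ℕ) : Set (NormalSphere g S → ℝ) :=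
  {h | ∃ H : ℕ → NormalSphere g S → ℝ, (∀ m, H m ∈ sphericalHarmonics g S m) ∧
    ∀ v, h v = ∑ m ∈ (Finset.range (j + 1)).filter (fun m => m % 2 = j % 2), H m v}

/-! ### Geodesics and the `t`-derivatives -/

/-- The components of the metric in the chart `φ`, as a bilinear form at `z ∈ ℝ^{n+k}`. -/
def metricInChart (g : Metric n k M) (φ : OpenPartialHomeomorph M (Model n k))
    (z a b : Model n k) : ℝ :=
  g.inner (φ.symm z) (mfderiv (𝓡 (n + k)) (𝓡 (n + k)) φ.symm z a)
    (mfderiv (𝓡 (n + k)) (𝓡 (n + k)) φ.symm z b)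

/-- The Christoffel symbols of the first kind in the chart `φ`:
`Γ(a, b; c) = ½ (∂_a g(b, c) + ∂_b g(a, c) - ∂_c g(a, b))`. -/
def christoffel (g : Metric n k M) (φ : OpenPartialHomeomorph M (Model n k))
    (z a b c : Model n k) : ℝ :=
  (1 / 2) * (fderiv ℝ (fun x => metricInChart g φ x b c) z a
    + fderiv ℝ (fun x => metricInChart g φ x a c) z b
    - fderiv ℝ (fun x => metricInChart g φ x a b) z c)

/-- `γ` is a geodesic on a neighbourhood of `0`, with initial velocity `v`. The geodesic equation
`g(c'', w) + Γ(c', c'; w) = 0` holds for the coordinate expression `c` of `γ` in every chart. -/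
def IsGeodesicFrom (g : Metric n k M) (v : TangentBundle (𝓡 (n + k)) M) (γ : ℝ → M) : Prop :=
  (⟨γ 0, mfderiv 𝓘(ℝ, ℝ) (𝓡 (n + k)) γ 0 (1 : ℝ)⟩ : TangentBundle (𝓡 (n + k)) M) = v ∧
  ∃ δ > 0, ContMDiffOn 𝓘(ℝ, ℝ) (𝓡 (n + k)) ∞ γ (Set.Ioo (-δ) δ) ∧
    ∀ s ∈ Set.Ioo (-δ) δ, ∀ φ ∈ IsManifold.maximalAtlas (𝓡 (n + k)) ∞ M, γ s ∈ φ.source →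
      ∀ w : Model n k,
        metricInChart g φ (φ (γ s)) (deriv (deriv (φ ∘ γ)) s) w
          + christoffel g φ (φ (γ s)) (deriv (φ ∘ γ) s) (deriv (φ ∘ γ) s) w = 0

open Classical in
/-- The geodesic `s ↦ exp (s v)`; it exists, and is unique near `0`. -/
def geodesic (g : Metric n k M) (v : TangentBundle (𝓡 (n + k)) M) : ℝ → M :=
  if h : ∃ γ, IsGeodesicFrom g v γ then h.choose else fun _ => v.proj

open Classical in
/-- The curve in the blow-up that starts at the boundary point `v` and covers the geodesic with
initial velocity `v`: in polar Fermi coordinates `(p, ω, t)` it is the curve `t ↦ (p, ω, t)`, with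
`(p, ω) = v` and `t` the distance to `S`. -/
def normalRay {g : Metric n k M} {S : Set M} (v : NormalSphere g S) (t : ℝ) : Blowup g S :=
  if h : geodesic g v.1 t ∉ S then Sum.inl ⟨geodesic g v.1 t, h⟩ else Sum.inr v

/-- The (one-sided) derivative `∂^j f / ∂t^j` at `t = 0`, a function on `SNS`. -/
def tDeriv {g : Metric n k M} {S : Set M} (f : Blowup g S → ℝ) (j : ℕ)
    (v : NormalSphere g S) : ℝ :=
  iteratedDerivWithin j (fun t => f (normalRay v t)) (Set.Ici 0) 0

end SphericalBlowup

end

/-!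
The theorem rests on one fact about spheres: the sums of spherical harmonics of degrees
`j, j - 2, …` on the unit sphere of a Euclidean space are exactly the restrictions of the homogeneous
polynomials of degree `j`. Applied to the fibres of the unit normal bundle, it says that the
elements of `𝓨_j` are the fibrewise homogeneous polynomials of degree `j`. The theorem becomes the
statement that a smooth function on the blow-up is smooth on `M` if and only if its expansion in
powers of `t` is, in each degree, polynomial on the normal spaces.

*The fact about spheres.* The extension of a function on the sphere as a homogeneous function of
degree `m` is harmonic if and only if the function satisfies the eigenvalue equation of degree `m`
(`laplacian_homExtension`). A harmonic function of degree `m ≥ 0` outside the origin is a polynomial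
(`exists_isHomPoly_of_harmonic`): its partial derivatives are harmonic of degree `m - 1`, so that
Euler's identity reduces this to `m = 0`, where an integration by parts shows that the function is
constant. (This is for dimension at least two; on a line, where the sphere consists of two points,
the parity condition takes its place.) A homogeneous function that is smooth at the origin is a
polynomial, and this is how polynomials are encoded here (`IsHomPoly`). Conversely, on restrictions
of polynomials of degree `j` the operator `Δ + j (j + k - 2)` is the restriction of the Euclidean
Laplacian and lowers the degree by `2`; it acts by a nonzero scalar on harmonics of degree `m < j`,
so that one can subtract these and proceed by induction (`IsFibrePoly.exists_laplacian`,
`IsFibrePoly.mem_parityHarmonics`).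

*Necessity.* If `f` is the pull-back of `u`, its `j`-th normal derivative at `v` is the `j`-th
derivative of `u` along the geodesic with initial velocity `v`. In a chart this is a smooth
expression in the initial data, homogeneous of degree `j` in the velocity (`geodesicIter`), hence a
polynomial in `v` (`isFibrePoly_tDeriv`).

*Sufficiency.* In a slice chart `(x, y)` the function `f` has a Taylor expansion in `|y|`, with
coefficients and remainders that are smooth functions of polar coordinates (`IsPolarTaylor`). The
distance to the submanifold is not `|y|`, but this does not matter: the `j`-th normal derivative of
`f` is that of the Taylor polynomial of degree `< j`, plus `j!` times the Taylor coefficient of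
degree `j` (`IsPolarTaylor.tDeriv_eq`). If the lower coefficients are polynomials in `y`, the first
term is a polynomial of degree `j` on the normal spaces as in the proof of necessity, and the left
side is one by hypothesis; so by induction all coefficients are polynomials in `y`
(`IsPolarTaylor.exists_isTaylorPoly`), depending smoothly on `x`
(`contDiffOn_uncurry_of_isHomPoly`). Therefore `f` is, for every `m`, the sum of a function smooth
in `(x, y)` and of `|y| ^ (m + 1)` times a smooth function of polar coordinates, which is of class
`C ^ m` (`contDiffOn_norm_pow_smul_comp_polar`, `IsPolarTaylor.contDiffOn_descend`).

In codimension zero the sphere bundle is empty, the submanifold is open and closed, and both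
conditions hold.
-/

open scoped Manifold ContDiff Topology
open Bundle

noncomputable section

set_option linter.unusedSectionVars false

namespace SphericalBlowup

/-! ### Hadamard's lemma on a half space -/

section Hadamard

open Set

universe u

variable {E F : Type u} [NormedAddCommGroup E] [NormedSpace ℝ E] [NormedAddCommGroup F]
  [NormedSpace ℝ F] [CompleteSpace F]

/-- The averages that occur as remainders in Hadamard's lemma are as smooth as `G`, on a compact
convex set. The weight `s ^ a` is there for the induction on `n`: differentiating in the second
variable replaces `a` by `a + 1`. -/
theorem contDiffOn_integral_rescale {K : Set (E × ℝ)} (hK : IsCompact K) (hc : Convex ℝ K)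
    (hu : UniqueDiffOn ℝ K) (hs : ∀ z ∈ K, ∀ s ∈ Icc (0 : ℝ) 1, (z.1, s * z.2) ∈ K) (n : ℕ)
    (a : ℕ) (G : E × ℝ → F) (hG : ContDiffOn ℝ n G K) :
    ContDiffOn ℝ n (fun z => ∫ s in (0 : ℝ)..1, s ^ a • G (z.1, s * z.2)) K := by
  have hcont : ∀ {F : Type u} [NormedAddCommGroup F] [NormedSpace ℝ F] (G : E × ℝ → F),
      ContinuousOn G K → ∀ z ∈ K, ∀ a : ℕ,
      ContinuousOn (fun s : ℝ => s ^ a • G (z.1, s * z.2)) (uIcc 0 1) := by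
    intro F _ _ G hG z hz a
    rw [uIcc_of_le zero_le_one]
    refine (continuous_pow a).continuousOn.smul (hG.comp (by fun_prop) fun s hs' => hs z hz s hs')
  have hdist : ∀ z z' : E × ℝ, ∀ s ∈ Icc (0 : ℝ) 1,
      dist ((z'.1, s * z'.2) : E × ℝ) (z.1, s * z.2) ≤ dist z' z := by
    intro z z' s hs'
    rw [Prod.dist_eq, Prod.dist_eq]
    refine max_le_max le_rfl ?_
    rw [Real.dist_eq, Real.dist_eq, ← mul_sub, abs_mul, abs_of_nonneg hs'.1]
    exact mul_le_of_le_one_left (abs_nonneg _) hs'.2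
  have hpow : ∀ a : ℕ, ∀ s ∈ Icc (0 : ℝ) 1, ‖s ^ a‖ ≤ 1 := by
    intro a s hs'
    rw [norm_pow, Real.norm_of_nonneg hs'.1]
    exact pow_le_one₀ hs'.1 hs'.2
  have hIoc : ∀ s ∈ uIoc (0 : ℝ) 1, s ∈ Icc (0 : ℝ) 1 := by
    intro s hs'
    rw [uIoc_of_le zero_le_one] at hs'
    exact Ioc_subset_Icc_self hs'
  induction n generalizing F a with
  | zero =>
    rw [Nat.cast_zero, contDiffOn_zero] at hG ⊢
    rw [Metric.continuousOn_iff]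
    intro z hz ε hε
    obtain ⟨δ, hδ, h⟩ := Metric.uniformContinuousOn_iff.1
      (hK.uniformContinuousOn_of_continuous hG) (ε / 2) (half_pos hε)
    refine ⟨δ, hδ, fun z' hz' hd => ?_⟩
    rw [dist_eq_norm, ← intervalIntegral.integral_sub
      (hcont G hG z' hz' a).intervalIntegrable (hcont G hG z hz a).intervalIntegrable]
    refine lt_of_le_of_lt (intervalIntegral.norm_integral_le_of_norm_le_const
      (C := ε / 2) fun s hs' => ?_) (by simpa using half_lt_self hε)
    have hs' := hIoc s hs'
    rw [← smul_sub, norm_smul, ← dist_eq_norm]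
    refine (mul_le_of_le_one_left dist_nonneg (hpow a s hs')).trans ?_
    exact (h _ (hs z' hz' s hs') _ (hs z hz s hs') ((hdist z z' s hs').trans_lt hd)).le
  | succ n ih =>
    rw [Nat.cast_succ] at hG ⊢
    obtain ⟨-, G', hG', hd⟩ := (contDiffOn_succ_iff_hasFDerivWithinAt_of_uniqueDiffOn hu).1 hG
    refine (contDiffOn_succ_iff_hasFDerivWithinAt_of_uniqueDiffOn hu).2
      ⟨fun h => by simp at h, ?_⟩
    let p₁ : (E × ℝ) →L[ℝ] (E × ℝ) :=
      (ContinuousLinearMap.inl ℝ E ℝ).comp (ContinuousLinearMap.fst ℝ E ℝ)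
    let p₂ : (E × ℝ) →L[ℝ] (E × ℝ) :=
      (ContinuousLinearMap.inr ℝ E ℝ).comp (ContinuousLinearMap.snd ℝ E ℝ)
    let A : ((E × ℝ) →L[ℝ] F) →L[ℝ] ((E × ℝ) →L[ℝ] F) :=
      (ContinuousLinearMap.compL ℝ (E × ℝ) (E × ℝ) F).flip p₁
    let B : ((E × ℝ) →L[ℝ] F) →L[ℝ] ((E × ℝ) →L[ℝ] F) :=
      (ContinuousLinearMap.compL ℝ (E × ℝ) (E × ℝ) F).flip p₂
    refine ⟨fun z => A (∫ s in (0 : ℝ)..1, s ^ a • G' (z.1, s * z.2))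
      + B (∫ s in (0 : ℝ)..1, s ^ (a + 1) • G' (z.1, s * z.2)), ?_, ?_⟩
    · exact (A.contDiff.comp_contDiffOn (ih a G' hG')).add
        (B.contDiff.comp_contDiffOn (ih (a + 1) G' hG'))
    · intro z hz
      have hG'c := hG'.continuousOn
      have hGc := hG.continuousOn
      rw [hasFDerivWithinAt_iff_isLittleO, Asymptotics.isLittleO_iff]
      intro ε hε
      obtain ⟨δ, hδ, h⟩ := Metric.uniformContinuousOn_iff.1
        (hK.uniformContinuousOn_of_continuous hG'c) ε hε
      filter_upwards [self_mem_nhdsWithin, mem_nhdsWithin_of_mem_nhds (Metric.ball_mem_nhds z hδ)]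
        with z' hz' hd'
      have e1 : (A (∫ s in (0 : ℝ)..1, s ^ a • G' (z.1, s * z.2))
          + B (∫ s in (0 : ℝ)..1, s ^ (a + 1) • G' (z.1, s * z.2))) (z' - z)
          = ∫ s in (0 : ℝ)..1, s ^ a • G' (z.1, s * z.2) (z'.1 - z.1, s * (z'.2 - z.2)) := by
        change (∫ s in (0 : ℝ)..1, s ^ a • G' (z.1, s * z.2)) (p₁ (z' - z))
          + (∫ s in (0 : ℝ)..1, s ^ (a + 1) • G' (z.1, s * z.2)) (p₂ (z' - z)) = _
        have i1 := (hcont G' hG'c z hz a).intervalIntegrable (μ := MeasureTheory.volume)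
        have i2 := (hcont G' hG'c z hz (a + 1)).intervalIntegrable (μ := MeasureTheory.volume)
        rw [ContinuousLinearMap.intervalIntegral_apply i1,
          ContinuousLinearMap.intervalIntegral_apply i2, ← intervalIntegral.integral_add
            ((hcont G' hG'c z hz a).clm_apply continuousOn_const).intervalIntegrable
            ((hcont G' hG'c z hz (a + 1)).clm_apply continuousOn_const).intervalIntegrable]
        refine intervalIntegral.integral_congr fun s _ => ?_
        have : ((z'.1 - z.1, s * (z'.2 - z.2)) : E × ℝ) = p₁ (z' - z) + s • p₂ (z' - z) := by
          simp [p₁, p₂]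
        simp only [this, map_add, map_smul, smul_apply, smul_add, smul_smul,
          pow_succ]
      have c1 := hcont G hGc z' hz' a
      have c2 := hcont G hGc z hz a
      have c3 : ContinuousOn (fun s : ℝ =>
          s ^ a • G' (z.1, s * z.2) (z'.1 - z.1, s * (z'.2 - z.2))) (uIcc 0 1) := by
        have := (hcont G' hG'c z hz a).clm_apply
          (g := fun s : ℝ => ((z'.1 - z.1, s * (z'.2 - z.2)) : E × ℝ)) (by fun_prop)
        exact this
      rw [e1, ← intervalIntegral.integral_sub c1.intervalIntegrable c2.intervalIntegrable,
        ← intervalIntegral.integral_sub (c1.fun_sub c2).intervalIntegrable c3.intervalIntegrable]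
      refine (intervalIntegral.norm_integral_le_of_norm_le_const
        (C := ε * ‖z' - z‖) fun s hs' => ?_).trans (by simp)
      have hs' := hIoc s hs'
      rw [← smul_sub, ← smul_sub, norm_smul]
      refine (mul_le_of_le_one_left (norm_nonneg _) (hpow a s hs')).trans ?_
      have hz'' : (z'.1 - z.1, s * (z'.2 - z.2))
          = ((z'.1, s * z'.2) : E × ℝ) - (z.1, s * z.2) := by
        simp [mul_sub]
      rw [hz'']
      have hm : ∀ w ∈ K ∩ Metric.ball ((z.1, s * z.2) : E × ℝ) δ,
          ‖G' w - G' (z.1, s * z.2)‖ ≤ ε := by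
        intro w hw
        rw [← dist_eq_norm]
        exact (h _ hw.1 _ (hs z hz s hs') hw.2).le
      refine ((hc.inter (convex_ball _ _)).norm_image_sub_le_of_norm_hasFDerivWithin_le'
        (fun w hw => (hd w hw.1).mono inter_subset_left) hm
        ⟨hs z hz s hs', Metric.mem_ball_self hδ⟩
        ⟨hs z' hz' s hs', (hdist z z' s hs').trans_lt hd'⟩).trans ?_
      gcongr
      rw [← dist_eq_norm, ← dist_eq_norm]
      exact hdist z z' s hs'

theorem uniqueDiffOn_inter_halfSpace {Ω : Set (E × ℝ)} (hΩ : IsOpen Ω) :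
    UniqueDiffOn ℝ (Ω ∩ {z | 0 ≤ z.2}) := by
  have h : UniqueDiffOn ℝ ((univ : Set E) ×ˢ Ici (0 : ℝ)) :=
    uniqueDiffOn_univ.prod (uniqueDiffOn_Ici 0)
  have h2 := h.inter hΩ
  have e : Ω ∩ {z | 0 ≤ z.2} = (univ : Set E) ×ˢ Ici (0 : ℝ) ∩ Ω := by
    ext z; simp [and_comm]
  rwa [e]

/-- Hadamard's lemma on a half space: `f(x, t) - f(x, 0)` is divisible by `t`, with a quotient
that is smooth up to the boundary `t = 0`. -/
theorem exists_contDiffOn_eq_add_smul [FiniteDimensional ℝ E] {Ω : Set (E × ℝ)} (hΩ : IsOpen Ω)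
    (h0 : ∀ z ∈ Ω, 0 ≤ z.2 → (z.1, (0 : ℝ)) ∈ Ω) {f : E × ℝ → F}
    (hf : ContDiffOn ℝ ∞ f (Ω ∩ {z | 0 ≤ z.2})) :
    ∃ f' : E × ℝ → F, ContDiffOn ℝ ∞ f' (Ω ∩ {z | 0 ≤ z.2}) ∧
      ∀ z ∈ Ω ∩ {z | 0 ≤ z.2}, f z = f (z.1, 0) + z.2 • f' z := by
  classical
  set D := Ω ∩ {z : E × ℝ | 0 ≤ z.2} with hD
  have hu : UniqueDiffOn ℝ D := uniqueDiffOn_inter_halfSpace hΩ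
  let G : E × ℝ → F := fun z => fderivWithin ℝ f D z (0, 1)
  have hG : ContDiffOn ℝ ∞ G D :=
    (hf.fderivWithin hu (by simp)).clm_apply contDiffOn_const
  refine ⟨fun z => if z.2 = 0 then G z else z.2⁻¹ • (f z - f (z.1, 0)), ?_, ?_⟩
  · intro z hz
    rcases eq_or_ne z.2 0 with hz0 | hz0
    -- near the boundary, the quotient is the average of `∂f/∂t` over the segment from `(x, 0)`
    · obtain ⟨r, hr, hrΩ⟩ := Metric.nhds_basis_closedBall.mem_iff.1 (hΩ.mem_nhds hz.1)
      let K : Set (E × ℝ) := Metric.closedBall z.1 r ×ˢ Icc 0 r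
      have hKD : K ⊆ D := by
        rintro w ⟨hw1, hw2⟩
        refine ⟨hrΩ ?_, hw2.1⟩
        rw [Metric.mem_closedBall, Prod.dist_eq, max_le_iff]
        refine ⟨hw1, ?_⟩
        rw [hz0, Real.dist_eq, sub_zero, abs_of_nonneg hw2.1]
        exact hw2.2
      have hs : ∀ w ∈ K, ∀ s ∈ Icc (0 : ℝ) 1, (w.1, s * w.2) ∈ K := by
        rintro w ⟨hw1, hw2⟩ s hs
        exact ⟨hw1, mul_nonneg hs.1 hw2.1, (mul_le_of_le_one_left hw2.1 hs.2).trans hw2.2⟩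
      have hKn : K ∈ 𝓝[D] z := by
        have : Metric.ball z r ∈ 𝓝 z := Metric.ball_mem_nhds z hr
        filter_upwards [self_mem_nhdsWithin, mem_nhdsWithin_of_mem_nhds this] with w hw hw'
        rw [Metric.mem_ball, Prod.dist_eq, max_lt_iff, hz0, Real.dist_eq, sub_zero] at hw'
        exact ⟨hw'.1.le, hw.2, (le_abs_self _).trans hw'.2.le⟩
      have hzK : z ∈ K := ⟨Metric.mem_closedBall_self hr.le, by simp [hz0, hr.le]⟩
      have hKc : Convex ℝ K := (convex_closedBall _ _).prod (convex_Icc _ _)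
      have hKu : UniqueDiffOn ℝ K := by
        refine (uniqueDiffOn_convex (convex_closedBall _ _) ?_).prod (uniqueDiffOn_Icc hr)
        exact ⟨z.1, Metric.ball_subset_interior_closedBall (Metric.mem_ball_self hr)⟩
      have hI : ContDiffOn ℝ ∞ (fun w : E × ℝ => ∫ s in (0 : ℝ)..1,
          s ^ 0 • G (w.1, s * w.2)) K := by
        rw [contDiffOn_infty]
        intro n
        exact contDiffOn_integral_rescale ((isCompact_closedBall _ _).prod isCompact_Icc) hKc hKu
          hs n 0 G ((hG.mono hKD).of_le (by exact_mod_cast le_top))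
      refine ContDiffWithinAt.mono_of_mem_nhdsWithin (t := D) (s := K) ?_ hKn
      refine (hI z hzK).congr_of_mem (fun w hw => ?_) hzK
      split_ifs with hw0
      · have : ((w.1, (0 : ℝ)) : E × ℝ) = w := Prod.ext rfl hw0.symm
        simp [hw0, this]
      · have hder : ∀ s ∈ Ioo (0 : ℝ) 1, HasDerivAt (fun s : ℝ => f (w.1, s * w.2))
            (w.2 • G (w.1, s * w.2)) s := by
          intro s hs'
          have hmem := hKD (hs w hw s (Ioo_subset_Icc_self hs'))
          have h1 := (hf.differentiableOn (by simp) _ hmem).hasFDerivWithinAt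
          have h2 : HasDerivWithinAt (fun s : ℝ => ((w.1, s * w.2) : E × ℝ)) (0, w.2)
              (Icc 0 1) s := by
            refine ((hasDerivWithinAt_const _ _ _).prodMk ?_)
            simpa using (hasDerivWithinAt_id s _).mul_const w.2
          have h3 := h1.comp_hasDerivWithinAt s h2 fun s hs'' => hKD (hs w hw s hs'')
          have h4 := h3.hasDerivAt (Icc_mem_nhds hs'.1 hs'.2)
          have h5 : ((0, w.2) : E × ℝ) = w.2 • (0, 1) := by simp
          rw [h5, map_smul] at h4
          exact h4
        have hcG : ContinuousOn (fun s : ℝ => G (w.1, s * w.2)) (uIcc 0 1) := by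
          rw [uIcc_of_le zero_le_one]
          exact hG.continuousOn.comp (by fun_prop) fun s hs' => hKD (hs w hw s hs')
        have := intervalIntegral.integral_eq_sub_of_hasDerivAt_of_le zero_le_one
          (hf.continuousOn.comp (f := fun s : ℝ => ((w.1, s * w.2) : E × ℝ)) (by fun_prop)
            fun s hs' => hKD (hs w hw s hs')) hder
          (hcG.const_smul w.2).intervalIntegrable
        rw [intervalIntegral.integral_smul] at this
        simp only [pow_zero, one_smul]
        rw [inv_smul_eq_iff₀ hw0, this]
        simp
    · have h1 : ContDiffWithinAt ℝ ∞ (fun w : E × ℝ => w.2⁻¹ • (f w - f (w.1, 0))) D z := by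
        refine (contDiffWithinAt_snd.inv hz0).smul ((hf z hz).sub ?_)
        refine (hf (z.1, 0) ⟨h0 z hz.1 hz.2, le_refl (0 : ℝ)⟩).comp z
          (f := fun w : E × ℝ => ((w.1, 0) : E × ℝ)) (by fun_prop) ?_
        exact fun w hw => ⟨h0 w hw.1 hw.2, le_refl (0 : ℝ)⟩
      refine h1.congr_of_eventuallyEq ?_ (by simp [hz0])
      have : ∀ᶠ w in 𝓝 z, w.2 ≠ 0 := continuous_snd.continuousAt.eventually_ne hz0
      filter_upwards [mem_nhdsWithin_of_mem_nhds this] with w hw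
      have hw : w.2 ≠ 0 := hw
      simp [hw]
  · intro z hz
    rcases eq_or_ne z.2 0 with hz0 | hz0
    · have : ((z.1, (0 : ℝ)) : E × ℝ) = z := Prod.ext rfl hz0.symm
      simp [hz0, this]
    · simp [hz0]

end Hadamard

/-! ### Positively homogeneous functions -/

section PosHom

variable {V F : Type*} [NormedAddCommGroup V] [NormedSpace ℝ V] [NormedAddCommGroup F]
  [NormedSpace ℝ F]

/-- `f` is positively homogeneous of degree `j` away from the origin. -/
def IsPosHom (j : ℤ) (f : V → F) : Prop :=
  ∀ c : ℝ, 0 < c → ∀ y : V, y ≠ 0 → f (c • y) = c ^ j • f y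

theorem IsPosHom.congr {j : ℤ} {f g : V → F} (hf : IsPosHom j f) (h : ∀ y ≠ 0, g y = f y) :
    IsPosHom j g := by
  intro c hc y hy
  rw [h y hy, h _ (smul_ne_zero hc.ne' hy), hf c hc y hy]

theorem isPosHom_fderiv {j : ℤ} {f : V → F} (hf : IsPosHom j f) :
    IsPosHom (j - 1) (fderiv ℝ f) := by
  intro c hc y hy
  have h1 : (fun x => f (c • x)) =ᶠ[𝓝 y] fun x => c ^ j • f x := by
    filter_upwards [isOpen_ne.mem_nhds hy] with x hx
    exact hf c hc x hx
  have h2 := h1.fderiv_eq (𝕜 := ℝ)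
  rw [fderiv_comp_smul, show (fun x => c ^ j • f x) = (c ^ j) • f from rfl,
    fderiv_const_smul_field] at h2
  rw [zpow_sub_one₀ hc.ne', mul_comm, mul_smul]
  exact (eq_inv_smul_iff₀ hc.ne').2 h2

/-- Euler's identity. -/
theorem fderiv_apply_self_of_isPosHom {j : ℤ} {f : V → F} (hf : IsPosHom j f) {y : V} (hy : y ≠ 0)
    (hd : DifferentiableAt ℝ f y) : fderiv ℝ f y y = (j : ℝ) • f y := by
  have h1 : HasDerivAt (fun c : ℝ => f (c • y)) (fderiv ℝ f y y) 1 := by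
    have h2 : HasDerivAt (fun c : ℝ => c • y) y 1 := by
      simpa using (hasDerivAt_id (1 : ℝ)).smul_const y
    have h3 : HasFDerivAt f (fderiv ℝ f y) ((1 : ℝ) • y) := by
      rw [one_smul]; exact hd.hasFDerivAt
    exact h3.comp_hasDerivAt (1 : ℝ) h2
  have h2 : HasDerivAt (fun c : ℝ => c ^ j • f y) ((j : ℝ) • f y) 1 := by
    simpa using (hasDerivAt_zpow j (1 : ℝ) (Or.inl one_ne_zero)).smul_const (f y)
  refine h1.unique (h2.congr_of_eventuallyEq ?_)
  filter_upwards [lt_mem_nhds (zero_lt_one (α := ℝ))] with c hc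
  exact hf c hc y hy

end PosHom

/-! ### Polar coordinates -/

section Polar

open Set

variable {X Y : Type} [NormedAddCommGroup X] [NormedSpace ℝ X]
  [NormedAddCommGroup Y] [InnerProductSpace ℝ Y]

/-- The radial projection `y ↦ y / |y|`, with value `0` at the origin. -/
def direction (y : Y) : Y := ‖y‖⁻¹ • y

theorem norm_direction {y : Y} (hy : y ≠ 0) : ‖direction y‖ = 1 := by
  simp [direction, norm_smul, hy]

theorem direction_ne_zero {y : Y} (hy : y ≠ 0) : direction y ≠ 0 := by
  rw [← norm_ne_zero_iff, norm_direction hy]; exact one_ne_zero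

theorem norm_smul_direction (y : Y) : ‖y‖ • direction y = y := by
  rcases eq_or_ne y 0 with rfl | hy
  · simp
  · rw [direction, smul_smul, mul_inv_cancel₀ (norm_ne_zero_iff.2 hy), one_smul]

theorem isPosHom_norm : IsPosHom 1 (fun y : Y => ‖y‖) := by
  intro c hc y _
  simp [norm_smul, abs_of_pos hc]

theorem isPosHom_direction : IsPosHom 0 (direction : Y → Y) := by
  intro c hc y _
  simp only [direction, norm_smul, Real.norm_of_nonneg hc.le, zpow_zero, smul_smul, mul_inv]
  rw [one_mul]
  congr 1
  field_simp

theorem direction_smul {c : ℝ} (hc : 0 < c) (y : Y) : direction (c • y) = direction y := by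
  rcases eq_or_ne y 0 with rfl | hy
  · simp
  · simpa using isPosHom_direction c hc y hy

theorem direction_of_norm_eq_one {y : Y} (hy : ‖y‖ = 1) : direction y = y := by
  simp [direction, hy]

theorem contDiffOn_norm_ne : ContDiffOn ℝ ∞ (fun y : Y => ‖y‖) {y | y ≠ 0} :=
  fun _ hy => (contDiffAt_norm ℝ hy).contDiffWithinAt

theorem contDiffOn_direction : ContDiffOn ℝ ∞ (direction : Y → Y) {y | y ≠ 0} :=
  (contDiffOn_norm_ne.inv fun (_ : Y) hy => (norm_ne_zero_iff.2 hy : _)).smul contDiffOn_id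

/-- Polar coordinates in the second factor. -/
def polar (z : X × Y) : (X × Y) × ℝ := ((z.1, direction z.2), ‖z.2‖)

/-- The points `((x, y), t)`, `y ≠ 0`, with `(x, 0)` and `(x, t y / |y|)` in `O`. Its part
`{t ≥ 0, |y| = 1}` is the domain of the polar coordinates of the neighbourhood
`{(x, y) ∈ O | (x, 0) ∈ O}` of `O ∩ {y = 0}`. -/
def polarNhd (O : Set (X × Y)) : Set ((X × Y) × ℝ) :=
  {w | w.1.2 ≠ 0 ∧ (w.1.1, (0 : Y)) ∈ O ∧ (w.1.1, w.2 • direction w.1.2) ∈ O}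

theorem isOpen_polarNhd {O : Set (X × Y)} (hO : IsOpen O) : IsOpen (polarNhd O) := by
  have h1 : IsOpen {w : (X × Y) × ℝ | w.1.2 ≠ 0} :=
    isOpen_ne.preimage (by fun_prop : Continuous fun w : (X × Y) × ℝ => w.1.2)
  have h2 : IsOpen {w : (X × Y) × ℝ | (w.1.1, (0 : Y)) ∈ O} :=
    hO.preimage (by fun_prop : Continuous fun w : (X × Y) × ℝ => (w.1.1, (0 : Y)))
  have h3 : ContinuousOn (fun w : (X × Y) × ℝ => (w.1.1, w.2 • direction w.1.2))
      {w | w.1.2 ≠ 0} := by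
    refine ContinuousOn.prodMk (by fun_prop) (ContinuousOn.smul (by fun_prop) ?_)
    exact contDiffOn_direction.continuousOn.comp (by fun_prop) fun w hw => hw
  have := (h3.isOpen_inter_preimage h1 hO).inter h2
  convert this using 1
  ext w
  simp only [polarNhd, mem_ofPred_eq, mem_inter_iff, mem_preimage]
  tauto

theorem polarNhd_zero {O : Set (X × Y)} {w : (X × Y) × ℝ} (hw : w ∈ polarNhd O) :
    (w.1, (0 : ℝ)) ∈ polarNhd O :=
  ⟨hw.1, hw.2.1, by simpa using hw.2.1⟩

theorem polar_mem {O : Set (X × Y)} {z : X × Y} (hz : z ∈ O) (hz0 : (z.1, (0 : Y)) ∈ O)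
    (hy : z.2 ≠ 0) : polar z ∈ polarNhd O ∩ {w | 0 ≤ w.2} := by
  refine ⟨⟨direction_ne_zero hy, hz0, ?_⟩, norm_nonneg _⟩
  simp only [polar]
  rwa [direction_of_norm_eq_one (norm_direction hy), norm_smul_direction]

variable {F : Type} [NormedAddCommGroup F] [NormedSpace ℝ F]

/-- The differential of the polar coordinates at `z`, multiplied by `|y|`, as a function of
`polar z`. -/
def polarDeriv (w : (X × Y) × ℝ) : (X × Y) →L[ℝ] (X × Y) × ℝ :=
  w.2 • ((ContinuousLinearMap.inl ℝ (X × Y) ℝ).comp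
      ((ContinuousLinearMap.inl ℝ X Y).comp (ContinuousLinearMap.fst ℝ X Y)))
    + ((ContinuousLinearMap.inl ℝ (X × Y) ℝ).comp (ContinuousLinearMap.inr ℝ X Y)).comp
      ((fderiv ℝ direction w.1.2).comp (ContinuousLinearMap.snd ℝ X Y))
    + w.2 • ((ContinuousLinearMap.inr ℝ (X × Y) ℝ).comp
      ((fderiv ℝ (fun y : Y => ‖y‖) w.1.2).comp (ContinuousLinearMap.snd ℝ X Y)))

/-- The differential of the polar coordinates has a simple pole at `y = 0`: it is `|y|⁻¹` times a
function that is smooth in polar coordinates. -/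
theorem hasFDerivAt_polar {z : X × Y} (hz : z.2 ≠ 0) :
    HasFDerivAt polar (‖z.2‖⁻¹ • polarDeriv (polar z)) z := by
  have hn : 0 < ‖z.2‖ := norm_pos_iff.2 hz
  have h1 : HasFDerivAt (direction : Y → Y) (‖z.2‖⁻¹ • fderiv ℝ direction (direction z.2)) z.2 := by
    have h := isPosHom_fderiv isPosHom_direction ‖z.2‖ hn (direction z.2) (direction_ne_zero hz)
    rw [norm_smul_direction, zero_sub, zpow_neg_one] at h
    rw [← h]
    exact ((contDiffOn_direction.differentiableOn (by simp)).differentiableAt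
      (isOpen_ne.mem_nhds hz)).hasFDerivAt
  have h2 : HasFDerivAt (fun y : Y => ‖y‖) (fderiv ℝ (fun y : Y => ‖y‖) (direction z.2)) z.2 := by
    have h := isPosHom_fderiv (isPosHom_norm (Y := Y)) ‖z.2‖ hn (direction z.2)
      (direction_ne_zero hz)
    rw [norm_smul_direction, sub_self, zpow_zero, one_smul] at h
    rw [← h]
    exact ((contDiffOn_norm_ne.differentiableOn (by simp)).differentiableAt
      (isOpen_ne.mem_nhds hz)).hasFDerivAt
  have h3 := ((hasFDerivAt_fst (𝕜 := ℝ) (p := z)).prodMk (h1.comp z hasFDerivAt_snd)).prodMk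
    (h2.comp z hasFDerivAt_snd)
  refine h3.congr_fderiv ?_
  ext v <;> simp [polarDeriv, polar, hn.ne']

theorem contDiffOn_polarDeriv : ContDiffOn ℝ ∞ (polarDeriv (X := X) (Y := Y)) {w | w.1.2 ≠ 0} := by
  have h1 : ContDiffOn ℝ ∞ (fun w : (X × Y) × ℝ => fderiv ℝ (direction : Y → Y) w.1.2)
      {w | w.1.2 ≠ 0} :=
    (contDiffOn_direction.fderiv_of_isOpen (m := ∞) isOpen_ne (by simp)).comp (by fun_prop)
      fun w hw => hw
  have h2 : ContDiffOn ℝ ∞ (fun w : (X × Y) × ℝ => fderiv ℝ (fun y : Y => ‖y‖) w.1.2)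
      {w | w.1.2 ≠ 0} :=
    (contDiffOn_norm_ne.fderiv_of_isOpen (m := ∞) isOpen_ne (by simp)).comp (by fun_prop)
      fun w hw => hw
  have h3 : ContDiffOn ℝ ∞ (fun w : (X × Y) × ℝ => w.2) {w | w.1.2 ≠ 0} := by fun_prop
  unfold polarDeriv
  exact ((h3.smul contDiffOn_const).add (contDiffOn_const.clm_comp
    (h1.clm_comp contDiffOn_const))).add
    (h3.smul (contDiffOn_const.clm_comp (h2.clm_comp contDiffOn_const)))

theorem exists_bound_comp_polar [FiniteDimensional ℝ X] [FiniteDimensional ℝ Y]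
    {O : Set (X × Y)} (hO : IsOpen O) {S : (X × Y) × ℝ → F}
    (hS : ContinuousOn S (polarNhd O ∩ {w | 0 ≤ w.2})) {x : X} (hx : (x, (0 : Y)) ∈ O) :
    ∃ C : ℝ, ∀ᶠ z in 𝓝 (x, (0 : Y)), z.2 ≠ 0 → ‖S (polar z)‖ ≤ C := by
  obtain ⟨r, hr, hrO⟩ := Metric.nhds_basis_closedBall.mem_iff.1 (hO.mem_nhds hx)
  let K : Set ((X × Y) × ℝ) := (Metric.closedBall x r ×ˢ Metric.sphere 0 1) ×ˢ Icc 0 r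
  have hK : IsCompact K :=
    ((isCompact_closedBall _ _).prod (isCompact_sphere _ _)).prod isCompact_Icc
  have hO' : ∀ a ∈ Metric.closedBall x r, ∀ b : Y, ‖b‖ ≤ r → (a, b) ∈ O := by
    intro a ha b hb
    refine hrO ?_
    rw [Metric.mem_closedBall, Prod.dist_eq, max_le_iff]
    exact ⟨ha, by simpa using hb⟩
  have hKD : K ⊆ polarNhd O ∩ {w | 0 ≤ w.2} := by
    rintro ⟨⟨a, b⟩, t⟩ ⟨⟨ha, hb⟩, ht⟩
    have hb1 : ‖b‖ = 1 := by simpa using hb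
    refine ⟨⟨fun h => ?_, hO' a ha 0 (by simpa using hr.le), hO' a ha _ ?_⟩, ht.1⟩
    · have : b = 0 := h
      simp [this] at hb1
    · simp only [direction_of_norm_eq_one hb1]
      rw [norm_smul, hb1, mul_one, Real.norm_of_nonneg ht.1]
      exact ht.2
  obtain ⟨C, hC⟩ := hK.exists_bound_of_continuousOn (hS.mono hKD)
  refine ⟨C, ?_⟩
  filter_upwards [Metric.ball_mem_nhds _ hr] with z hz hz0
  rw [Metric.mem_ball, Prod.dist_eq, max_lt_iff] at hz
  exact hC _ ⟨⟨hz.1.le, by simpa [polar] using norm_direction hz0⟩, norm_nonneg _,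
    by simpa [polar] using hz.2.le⟩

theorem isOpen_polarBase {O : Set (X × Y)} (hO : IsOpen O) :
    IsOpen {z : X × Y | z ∈ O ∧ (z.1, (0 : Y)) ∈ O} :=
  hO.inter (hO.preimage (by fun_prop : Continuous fun z : X × Y => (z.1, (0 : Y))))

theorem hasFDerivAt_comp_polar {O : Set (X × Y)} (hO : IsOpen O) {S : (X × Y) × ℝ → F}
    (hS : DifferentiableOn ℝ S (polarNhd O ∩ {w | 0 ≤ w.2})) {z : X × Y} (hz : z ∈ O)
    (hz' : (z.1, (0 : Y)) ∈ O) (hz0 : z.2 ≠ 0) :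
    HasFDerivAt (fun z => S (polar z)) ((fderivWithin ℝ S (polarNhd O ∩ {w | 0 ≤ w.2})
        (polar z)).comp (‖z.2‖⁻¹ • polarDeriv (polar z))) z := by
  have hmem := polar_mem hz hz' hz0
  have hnhds : polarNhd O ∩ {w | 0 ≤ w.2} ∈ 𝓝 (polar z) := by
    refine Filter.inter_mem ((isOpen_polarNhd hO).mem_nhds hmem.1) ?_
    have : ∀ᶠ w : (X × Y) × ℝ in 𝓝 (polar z), 0 < w.2 :=
      continuous_snd.continuousAt.eventually_const_lt (norm_pos_iff.2 hz0)
    filter_upwards [this] with w hw using hw.le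
  exact ((hS _ hmem).hasFDerivWithinAt.hasFDerivAt hnhds).comp z (hasFDerivAt_polar hz0)

/-- The function `S'` such that `t ^ m S'` is, in polar coordinates, the differential of
`t ^ (m + 1) S`. -/
def polarStep (O : Set (X × Y)) (m : ℕ) (S : (X × Y) × ℝ → F) (w : (X × Y) × ℝ) :
    (X × Y) →L[ℝ] F :=
  ((m + 1 : ℕ) : ℝ) • (((fderiv ℝ (fun y : Y => ‖y‖) w.1.2).comp
      (ContinuousLinearMap.snd ℝ X Y)).smulRight (S w))
    + (fderivWithin ℝ S (polarNhd O ∩ {w | 0 ≤ w.2}) w).comp (polarDeriv w)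

theorem contDiffOn_polarStep {O : Set (X × Y)} (hO : IsOpen O) (m : ℕ) {S : (X × Y) × ℝ → F}
    (hS : ContDiffOn ℝ ∞ S (polarNhd O ∩ {w | 0 ≤ w.2})) :
    ContDiffOn ℝ ∞ (polarStep O m S) (polarNhd O ∩ {w | 0 ≤ w.2}) := by
  have hD : UniqueDiffOn ℝ (polarNhd O ∩ {w : (X × Y) × ℝ | 0 ≤ w.2}) :=
    uniqueDiffOn_inter_halfSpace (E := X × Y) (isOpen_polarNhd hO)
  have h2 : ContDiffOn ℝ ∞ (fun w : (X × Y) × ℝ => fderiv ℝ (fun y : Y => ‖y‖) w.1.2)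
      (polarNhd O ∩ {w | 0 ≤ w.2}) :=
    (contDiffOn_norm_ne.fderiv_of_isOpen (m := ∞) isOpen_ne (by simp)).comp (by fun_prop)
      fun w hw => hw.1.1
  have h3 : ContDiffOn ℝ ∞ (fun w : (X × Y) × ℝ =>
      (fderiv ℝ (fun y : Y => ‖y‖) w.1.2).comp (ContinuousLinearMap.snd ℝ X Y))
      (polarNhd O ∩ {w | 0 ≤ w.2}) := h2.clm_comp contDiffOn_const
  have h4 : ContDiffOn ℝ ∞ (fun w : (X × Y) × ℝ =>
      ((fderiv ℝ (fun y : Y => ‖y‖) w.1.2).comp (ContinuousLinearMap.snd ℝ X Y)).smulRight (S w))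
      (polarNhd O ∩ {w | 0 ≤ w.2}) :=
    ContDiffOn.smulRight h3 hS
  have h5 := (hS.fderivWithin hD (m := ∞) (by simp)).clm_comp
    (contDiffOn_polarDeriv.mono fun w hw => hw.1.1)
  exact (h4.const_smul ((m + 1 : ℕ) : ℝ)).add h5

theorem hasFDerivAt_norm_pow_smul_comp_polar {O : Set (X × Y)} (hO : IsOpen O) (m : ℕ)
    {S : (X × Y) × ℝ → F} (hS : DifferentiableOn ℝ S (polarNhd O ∩ {w | 0 ≤ w.2})) {z : X × Y}
    (hz : z ∈ O) (hz' : (z.1, (0 : Y)) ∈ O) (hz0 : z.2 ≠ 0) :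
    HasFDerivAt (fun z : X × Y => ‖z.2‖ ^ (m + 1) • S (polar z))
      (‖z.2‖ ^ m • polarStep O m S (polar z)) z := by
  have hn : 0 < ‖z.2‖ := norm_pos_iff.2 hz0
  have h0 : HasFDerivAt (fun y : Y => ‖y‖) (fderiv ℝ (fun y : Y => ‖y‖) (direction z.2)) z.2 := by
    have h := isPosHom_fderiv (isPosHom_norm (Y := Y)) ‖z.2‖ hn (direction z.2)
      (direction_ne_zero hz0)
    rw [norm_smul_direction, sub_self, zpow_zero, one_smul] at h
    rw [← h]
    exact ((contDiffOn_norm_ne.differentiableOn (by simp)).differentiableAt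
      (isOpen_ne.mem_nhds hz0)).hasFDerivAt
  have h1 : HasFDerivAt (fun z : X × Y => ‖z.2‖)
      ((fderiv ℝ (fun y : Y => ‖y‖) (direction z.2)).comp (ContinuousLinearMap.snd ℝ X Y)) z :=
    h0.comp z hasFDerivAt_snd
  have h2 := (h1.pow (m + 1)).smul (hasFDerivAt_comp_polar hO hS hz hz' hz0)
  refine h2.congr_fderiv ?_
  ext v <;>
  · simp only [polarStep, polar, pow_succ, smul_add, ContinuousLinearMap.comp_smul, smul_smul,
      add_tsub_cancel_right, nsmul_eq_mul]
    have e : ‖z.2‖ * (‖z.2‖ ^ m * ‖z.2‖⁻¹) = ‖z.2‖ ^ m := by field_simp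
    simp [mul_assoc, smul_smul, mul_comm, mul_left_comm, add_comm, e]

/-- At the points of `{y = 0}` the function `|y| ^ (m + 1) S` is flat to order `m`, because `S` is
bounded there by compactness of the unit sphere. -/
theorem norm_pow_smul_comp_polar_isBigO [FiniteDimensional ℝ X] [FiniteDimensional ℝ Y]
    {O : Set (X × Y)} (hO : IsOpen O) (m : ℕ) {S : (X × Y) × ℝ → F}
    (hS : ContinuousOn S (polarNhd O ∩ {w | 0 ≤ w.2})) {z : X × Y} (hz : z ∈ O) (hz0 : z.2 = 0) :
    (fun w : X × Y => ‖w.2‖ ^ (m + 1) • S (polar w)) =O[𝓝 z] fun w => ‖w - z‖ ^ (m + 1) := by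
  have hzz : (z.1, (0 : Y)) = z := Prod.ext rfl hz0.symm
  obtain ⟨C, hC⟩ := exists_bound_comp_polar hO hS (x := z.1) (by rwa [hzz])
  rw [hzz] at hC
  refine Asymptotics.IsBigO.of_bound (max C 0) ?_
  filter_upwards [hC] with w hw
  rw [norm_smul, norm_pow, norm_norm, norm_pow, norm_norm, mul_comm]
  have h1 : ‖w.2‖ ≤ ‖w - z‖ := by
    have := norm_snd_le (w - z)
    rwa [Prod.snd_sub, hz0, sub_zero] at this
  rcases eq_or_ne w.2 0 with hw0 | hw0
  · rw [hw0, norm_zero, zero_pow (Nat.succ_ne_zero m), mul_zero]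
    positivity
  · gcongr
    exact (hw hw0).trans (le_max_left _ _)

/-- If `S` is smooth in polar coordinates up to `t = 0`, then `t ^ (m + 1) S`, extended by zero
to `t = 0`, is of class `C ^ m` in the original coordinates. Its differential is of the same form,
with `m` in place of `m + 1`. -/
theorem contDiffOn_norm_pow_smul_comp_polar [FiniteDimensional ℝ X] [FiniteDimensional ℝ Y]
    {O : Set (X × Y)} (hO : IsOpen O) (m : ℕ) (S : (X × Y) × ℝ → F)
    (hS : ContDiffOn ℝ ∞ S (polarNhd O ∩ {w | 0 ≤ w.2})) :
    ContDiffOn ℝ m (fun z : X × Y => ‖z.2‖ ^ (m + 1) • S (polar z))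
      {z | z ∈ O ∧ (z.1, (0 : Y)) ∈ O} := by
  induction m generalizing F with
  | zero =>
    rw [Nat.cast_zero, contDiffOn_zero]
    intro z hz
    refine ContinuousAt.continuousWithinAt ?_
    rcases eq_or_ne z.2 0 with hz0 | hz0
    · have h := norm_pow_smul_comp_polar_isBigO hO 0 hS.continuousOn hz.1 hz0
      rw [ContinuousAt]
      simp only [hz0, norm_zero, zero_add, pow_one, zero_smul] at h ⊢
      refine h.trans_tendsto ?_
      have : ContinuousAt (fun w : X × Y => ‖w - z‖) z := by fun_prop
      simpa [ContinuousAt] using this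
    · exact (hasFDerivAt_norm_pow_smul_comp_polar hO 0 (hS.differentiableOn (by simp)) hz.1 hz.2
        hz0).continuousAt
  | succ m ih =>
    have hS' := contDiffOn_polarStep hO (m + 1) hS
    rw [Nat.cast_succ]
    refine (contDiffOn_succ_iff_hasFDerivWithinAt_of_uniqueDiffOn
      (isOpen_polarBase hO).uniqueDiffOn).2 ⟨fun h => by simp at h,
        fun z => ‖z.2‖ ^ (m + 1) • polarStep O (m + 1) S (polar z), ih _ hS', fun z hz => ?_⟩
    refine HasFDerivAt.hasFDerivWithinAt ?_
    rcases eq_or_ne z.2 0 with hz0 | hz0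
    · have h := norm_pow_smul_comp_polar_isBigO hO (m + 1) hS.continuousOn hz.1 hz0
      rw [hasFDerivAt_iff_isLittleO]
      simp only [hz0, norm_zero, ne_eq, Nat.succ_ne_zero, not_false_eq_true, zero_pow, zero_smul,
        sub_zero, zero_apply]
      refine h.trans_isLittleO ?_
      have h2 := (Asymptotics.isLittleO_pow_id (𝕜 := ℝ) (n := m + 1 + 1)
        (by omega)).comp_tendsto (k := fun w : X × Y => ‖w - z‖) (l' := 𝓝 z) ?_
      · exact (h2 : (fun w => ‖w - z‖ ^ (m + 1 + 1)) =o[𝓝 z] fun w => ‖w - z‖).of_norm_right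
      · have : ContinuousAt (fun w : X × Y => ‖w - z‖) z := by fun_prop
        simpa [ContinuousAt] using this
    · exact hasFDerivAt_norm_pow_smul_comp_polar hO (m + 1) (hS.differentiableOn (by simp)) hz.1
        hz.2 hz0

end Polar

/-! ### Homogeneous polynomials -/

section HomPoly

open Set

variable {V F : Type} [NormedAddCommGroup V] [NormedSpace ℝ V] [NormedAddCommGroup F]
  [NormedSpace ℝ F]

/-- `p` is a homogeneous polynomial of degree `j`, encoded as a homogeneous function that is smooth
on the whole space, the origin included. -/
structure IsHomPoly (j : ℕ) (p : V → F) : Prop where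
  contDiff : ContDiff ℝ ∞ p
  map_smul : ∀ (c : ℝ) (y : V), p (c • y) = c ^ j • p y

theorem IsHomPoly.isPosHom {j : ℕ} {p : V → F} (h : IsHomPoly j p) : IsPosHom j p := by
  intro c _ y _
  rw [zpow_natCast]
  exact h.map_smul c y

theorem map_zero_of_isPosHom {j : ℕ} {p : V → F} (hp : IsPosHom j p) (hc : Continuous p)
    {y : V} (hy : y ≠ 0) : p 0 = (0 : ℝ) ^ j • p y := by
  have h1 : Filter.Tendsto (fun c : ℝ => p (c • y)) (𝓝[>] 0) (𝓝 (p 0)) := by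
    have : ContinuousAt (fun c : ℝ => p (c • y)) 0 := by fun_prop
    simpa using this.tendsto.mono_left nhdsWithin_le_nhds
  have h2 : Filter.Tendsto (fun c : ℝ => c ^ j • p y) (𝓝[>] 0) (𝓝 ((0 : ℝ) ^ j • p y)) := by
    have : ContinuousAt (fun c : ℝ => c ^ j • p y) 0 := by fun_prop
    exact this.tendsto.mono_left nhdsWithin_le_nhds
  refine tendsto_nhds_unique (h1.congr' ?_) h2
  filter_upwards [self_mem_nhdsWithin] with c hc
  rw [hp c hc y hy, zpow_natCast]

/-- Euler's identity, at the origin too. -/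
theorem fderiv_apply_self_of_contDiff [Nontrivial V] {j : ℕ} {p : V → F} (hp : IsPosHom j p)
    (hc : ContDiff ℝ ∞ p) (y : V) : fderiv ℝ p y y = (j : ℝ) • p y := by
  rcases eq_or_ne y 0 with rfl | hy
  · rw [map_zero]
    rcases Nat.eq_zero_or_pos j with rfl | hj
    · simp
    · obtain ⟨y, hy⟩ := exists_ne (0 : V)
      rw [map_zero_of_isPosHom hp hc.continuous hy, zero_pow hj.ne', zero_smul, smul_zero]
  · simpa using fderiv_apply_self_of_isPosHom hp hy (hc.differentiable (by simp) y)

/-- A function that is positively homogeneous of degree `j` and smooth at the origin is a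
homogeneous polynomial: by Euler's identity this follows from the same statement for the derivative,
which has degree `j - 1`. -/
theorem IsPosHom.isHomPoly [Nontrivial V] {j : ℕ} {p : V → F} (hp : IsPosHom j p)
    (hc : ContDiff ℝ ∞ p) : IsHomPoly j p := by
  induction j generalizing F with
  | zero =>
    have h0 : ∀ y, p y = p 0 := fun y => by
      rcases eq_or_ne y 0 with rfl | hy
      · rfl
      · simpa using (map_zero_of_isPosHom hp hc.continuous hy).symm
    exact ⟨hc, fun c y => by rw [h0, h0 y, pow_zero, one_smul]⟩
  | succ j ih =>
    have hD : IsHomPoly j (fderiv ℝ p) := by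
      refine ih ?_ (hc.fderiv_right (by simp))
      have := isPosHom_fderiv hp
      rwa [Nat.cast_succ, add_sub_cancel_right] at this
    refine ⟨hc, fun c y => ?_⟩
    have h1 := fderiv_apply_self_of_contDiff hp hc (c • y)
    rw [hD.map_smul, map_smul, smul_apply, fderiv_apply_self_of_contDiff hp hc y, smul_smul,
      mul_comm c, ← pow_succ, smul_comm] at h1
    exact (smul_right_injective F (by positivity : ((j + 1 : ℕ) : ℝ) ≠ 0) h1).symm

theorem IsHomPoly.fderiv [Nontrivial V] {j : ℕ} {p : V → F} (hp : IsHomPoly (j + 1) p) :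
    IsHomPoly j (_root_.fderiv ℝ p) := by
  refine IsPosHom.isHomPoly ?_ (hp.contDiff.fderiv_right (by simp))
  have := isPosHom_fderiv hp.isPosHom
  rwa [Nat.cast_succ, add_sub_cancel_right] at this

theorem IsHomPoly.fderiv_apply_self [Nontrivial V] {j : ℕ} {p : V → F} (hp : IsHomPoly j p)
    (y : V) : _root_.fderiv ℝ p y y = (j : ℝ) • p y :=
  fderiv_apply_self_of_contDiff hp.isPosHom hp.contDiff y

theorem IsHomPoly.eq_const {p : V → F} (hp : IsHomPoly 0 p) (y : V) : p y = p 0 := by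
  simpa using (hp.map_smul 0 y).symm

theorem IsHomPoly.add {j : ℕ} {p q : V → F} (hp : IsHomPoly j p) (hq : IsHomPoly j q) :
    IsHomPoly j (fun y => p y + q y) :=
  ⟨hp.contDiff.add hq.contDiff, fun c y => by rw [hp.map_smul, hq.map_smul, smul_add]⟩

theorem IsHomPoly.const_smul {j : ℕ} {p : V → F} (a : ℝ) (hp : IsHomPoly j p) :
    IsHomPoly j (fun y => a • p y) :=
  ⟨contDiff_const.smul hp.contDiff, fun c y => by rw [hp.map_smul, smul_comm]⟩

theorem IsHomPoly.comp_continuousLinearMap {W : Type} [NormedAddCommGroup W] [NormedSpace ℝ W]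
    {j : ℕ} {p : V → F} (hp : IsHomPoly j p) (A : W →L[ℝ] V) : IsHomPoly j (fun y => p (A y)) :=
  ⟨hp.contDiff.comp A.contDiff, fun c y => by rw [A.map_smul, hp.map_smul]⟩

/-- A family of homogeneous polynomials `P x` that depends smoothly on `(x, y)` for `y ≠ 0`
depends smoothly on `(x, y)`. By Euler's identity `j P x y = (∂_y P x y) y`, the question is
reduced to constant polynomials. -/
theorem contDiffOn_uncurry_of_isHomPoly {X : Type} [NormedAddCommGroup X] [NormedSpace ℝ X]
    [Nontrivial V] {U : Set X} (hU : IsOpen U) (j : ℕ) (P : X → V → F)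
    (hP : ∀ x ∈ U, IsHomPoly j (P x))
    (hG : ContDiffOn ℝ ∞ (fun z : X × V => P z.1 z.2) {z | z.1 ∈ U ∧ z.2 ≠ 0}) :
    ContDiffOn ℝ ∞ (fun z : X × V => P z.1 z.2) {z | z.1 ∈ U} := by
  induction j generalizing F with
  | zero =>
    obtain ⟨e, he⟩ := exists_ne (0 : V)
    have h1 : ContDiffOn ℝ ∞ (fun z : X × V => P z.1 e) {z | z.1 ∈ U} :=
      hG.comp (f := fun z : X × V => (z.1, e)) (by fun_prop) fun z hz => ⟨hz, he⟩
    refine h1.congr fun z hz => ?_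
    rw [(hP z.1 hz).eq_const, (hP z.1 hz).eq_const e]
  | succ j ih =>
    have hopen : IsOpen {z : X × V | z.1 ∈ U ∧ z.2 ≠ 0} :=
      (hU.preimage continuous_fst).inter (isOpen_ne.preimage continuous_snd)
    have h1 := ih (fun x => fderiv ℝ (P x)) (fun x hx => (hP x hx).fderiv) ?_
    · have h2 : ContDiffOn ℝ ∞ (fun z : X × V =>
          ((j + 1 : ℕ) : ℝ)⁻¹ • fderiv ℝ (P z.1) z.2 z.2) {z | z.1 ∈ U} :=
        contDiffOn_const.smul (h1.clm_apply contDiffOn_snd)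
      refine h2.congr fun z hz => ?_
      rw [(hP z.1 hz).fderiv_apply_self, inv_smul_smul₀ (by positivity)]
    · have h2 : ContDiffOn ℝ ∞ (fun z : X × V =>
          (fderiv ℝ (fun z : X × V => P z.1 z.2) z).comp (ContinuousLinearMap.inr ℝ X V))
          {z | z.1 ∈ U ∧ z.2 ≠ 0} :=
        (hG.fderiv_of_isOpen hopen (by simp)).clm_comp contDiffOn_const
      refine h2.congr fun z hz => ?_
      have h3 := ((hG.differentiableOn (by simp)).differentiableAt
        (hopen.mem_nhds hz)).hasFDerivAt
      have h4 : HasFDerivAt (fun y : V => ((z.1, y) : X × V)) (ContinuousLinearMap.inr ℝ X V)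
          z.2 := hasFDerivAt_prodMk_right _ _
      exact (h3.comp z.2 h4).fderiv

end HomPoly

/-! ### One-sided iterated derivatives -/

section IteratedDeriv

open Set

variable {F : Type*} [NormedAddCommGroup F] [NormedSpace ℝ F]

/-- The `j`-th one-sided derivative at `0` sees only the leading coefficient of `t ^ j • h t`. -/
theorem iteratedDerivWithin_pow_smul {ε : ℝ} (hε : 0 < ε) (j : ℕ) {h : ℝ → F}
    (hh : ContDiffOn ℝ ∞ h (Ico 0 ε)) :
    iteratedDerivWithin j (fun t => t ^ j • h t) (Ico 0 ε) 0 = (j.factorial : ℝ) • h 0 := by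
  have hu : UniqueDiffOn ℝ (Ico 0 ε) := uniqueDiffOn_Ico 0 ε
  induction j generalizing h with
  | zero => simp
  | succ j ih =>
    have hd : ContDiffOn ℝ ∞ (derivWithin h (Ico 0 ε)) (Ico 0 ε) := hh.derivWithin hu (by simp)
    rw [iteratedDerivWithin_succ', iteratedDerivWithin_congr
      (g := fun t => t ^ j • (((j + 1 : ℕ) : ℝ) • h t + t • derivWithin h (Ico 0 ε) t))
      ?_ (left_mem_Ico.2 hε)]
    · have h1 : ContDiffOn ℝ ∞ (fun t => ((j + 1 : ℕ) : ℝ) • h t + t • derivWithin h (Ico 0 ε) t)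
          (Ico 0 ε) := (hh.const_smul _).add (contDiffOn_id.smul hd)
      rw [ih h1]
      simp [Nat.factorial_succ, smul_smul, mul_comm]
    · intro t ht
      have h1 : HasDerivWithinAt (fun t : ℝ => t ^ (j + 1)) (((j + 1 : ℕ) : ℝ) * t ^ j)
          (Ico 0 ε) t := by
        simpa using (hasDerivAt_pow (j + 1) t).hasDerivWithinAt
      have h2 := h1.smul ((hh.differentiableOn (by simp) t ht).hasDerivWithinAt)
      refine (h2.derivWithin (hu t ht)).trans ?_
      simp only [smul_add, smul_smul, pow_succ]
      rw [add_comm, mul_comm (t ^ j) ((j + 1 : ℕ) : ℝ)]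

theorem Ici_eventuallyEq_Ico {ε : ℝ} (hε : 0 < ε) : Ici (0 : ℝ) =ᶠ[𝓝 0] Ico 0 ε := by
  filter_upwards [Iio_mem_nhds hε] with t ht
  exact propext ⟨fun h => ⟨h, ht⟩, fun h => h.1⟩

theorem iteratedDerivWithin_Ici_eq {ε : ℝ} (hε : 0 < ε) (j : ℕ) (f : ℝ → F) :
    iteratedDerivWithin j f (Ici 0) 0 = iteratedDerivWithin j f (Ico 0 ε) 0 := by
  simp only [iteratedDerivWithin]
  rw [iteratedFDerivWithin_congr_set (Ici_eventuallyEq_Ico hε)]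

end IteratedDeriv

/-! ### The Laplacian of `|y|^m Q` -/

section Laplacian

open Set Laplacian InnerProductSpace

variable {V : Type} [NormedAddCommGroup V] [InnerProductSpace ℝ V] [FiniteDimensional ℝ V]

theorem laplacian_eq_sum_fderiv {ι : Type*} [Fintype ι] (b : OrthonormalBasis ι ℝ V) (f : V → ℝ)
    (x : V) : Δ f x = ∑ i, fderiv ℝ (fderiv ℝ f) x (b i) (b i) := by
  rw [laplacian_eq_iteratedFDeriv_orthonormalBasis f b]
  simp [iteratedFDeriv_two_apply]

theorem differentiableAt_fderiv {f : V → ℝ} {x : V} (hf : ContDiffAt ℝ 2 f x) :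
    DifferentiableAt ℝ (fderiv ℝ f) x :=
  (hf.fderiv_right (m := 1) (by norm_num)).differentiableAt (by simp)

theorem fderiv_fderiv_apply {f : V → ℝ} {x : V} (hf : ContDiffAt ℝ 2 f x) (v w : V) :
    fderiv ℝ (fun y => fderiv ℝ f y v) x w = fderiv ℝ (fderiv ℝ f) x w v := by
  have h := ((differentiableAt_fderiv hf).hasFDerivAt.clm_apply (hasFDerivAt_const v x)).fderiv
  rw [h]
  simp

theorem laplacian_eq_sum_fderiv_apply {ι : Type*} [Fintype ι] (b : OrthonormalBasis ι ℝ V)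
    {f : V → ℝ} {x : V} (hf : ContDiffAt ℝ 2 f x) :
    Δ f x = ∑ i, fderiv ℝ (fun y => fderiv ℝ f y (b i)) x (b i) := by
  rw [laplacian_eq_sum_fderiv b]
  exact Finset.sum_congr rfl fun i _ => (fderiv_fderiv_apply hf _ _).symm

theorem fderiv_fderiv_apply_comm {f : V → ℝ} {x : V} (hf : ContDiffAt ℝ 2 f x) (v w : V) :
    fderiv ℝ (fun y => fderiv ℝ f y v) x w = fderiv ℝ (fun y => fderiv ℝ f y w) x v := by
  rw [fderiv_fderiv_apply hf, fderiv_fderiv_apply hf]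
  exact hf.isSymmSndFDerivAt (by simp) w v

theorem laplacian_mul {ι : Type*} [Fintype ι] (b : OrthonormalBasis ι ℝ V) {f g : V → ℝ} {x : V}
    (hf : ContDiffAt ℝ 2 f x) (hg : ContDiffAt ℝ 2 g x) :
    Δ (fun y => f y * g y) x = f x * Δ g x + 2 * ∑ i, fderiv ℝ f x (b i) * fderiv ℝ g x (b i)
      + g x * Δ f x := by
  have h1 : fderiv ℝ (fun y => f y * g y) =ᶠ[𝓝 x] fun y =>
      f y • fderiv ℝ g y + g y • fderiv ℝ f y := by
    filter_upwards [hf.eventually (by simp), hg.eventually (by simp)] with y hy1 hy2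
    exact fderiv_fun_mul (hy1.differentiableAt (by simp)) (hy2.differentiableAt (by simp))
  have h2 := ((hf.differentiableAt (by simp)).hasFDerivAt.smul
    (differentiableAt_fderiv hg).hasFDerivAt).add
    ((hg.differentiableAt (by simp)).hasFDerivAt.smul (differentiableAt_fderiv hf).hasFDerivAt)
  rw [laplacian_eq_sum_fderiv b, laplacian_eq_sum_fderiv b, laplacian_eq_sum_fderiv b,
    Finset.mul_sum, Finset.mul_sum, Finset.mul_sum, ← Finset.sum_add_distrib,
    ← Finset.sum_add_distrib]
  refine Finset.sum_congr rfl fun i _ => ?_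
  rw [h1.fderiv_eq]
  have h3 := h2.fderiv
  simp only [Pi.smul_def', Pi.add_def] at h3
  rw [h3]
  simp
  ring

theorem hasFDerivAt_norm {y : V} (hy : y ≠ 0) :
    HasFDerivAt (fun y : V => ‖y‖) (‖y‖⁻¹ • innerSL ℝ y) y := by
  have h1 := (hasStrictFDerivAt_norm_sq y).hasFDerivAt.sqrt (by simpa using hy)
  simp only [Real.sqrt_sq (norm_nonneg _)] at h1
  refine h1.congr_fderiv ?_
  ext v
  have : ‖y‖ ≠ 0 := norm_ne_zero_iff.2 hy
  simp
  field_simp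

theorem sum_fderiv_norm_mul_fderiv {ι : Type*} [Fintype ι] (b : OrthonormalBasis ι ℝ V)
    (f : V → ℝ) {y : V} (hy : y ≠ 0) :
    ∑ i, fderiv ℝ (fun y : V => ‖y‖) y (b i) * fderiv ℝ f y (b i) = ‖y‖⁻¹ * fderiv ℝ f y y := by
  conv_rhs => rw [← b.sum_repr y]
  simp only [(hasFDerivAt_norm hy).fderiv, map_sum, map_smul, Finset.mul_sum, smul_eq_mul]
  refine Finset.sum_congr rfl fun i _ => ?_
  rw [b.sum_repr, b.repr_apply_apply, real_inner_comm]
  simp [mul_assoc]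

theorem laplacian_norm_sq (y : V) :
    Δ (fun y : V => ‖y‖ ^ 2) y = 2 * (Module.finrank ℝ V : ℝ) := by
  let L : V →L[ℝ] V →L[ℝ] ℝ := innerSL ℝ
  have h : fderiv ℝ (fun y : V => ‖y‖ ^ 2) = fun y => (2 • L) y := by
    rw [fderiv_norm_sq]; rfl
  have h2 : ∀ v : V, L v v = ‖v‖ ^ 2 := fun v => real_inner_self_eq_norm_sq v
  rw [laplacian_eq_sum_fderiv (stdOrthonormalBasis ℝ V), h, ContinuousLinearMap.fderiv]
  simp [h2, mul_comm]

theorem laplacian_norm {y : V} (hy : y ≠ 0) :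
    Δ (fun y : V => ‖y‖) y = ((Module.finrank ℝ V : ℝ) - 1) * ‖y‖⁻¹ := by
  have hn : ‖y‖ ≠ 0 := norm_ne_zero_iff.2 hy
  have hc : ContDiffAt ℝ 2 (fun y : V => ‖y‖) y := contDiffAt_norm ℝ hy
  have h1 := laplacian_mul (stdOrthonormalBasis ℝ V) hc hc
  rw [sum_fderiv_norm_mul_fderiv _ _ hy, (hasFDerivAt_norm hy).fderiv] at h1
  have h2 := laplacian_norm_sq y
  simp only [pow_two] at h2
  rw [h2] at h1
  simp only [smul_apply, innerSL_apply_apply, real_inner_self_eq_norm_sq, smul_eq_mul] at h1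
  field_simp at h1 ⊢
  linarith

/-- The Laplacian of `|y| Q` for `Q` homogeneous of degree `q`. -/
theorem laplacian_norm_mul {q : ℤ} {Q : V → ℝ} (hQ : IsPosHom q Q) {y : V} (hy : y ≠ 0)
    (hc : ContDiffAt ℝ 2 Q y) :
    Δ (fun y => ‖y‖ * Q y) y
      = ‖y‖ * Δ Q y + (2 * q + (Module.finrank ℝ V : ℝ) - 1) * ‖y‖⁻¹ * Q y := by
  rw [laplacian_mul (stdOrthonormalBasis ℝ V) (contDiffAt_norm ℝ hy) hc,
    sum_fderiv_norm_mul_fderiv _ _ hy, laplacian_norm hy,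
    fderiv_apply_self_of_isPosHom hQ hy (hc.differentiableAt (by simp)), smul_eq_mul]
  ring

theorem IsPosHom.norm_pow_mul {q : ℤ} {Q : V → ℝ} (hQ : IsPosHom q Q) (m : ℕ) :
    IsPosHom (q + m) (fun y => ‖y‖ ^ m * Q y) := by
  intro c hc y hy
  simp only [hQ c hc y hy, norm_smul, Real.norm_of_nonneg hc.le, smul_eq_mul, mul_pow,
    zpow_add₀ hc.ne', zpow_natCast]
  ring

/-- The Laplacian of `|y| ^ m Q`. For `q = 0` the coefficient of the second term is, up to sign, the
eigenvalue of the spherical harmonics of degree `m`. -/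
theorem laplacian_norm_pow_mul {q : ℤ} {Q : V → ℝ} (hQ : IsPosHom q Q)
    (hc : ContDiffOn ℝ ∞ Q {y | y ≠ 0}) (m : ℕ) {y : V} (hy : y ≠ 0) :
    Δ (fun y => ‖y‖ ^ m * Q y) y = ‖y‖ ^ m * Δ Q y
      + m * (m + 2 * q + (Module.finrank ℝ V : ℝ) - 2) * (‖y‖ ^ m * (‖y‖⁻¹) ^ 2 * Q y) := by
  have hn : ‖y‖ ≠ 0 := norm_ne_zero_iff.2 hy
  induction m with
  | zero => simp
  | succ m ih =>
    have h1 : ContDiffAt ℝ 2 (fun y => ‖y‖ ^ m * Q y) y :=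
      ((contDiffAt_norm ℝ hy).pow m).mul
        ((hc.contDiffAt (isOpen_ne.mem_nhds hy)).of_le ENat.LEInfty.out)
    have h2 := laplacian_norm_mul (hQ.norm_pow_mul m) hy h1
    have e : (fun y : V => ‖y‖ ^ (m + 1) * Q y) = fun y => ‖y‖ * (‖y‖ ^ m * Q y) := by
      ext y; ring
    rw [e, h2, ih]
    push_cast
    field_simp
    ring

theorem contDiffAt_two_of_contDiffOn {Q : V → ℝ} (hc : ContDiffOn ℝ ∞ Q {y | y ≠ 0}) {y : V}
    (hy : y ≠ 0) : ContDiffAt ℝ 2 Q y :=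
  (hc.contDiffAt (isOpen_ne.mem_nhds hy)).of_le ENat.LEInfty.out

end Laplacian

/-! ### Homogeneous harmonic functions -/

section Harmonic

open Set Laplacian InnerProductSpace MeasureTheory

variable {k : ℕ}

theorem clm_apply_eq_sum_basisFun (L : EuclideanSpace ℝ (Fin k) →L[ℝ] ℝ)
    (y : EuclideanSpace ℝ (Fin k)) :
    L y = ∑ i, y i * L (EuclideanSpace.basisFun (Fin k) ℝ i) := by
  conv_lhs => rw [← (EuclideanSpace.basisFun (Fin k) ℝ).sum_repr y]
  simp

/-- The gradient of a harmonic function on `ℝ^k ∖ {0}` that is constant on rays vanishes: multiply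
`Δ H = 0` by `φ H`, where `φ` is a radial cut-off function, and integrate by parts; the derivative
of `φ` does not contribute, since `H` has no radial derivative. -/
theorem fderiv_eq_zero_of_harmonic {H : EuclideanSpace ℝ (Fin k) → ℝ} (hH : IsPosHom 0 H)
    (hc : ContDiffOn ℝ ∞ H {y | y ≠ 0}) (hΔ : ∀ y ≠ 0, Δ H y = 0)
    {y : EuclideanSpace ℝ (Fin k)} (hy : y ≠ 0) : fderiv ℝ H y = 0 := by
  let b := EuclideanSpace.basisFun (Fin k) ℝ
  let χ : ContDiffBump (1 : ℝ) := ⟨1 / 4, 1 / 2, by norm_num, by norm_num⟩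
  let φ : EuclideanSpace ℝ (Fin k) → ℝ := fun y => χ (‖y‖ ^ 2)
  have hφ : ContDiff ℝ ∞ φ := χ.contDiff.comp (contDiff_norm_sq ℝ)
  have hφ0 : ∀ y, ‖y‖ ^ 2 ≤ 1 / 2 → φ y = 0 := by
    intro y hy
    refine χ.zero_of_le_dist ?_
    rw [Real.dist_eq, abs_of_nonpos (by linarith)]
    change 1 / 2 ≤ _
    linarith
  have hφ1 : ∀ y, 3 / 2 ≤ ‖y‖ ^ 2 → φ y = 0 := by
    intro y hy
    refine χ.zero_of_le_dist ?_
    rw [Real.dist_eq, abs_of_nonneg (by linarith)]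
    change 1 / 2 ≤ _
    linarith
  have hφz : φ =ᶠ[𝓝 0] fun _ => 0 := by
    have : ∀ᶠ y : EuclideanSpace ℝ (Fin k) in 𝓝 0, ‖y‖ ^ 2 < 1 / 2 := by
      have : ContinuousAt (fun y : EuclideanSpace ℝ (Fin k) => ‖y‖ ^ 2) 0 := by fun_prop
      exact this.eventually_lt_const (by norm_num)
    filter_upwards [this] with y hy using hφ0 y hy.le
  have hφr : ∀ y, fderiv ℝ φ y = (2 * deriv χ (‖y‖ ^ 2)) • innerSL ℝ y := by
    intro y
    have h1 := (χ.contDiff (n := 1)).differentiable (by simp) (‖y‖ ^ 2) |>.hasDerivAt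
    have h2 := h1.comp_hasFDerivAt y (hasStrictFDerivAt_norm_sq y).hasFDerivAt
    have h3 : fderiv ℝ φ y = _ := h2.fderiv
    rw [h3]
    ext v
    simp
    ring
  -- the components of the vector field `φ H ∇H`
  let G : Fin k → EuclideanSpace ℝ (Fin k) → ℝ := fun i y => φ y * (H y * fderiv ℝ H y (b i))
  have hcd : ∀ i, ContDiffOn ℝ ∞ (fun y => fderiv ℝ H y (b i)) {y | y ≠ 0} := fun i =>
    (hc.fderiv_of_isOpen isOpen_ne (by simp)).clm_apply contDiffOn_const
  have hG : ∀ i, ContDiff ℝ ∞ (G i) := by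
    intro i
    rw [contDiff_iff_contDiffAt]
    intro y
    rcases eq_or_ne y 0 with rfl | hy
    · refine (contDiffAt_const (c := (0 : ℝ))).congr_of_eventuallyEq ?_
      filter_upwards [hφz] with y hy
      simp [G, hy]
    · exact hφ.contDiffAt.mul ((hc.mul (hcd i)).contDiffAt (isOpen_ne.mem_nhds hy))
  have hGs : ∀ i, HasCompactSupport (G i) := by
    intro i
    refine HasCompactSupport.of_support_subset_isCompact
      (isCompact_closedBall (0 : EuclideanSpace ℝ (Fin k)) 2) fun y hy => ?_
    rw [mem_closedBall_zero_iff]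
    by_contra hlt
    push Not at hlt
    refine hy ?_
    simp only [G, hφ1 y (by nlinarith), zero_mul]
  have hint : ∀ i, ∫ y, fderiv ℝ (G i) y (b i) = 0 := by
    intro i
    have hi1 : Integrable (G i) := (hG i).continuous.integrable_of_hasCompactSupport (hGs i)
    have hi2 : Integrable (fun y => fderiv ℝ (G i) y (b i)) := by
      refine Continuous.integrable_of_hasCompactSupport ?_ ?_
      · exact ((hG i).continuous_fderiv (by simp)).clm_apply continuous_const
      · exact (hGs i).fderiv_apply ℝ (b i)
    have := integral_mul_fderiv_eq_neg_fderiv_mul_of_integrable (μ := volume)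
      (f := fun _ : EuclideanSpace ℝ (Fin k) => (1 : ℝ)) (g := G i) (v := b i)
      (by simp) (by simpa using hi2) (by simpa using hi1) (by simp)
      (fun y _ => (hG i).differentiable (by simp) y)
    simpa using this
  let Q : EuclideanSpace ℝ (Fin k) → ℝ := fun y => ∑ i, fderiv ℝ (G i) y (b i)
  have hQ : ∀ y, Q y = φ y * ∑ i, (fderiv ℝ H y (b i)) ^ 2 := by
    intro y
    rcases eq_or_ne y 0 with rfl | hy
    · have h1 : ∀ i, G i =ᶠ[𝓝 0] fun _ => 0 := fun i => by
        filter_upwards [hφz] with y hy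
        simp [G, hy]
      have h2 : φ 0 = 0 := hφz.self_of_nhds
      simp [Q, (h1 _).fderiv_eq, h2]
    · have hH1 := (hc.differentiableOn (by simp)).differentiableAt (isOpen_ne.mem_nhds hy)
      have h1 : ∀ i, fderiv ℝ (G i) y (b i) = φ y * (fderiv ℝ H y (b i)) ^ 2
          + φ y * H y * fderiv ℝ (fun y => fderiv ℝ H y (b i)) y (b i)
          + H y * (fderiv ℝ H y (b i) * fderiv ℝ φ y (b i)) := by
        intro i
        have h2 := ((hcd i).differentiableOn (by simp)).differentiableAt (isOpen_ne.mem_nhds hy)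
        have h3 := (hφ.differentiable (by simp) y).hasFDerivAt.mul
          (hH1.hasFDerivAt.mul h2.hasFDerivAt)
        have h4 : fderiv ℝ (G i) y = _ := h3.fderiv
        rw [h4]
        simp
        ring
      have h5 : ∑ i, fderiv ℝ H y (b i) * fderiv ℝ φ y (b i) = 0 := by
        have h6 := fderiv_apply_self_of_isPosHom hH hy hH1
        rw [clm_apply_eq_sum_basisFun, Int.cast_zero, zero_smul] at h6
        simp only [hφr, smul_apply, innerSL_apply_apply, smul_eq_mul]
        rw [← mul_zero (2 * deriv χ (‖y‖ ^ 2)), ← h6, Finset.mul_sum]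
        refine Finset.sum_congr rfl fun i _ => ?_
        have : inner ℝ y (b i) = y i := by simp [b, EuclideanSpace.inner_single_right]
        rw [this]
        ring
      have h7 := hΔ y hy
      rw [laplacian_eq_sum_fderiv_apply b (contDiffAt_two_of_contDiffOn hc hy)] at h7
      simp only [Q, h1, Finset.sum_add_distrib, ← Finset.mul_sum, h7, h5, mul_zero, add_zero]
  have hQc : Continuous Q := continuous_finsetSum _ fun i _ =>
    ((hG i).continuous_fderiv (by simp)).clm_apply continuous_const
  have hQs : HasCompactSupport Q := by
    refine HasCompactSupport.of_support_subset_isCompact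
      (isCompact_closedBall (0 : EuclideanSpace ℝ (Fin k)) 2) fun y hy => ?_
    rw [mem_closedBall_zero_iff]
    by_contra hlt
    push Not at hlt
    refine hy ?_
    rw [hQ, hφ1 y (by nlinarith), zero_mul]
  have hQn : 0 ≤ Q := fun y => by
    rw [hQ]
    exact mul_nonneg χ.nonneg (Finset.sum_nonneg fun i _ => sq_nonneg _)
  have hQ0 : ∫ y, Q y = 0 := by
    simp only [Q]
    rw [integral_finsetSum]
    · simp [hint]
    · intro i _
      refine Continuous.integrable_of_hasCompactSupport ?_ ?_
      · exact ((hG i).continuous_fderiv (by simp)).clm_apply continuous_const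
      · exact (hGs i).fderiv_apply ℝ (b i)
  have hQz : ∀ y, Q y = 0 := by
    intro y
    by_contra hne
    exact (hQc.integral_pos_of_hasCompactSupport_nonneg_nonzero hQs hQn hne).ne' hQ0
  have hu : ∀ y, ‖y‖ = 1 → fderiv ℝ H y = 0 := by
    intro y hy
    have h1 := hQz y
    have h2 : φ y = 1 := by
      simp only [φ, hy, one_pow]
      exact χ.one_of_mem_closedBall (by simp [χ.rIn_pos.le])
    rw [hQ, h2, one_mul, Finset.sum_eq_zero_iff_of_nonneg fun i _ => sq_nonneg _] at h1
    refine ContinuousLinearMap.coe_injective (b.toBasis.ext fun i => ?_)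
    simpa using h1 i (Finset.mem_univ _)
  have h := isPosHom_fderiv hH ‖y‖ (norm_pos_iff.2 hy) (direction y) (direction_ne_zero hy)
  rw [norm_smul_direction, hu _ (norm_direction hy), smul_zero] at h
  exact h

/-- For `k ≥ 2` the complement of the origin is connected, so that a harmonic function constant on
rays is constant. -/
theorem eq_of_harmonic (hk : 2 ≤ k) {H : EuclideanSpace ℝ (Fin k) → ℝ} (hH : IsPosHom 0 H)
    (hc : ContDiffOn ℝ ∞ H {y | y ≠ 0}) (hΔ : ∀ y ≠ 0, Δ H y = 0)
    {y z : EuclideanSpace ℝ (Fin k)} (hy : y ≠ 0) (hz : z ≠ 0) : H y = H z := by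
  have h1 : IsPreconnected ({0}ᶜ : Set (EuclideanSpace ℝ (Fin k))) := by
    refine (isConnected_compl_singleton_of_one_lt_rank ?_ 0).isPreconnected
    rw [← Module.finrank_eq_rank, finrank_euclideanSpace_fin]
    exact_mod_cast hk
  exact isOpen_compl_singleton.is_const_of_fderiv_eq_zero (𝕜 := ℝ) h1
    (hc.differentiableOn (by simp)) (fun y hy => fderiv_eq_zero_of_harmonic hH hc hΔ hy) hy hz

/-- The partial derivatives of a harmonic function are harmonic. -/
theorem laplacian_fderiv_apply {H : EuclideanSpace ℝ (Fin k) → ℝ}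
    (hc : ContDiffOn ℝ ∞ H {y | y ≠ 0}) (hΔ : ∀ y ≠ 0, Δ H y = 0)
    {y : EuclideanSpace ℝ (Fin k)} (hy : y ≠ 0) (v : EuclideanSpace ℝ (Fin k)) :
    Δ (fun y => fderiv ℝ H y v) y = 0 := by
  let b := EuclideanSpace.basisFun (Fin k) ℝ
  have hcd : ∀ w, ContDiffOn ℝ ∞ (fun y => fderiv ℝ H y w) {y | y ≠ 0} := fun w =>
    (hc.fderiv_of_isOpen isOpen_ne (by simp)).clm_apply contDiffOn_const
  have hcdd : ∀ w, ContDiffOn ℝ ∞ (fun y => fderiv ℝ (fun y => fderiv ℝ H y w) y w)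
      {y | y ≠ 0} := fun w =>
    ((hcd w).fderiv_of_isOpen isOpen_ne (by simp)).clm_apply contDiffOn_const
  rw [laplacian_eq_sum_fderiv_apply b (contDiffAt_two_of_contDiffOn (hcd v) hy)]
  have h1 : ∀ i, fderiv ℝ (fun y => fderiv ℝ (fun y => fderiv ℝ H y v) y (b i)) y (b i)
      = fderiv ℝ (fun y => fderiv ℝ (fun y => fderiv ℝ H y (b i)) y (b i)) y v := by
    intro i
    have h2 : (fun y => fderiv ℝ (fun y => fderiv ℝ H y v) y (b i)) =ᶠ[𝓝 y]
        fun y => fderiv ℝ (fun y => fderiv ℝ H y (b i)) y v := by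
      filter_upwards [isOpen_ne.mem_nhds hy] with z hz
      exact fderiv_fderiv_apply_comm (contDiffAt_two_of_contDiffOn hc hz) _ _
    rw [h2.fderiv_eq]
    exact fderiv_fderiv_apply_comm (contDiffAt_two_of_contDiffOn (hcd _) hy) _ _
  have h3 : (fun y => ∑ i, fderiv ℝ (fun y => fderiv ℝ H y (b i)) y (b i)) =ᶠ[𝓝 y]
      fun _ => 0 := by
    filter_upwards [isOpen_ne.mem_nhds hy] with z hz
    rw [← laplacian_eq_sum_fderiv_apply b (contDiffAt_two_of_contDiffOn hc hz)]
    exact hΔ z hz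
  have h4 := h3.fderiv_eq (𝕜 := ℝ)
  rw [fderiv_fun_sum fun i _ =>
    ((hcdd _).differentiableOn (by simp)).differentiableAt (isOpen_ne.mem_nhds hy)] at h4
  simp only [h1]
  have h5 := congrArg (fun L : EuclideanSpace ℝ (Fin k) →L[ℝ] ℝ => L v) h4
  simpa using h5

/-- A harmonic function on `ℝ^k ∖ {0}`, `k ≥ 2`, that is positively homogeneous of degree `j ≥ 0`
is a polynomial: its partial derivatives are, by induction on `j`, and they determine it by Euler's
identity. -/
theorem exists_isHomPoly_of_harmonic (hk : 2 ≤ k) (j : ℕ) {H : EuclideanSpace ℝ (Fin k) → ℝ}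
    (hH : IsPosHom j H) (hc : ContDiffOn ℝ ∞ H {y | y ≠ 0}) (hΔ : ∀ y ≠ 0, Δ H y = 0) :
    ∃ p : EuclideanSpace ℝ (Fin k) → ℝ, IsHomPoly j p ∧ ∀ y ≠ 0, p y = H y := by
  induction j generalizing H with
  | zero =>
    have hk0 : 0 < k := by omega
    let e : EuclideanSpace ℝ (Fin k) := EuclideanSpace.single ⟨0, hk0⟩ 1
    have he : e ≠ 0 := by simp [e]
    refine ⟨fun _ => H e, ⟨contDiff_const, by simp⟩, fun y hy => ?_⟩
    exact eq_of_harmonic hk (by simpa using hH) hc hΔ he hy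
  | succ j ih =>
    let b := EuclideanSpace.basisFun (Fin k) ℝ
    have h1 : ∀ i, ∃ p : EuclideanSpace ℝ (Fin k) → ℝ, IsHomPoly j p ∧
        ∀ y ≠ 0, p y = fderiv ℝ H y (b i) := by
      intro i
      refine ih ?_ ?_ fun y hy => laplacian_fderiv_apply hc hΔ hy _
      · intro c hc y hy
        have := isPosHom_fderiv hH c hc y hy
        rw [Nat.cast_succ, add_sub_cancel_right] at this
        simp only [this, smul_apply]
      · exact (hc.fderiv_of_isOpen isOpen_ne (by simp)).clm_apply contDiffOn_const
    choose p hp hpH using h1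
    refine ⟨fun y => ((j + 1 : ℕ) : ℝ)⁻¹ * ∑ i, y i * p i y, ⟨?_, ?_⟩, fun y hy => ?_⟩
    · refine contDiff_const.mul (ContDiff.sum fun i _ => ContDiff.mul ?_ (hp i).contDiff)
      exact (EuclideanSpace.proj (𝕜 := ℝ) i).contDiff
    · intro c y
      simp only [(hp _).map_smul, PiLp.smul_apply, smul_eq_mul, Finset.mul_sum]
      refine Finset.sum_congr rfl fun i _ => ?_
      ring
    · have h2 := fderiv_apply_self_of_isPosHom hH hy
        ((hc.differentiableOn (by simp)).differentiableAt (isOpen_ne.mem_nhds hy))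
      rw [clm_apply_eq_sum_basisFun, Int.cast_natCast, smul_eq_mul] at h2
      rw [inv_mul_eq_iff_eq_mul₀ (by positivity), ← h2]
      exact Finset.sum_congr rfl fun i _ => by rw [hpH i y hy]

end Harmonic

/-! ### Spherical harmonics -/

section SphericalHarmonics

open Set Laplacian InnerProductSpace

variable {k : ℕ}

theorem one_le_of_nontrivial [Nontrivial (EuclideanSpace ℝ (Fin k))] : 1 ≤ k := by
  by_contra hk
  obtain rfl : k = 0 := by omega
  exact not_nontrivial _ ‹Nontrivial (EuclideanSpace ℝ (Fin 0))›

theorem IsPosHom.laplacian {j : ℤ} {f : EuclideanSpace ℝ (Fin k) → ℝ} (hf : IsPosHom j f) :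
    IsPosHom (j - 2) (Δ f) := by
  intro c hc y hy
  have h := isPosHom_fderiv (isPosHom_fderiv hf) c hc y hy
  rw [laplacian_eq_sum_fderiv (EuclideanSpace.basisFun (Fin k) ℝ),
    laplacian_eq_sum_fderiv (EuclideanSpace.basisFun (Fin k) ℝ), h, Finset.smul_sum]
  refine Finset.sum_congr rfl fun i _ => ?_
  rw [smul_apply, smul_apply, sub_sub, one_add_one_eq_two]

theorem radialExtension_of_ne_zero (u : Metric.sphere (0 : EuclideanSpace ℝ (Fin k)) 1 → ℝ)
    {y : EuclideanSpace ℝ (Fin k)} (hy : y ≠ 0) :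
    radialExtension u y = u ⟨direction y, by simpa using norm_direction hy⟩ := by
  rw [radialExtension, dif_pos hy]
  rfl

theorem radialExtension_coe (u : Metric.sphere (0 : EuclideanSpace ℝ (Fin k)) 1 → ℝ)
    (ξ : Metric.sphere (0 : EuclideanSpace ℝ (Fin k)) 1) : radialExtension u ξ = u ξ := by
  have h1 : ‖(ξ : EuclideanSpace ℝ (Fin k))‖ = 1 := norm_eq_of_mem_sphere ξ
  rw [radialExtension_of_ne_zero u (ne_zero_of_mem_unit_sphere ξ)]
  congr 1
  exact Subtype.ext (direction_of_norm_eq_one h1)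

theorem isPosHom_radialExtension (u : Metric.sphere (0 : EuclideanSpace ℝ (Fin k)) 1 → ℝ) :
    IsPosHom 0 (radialExtension u) := by
  intro c hc y hy
  rw [zpow_zero, one_smul, radialExtension_of_ne_zero u hy,
    radialExtension_of_ne_zero u (smul_ne_zero hc.ne' hy)]
  simp only [direction_smul hc]

/-- The extension of `u` to `ℝ^k ∖ {0}` as a positively homogeneous function of degree `m`. -/
def homExtension (m : ℕ) (u : Metric.sphere (0 : EuclideanSpace ℝ (Fin k)) 1 → ℝ)
    (y : EuclideanSpace ℝ (Fin k)) : ℝ :=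
  ‖y‖ ^ m * radialExtension u y

theorem isPosHom_homExtension (m : ℕ)
    (u : Metric.sphere (0 : EuclideanSpace ℝ (Fin k)) 1 → ℝ) : IsPosHom m (homExtension m u) := by
  have := (isPosHom_radialExtension u).norm_pow_mul m
  rwa [zero_add] at this

theorem homExtension_coe (m : ℕ) (u : Metric.sphere (0 : EuclideanSpace ℝ (Fin k)) 1 → ℝ)
    (ξ : Metric.sphere (0 : EuclideanSpace ℝ (Fin k)) 1) : homExtension m u ξ = u ξ := by
  rw [homExtension, radialExtension_coe, norm_eq_of_mem_sphere, one_pow, one_mul]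

theorem contDiffOn_homExtension (m : ℕ)
    {u : Metric.sphere (0 : EuclideanSpace ℝ (Fin k)) 1 → ℝ}
    (hu : ContDiffOn ℝ ∞ (radialExtension u) {y | y ≠ 0}) :
    ContDiffOn ℝ ∞ (homExtension m u) {y | y ≠ 0} :=
  (contDiffOn_norm_ne.pow m).mul hu

theorem eq_homExtension_of_isPosHom {m : ℕ}
    {u : Metric.sphere (0 : EuclideanSpace ℝ (Fin k)) 1 → ℝ} {p : EuclideanSpace ℝ (Fin k) → ℝ}
    (hp : IsPosHom m p) (hu : ∀ ξ : Metric.sphere (0 : EuclideanSpace ℝ (Fin k)) 1, p ξ = u ξ)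
    {y : EuclideanSpace ℝ (Fin k)} (hy : y ≠ 0) : p y = homExtension m u y := by
  have h := hp ‖y‖ (norm_pos_iff.2 hy) (direction y) (direction_ne_zero hy)
  rw [norm_smul_direction, zpow_natCast, smul_eq_mul] at h
  rw [h, homExtension, radialExtension_of_ne_zero u hy]
  congr 1
  exact hu ⟨direction y, by simpa using norm_direction hy⟩

theorem contDiffOn_radialExtension {m : ℕ}
    {u : Metric.sphere (0 : EuclideanSpace ℝ (Fin k)) 1 → ℝ} {p : EuclideanSpace ℝ (Fin k) → ℝ}
    (hp : IsHomPoly m p)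
    (hu : ∀ ξ : Metric.sphere (0 : EuclideanSpace ℝ (Fin k)) 1, p ξ = u ξ) :
    ContDiffOn ℝ ∞ (radialExtension u) {y | y ≠ 0} := by
  refine (hp.contDiff.comp_contDiffOn contDiffOn_direction).congr fun y hy => ?_
  rw [radialExtension_of_ne_zero u hy]
  exact (hu ⟨direction y, by simpa using norm_direction hy⟩).symm

/-- The eigenvalue equation of the spherical Laplacian on degree `m` is Laplace's equation for the
homogeneous extension of degree `m`. -/
theorem laplacian_homExtension (m : ℕ) {u : Metric.sphere (0 : EuclideanSpace ℝ (Fin k)) 1 → ℝ}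
    (hu : ContDiffOn ℝ ∞ (radialExtension u) {y | y ≠ 0})
    (ξ : Metric.sphere (0 : EuclideanSpace ℝ (Fin k)) 1) :
    Δ (homExtension m u) (ξ : EuclideanSpace ℝ (Fin k))
      = sphericalLaplacian u ξ + (m : ℝ) * ((m : ℝ) + (k : ℝ) - 2) * u ξ := by
  have h1 : ‖(ξ : EuclideanSpace ℝ (Fin k))‖ = 1 := norm_eq_of_mem_sphere ξ
  have h := laplacian_norm_pow_mul (isPosHom_radialExtension u) hu m
    (ne_zero_of_mem_unit_sphere ξ)
  simp only [h1, one_pow, one_mul, inv_one, radialExtension_coe, finrank_euclideanSpace_fin,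
    Int.cast_zero, mul_zero, add_zero] at h
  exact h

/-- Functions with the two properties of a spherical harmonic of degree `m` on `𝕊^{k-1}` are
restrictions of homogeneous polynomials. For `k ≥ 2` the homogeneous extension is harmonic. For
`k = 1` the eigenvalue equation forces `u = 0` unless `m ≤ 1`, and then the parity condition
says that `u` is the restriction of a multiple of `y ^ m`. -/
theorem exists_isHomPoly_of_sphericalLaplacian (hk : 1 ≤ k) (m : ℕ)
    {u : Metric.sphere (0 : EuclideanSpace ℝ (Fin k)) 1 → ℝ}
    (hu : ContDiffOn ℝ ∞ (radialExtension u) {y | y ≠ 0})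
    (hΔ : ∀ ξ, sphericalLaplacian u ξ + (m : ℝ) * ((m : ℝ) + (k : ℝ) - 2) * u ξ = 0)
    (hpar : k = 1 → ∀ ξ, u (-ξ) = (-1) ^ m * u ξ) :
    ∃ p : EuclideanSpace ℝ (Fin k) → ℝ, IsHomPoly m p ∧ ∀ ξ : Metric.sphere _ _, p ξ = u ξ := by
  rcases eq_or_lt_of_le hk with hk1 | hk2
  · subst hk1
    -- on a line the radial extension is locally constant, so that its Laplacian vanishes
    have hsphere : ∀ ξ : Metric.sphere (0 : EuclideanSpace ℝ (Fin 1)) 1,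
        sphericalLaplacian u ξ = 0 := by
      intro ξ
      have hξ : (ξ : EuclideanSpace ℝ (Fin 1)) 0 ≠ 0 := by
        intro h
        refine ne_zero_of_mem_unit_sphere ξ (PiLp.ext fun i => ?_)
        rw [Subsingleton.elim i 0, h]
        rfl
      have h1 : radialExtension u =ᶠ[𝓝 (ξ : EuclideanSpace ℝ (Fin 1))] fun _ => u ξ := by
        have h2 : ∀ᶠ y : EuclideanSpace ℝ (Fin 1) in 𝓝 (ξ : EuclideanSpace ℝ (Fin 1)),
            0 < y 0 / (ξ : EuclideanSpace ℝ (Fin 1)) 0 := by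
          have : ContinuousAt (fun y : EuclideanSpace ℝ (Fin 1) =>
            y 0 / (ξ : EuclideanSpace ℝ (Fin 1)) 0) ξ := by fun_prop
          refine this.eventually_const_lt ?_
          simp [div_self hξ]
        filter_upwards [h2] with y hy
        have h3 := isPosHom_radialExtension u _ hy (ξ : EuclideanSpace ℝ (Fin 1))
          (ne_zero_of_mem_unit_sphere ξ)
        rw [zpow_zero, one_smul, radialExtension_coe] at h3
        rw [← h3]
        congr 1
        refine PiLp.ext fun i => ?_
        rw [Subsingleton.elim i 0]
        simp [hξ]
      rw [sphericalLaplacian, (laplacian_congr_nhds h1).self_of_nhds]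
      simp
    let e : Metric.sphere (0 : EuclideanSpace ℝ (Fin 1)) 1 := ⟨EuclideanSpace.single 0 1, by simp⟩
    have he : ∀ ξ : Metric.sphere (0 : EuclideanSpace ℝ (Fin 1)) 1, ξ = e ∨ ξ = -e := by
      intro ξ
      have h1 : ‖(ξ : EuclideanSpace ℝ (Fin 1))‖ = 1 := norm_eq_of_mem_sphere ξ
      rw [EuclideanSpace.norm_eq] at h1
      simp only [Real.norm_eq_abs, sq_abs, Real.sqrt_eq_one, Finset.univ_unique,
        Finset.sum_singleton] at h1
      rcases sq_eq_one_iff.1 h1 with h | h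
      · exact Or.inl (Subtype.ext (PiLp.ext fun i => by
          rw [Subsingleton.elim i 0]; simpa [e] using h))
      · exact Or.inr (Subtype.ext (PiLp.ext fun i => by
          rw [Subsingleton.elim i 0]; simpa [e] using h))
    -- the eigenvalue `m (m - 1)` vanishes only for `m ≤ 1`
    by_cases hm : m ≤ 1
    · refine ⟨fun y => y 0 ^ m * u e, ⟨?_, fun c y => ?_⟩, fun ξ => ?_⟩
      · exact ((EuclideanSpace.proj (𝕜 := ℝ) (0 : Fin 1)).contDiff.pow m).mul contDiff_const
      · simp [mul_pow, mul_assoc]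
      · rcases he ξ with rfl | rfl
        · simp [e]
        · rw [hpar rfl e]
          simp [e]
    · refine ⟨fun _ => 0, ⟨contDiff_const, by simp⟩, fun ξ => ?_⟩
      have h1 := hΔ ξ
      rw [hsphere, zero_add] at h1
      have h2 : (2 : ℝ) ≤ m := by exact_mod_cast Nat.lt_of_not_le hm
      have h3 : (m : ℝ) * ((m : ℝ) + ((1 : ℕ) : ℝ) - 2) ≠ 0 := by
        push_cast
        have : (0 : ℝ) < m + 1 - 2 := by linarith
        positivity
      exact ((mul_eq_zero.1 h1).resolve_left h3).symm
  · have h0 : ∀ y ≠ 0, Δ (homExtension m u) y = 0 := by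
      intro y hy
      have h1 := (isPosHom_homExtension m u).laplacian ‖y‖ (norm_pos_iff.2 hy) (direction y)
        (direction_ne_zero hy)
      have h2 := laplacian_homExtension m hu ⟨direction y, by simpa using norm_direction hy⟩
      rw [hΔ] at h2
      rw [norm_smul_direction] at h1
      rw [h1]
      exact smul_eq_zero_of_right _ h2
    obtain ⟨p, hp, hpu⟩ := exists_isHomPoly_of_harmonic hk2 m (isPosHom_homExtension m u)
      (contDiffOn_homExtension m hu) h0
    refine ⟨p, hp, fun ξ => ?_⟩
    rw [hpu _ (ne_zero_of_mem_unit_sphere ξ), homExtension_coe]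

end SphericalHarmonics

/-! ### The geodesic spray -/

section Spray

open Set

set_option maxSynthPendingDepth 6

variable {E : Type} [NormedAddCommGroup E] [NormedSpace ℝ E] [FiniteDimensional ℝ E]

theorem exists_equiv_of_pos {L : E →L[ℝ] E →L[ℝ] ℝ} (hL : ∀ v ≠ 0, 0 < L v v) :
    ∃ e : E ≃L[ℝ] (E →L[ℝ] ℝ), (e : E →L[ℝ] E →L[ℝ] ℝ) = L := by
  have hinj : Function.Injective L := by
    rw [injective_iff_map_eq_zero]
    intro v hv
    by_contra h
    have := hL v h
    rw [hv] at this
    simp at this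
  have hdim : Module.finrank ℝ E = Module.finrank ℝ (E →L[ℝ] ℝ) := by
    rw [← (LinearMap.toContinuousLinearMap (𝕜 := ℝ) (E := E) (F' := ℝ)).finrank_eq]
    exact (Subspace.dual_finrank_eq (K := ℝ) (V := E)).symm
  let e := LinearEquiv.ofInjectiveOfFinrankEq (L : E →ₗ[ℝ] E →L[ℝ] ℝ) hinj hdim
  refine ⟨e.toContinuousLinearEquiv, ?_⟩
  ext v w
  rfl

/-- The Christoffel symbols of the first kind `Γ(a, a; ·)` of a metric `G`. -/
def sprayCovector (G : E → E →L[ℝ] E →L[ℝ] ℝ) (z a : E) : E →L[ℝ] ℝ :=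
  fderiv ℝ G z a a - (1 / 2 : ℝ) • ((fderiv ℝ G z).flip a).flip a

/-- The geodesic spray of a metric `G`: the geodesic equation is `c'' = spray G c c'`. -/
def spray (G : E → E →L[ℝ] E →L[ℝ] ℝ) (z a : E) : E :=
  -(G z).inverse (sprayCovector G z a)

theorem sprayCovector_apply (G : E → E →L[ℝ] E →L[ℝ] ℝ) (z a c : E) :
    sprayCovector G z a c = fderiv ℝ G z a a c - (1 / 2) * fderiv ℝ G z c a a := rfl

theorem sprayCovector_smul (G : E → E →L[ℝ] E →L[ℝ] ℝ) (z a : E) (r : ℝ) :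
    sprayCovector G z (r • a) = r ^ 2 • sprayCovector G z a := by
  ext c
  simp only [sprayCovector_apply, map_smul, smul_apply, smul_eq_mul]
  ring

theorem spray_smul (G : E → E →L[ℝ] E →L[ℝ] ℝ) (z a : E) (r : ℝ) :
    spray G z (r • a) = r ^ 2 • spray G z a := by
  rw [spray, spray, sprayCovector_smul, map_smul, smul_neg]

theorem eq_spray_iff {G : E → E →L[ℝ] E →L[ℝ] ℝ} {z : E} (hpos : ∀ v ≠ 0, 0 < G z v v)
    (a b : E) : b = spray G z a ↔ ∀ w, G z b w + sprayCovector G z a w = 0 := by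
  obtain ⟨e, he⟩ := exists_equiv_of_pos hpos
  rw [spray, ← he, ContinuousLinearMap.inverse_equiv]
  constructor
  · rintro rfl w
    simp
  · intro h
    have : e b = -sprayCovector G z a := by
      ext w
      have := h w
      simp only [ContinuousLinearEquiv.coe_coe] at this
      simp only [neg_apply]
      linarith
    rw [← e.symm_apply_apply b, this]
    simp

variable {O : Set E} {G : E → E →L[ℝ] E →L[ℝ] ℝ}

theorem contDiffOn_spray (hO : IsOpen O) (hG : ContDiffOn ℝ ∞ G O)
    (hpos : ∀ z ∈ O, ∀ v ≠ 0, 0 < G z v v) :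
    ContDiffOn ℝ ∞ (fun w : E × E => spray G w.1 w.2) {w | w.1 ∈ O} := by
  have h1 : ContDiffOn ℝ ∞ (fun w : E × E => (G w.1).inverse) {w | w.1 ∈ O} := by
    intro w hw
    obtain ⟨e, he⟩ := exists_equiv_of_pos (hpos w.1 hw)
    have h2 := contDiffAt_map_inverse (n := ∞) e
    rw [he] at h2
    exact h2.comp_contDiffWithinAt w
      ((hG w.1 hw).comp w contDiffWithinAt_fst fun _ h => h)
  have hD : ContDiffOn ℝ ∞ (fun w : E × E => fderiv ℝ G w.1) {w | w.1 ∈ O} :=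
    (hG.fderiv_of_isOpen (m := ∞) hO (by simp)).comp contDiffOn_fst fun _ h => h
  have h3 : ContDiffOn ℝ ∞ (fun w : E × E => sprayCovector G w.1 w.2) {w | w.1 ∈ O} := by
    rw [contDiffOn_clm_apply]
    intro c
    simp only [sprayCovector_apply]
    have e1 := ((hD.clm_apply contDiffOn_snd).clm_apply contDiffOn_snd).clm_apply
      (contDiffOn_const (c := c))
    have e2 := ((hD.clm_apply (contDiffOn_const (c := c))).clm_apply contDiffOn_snd).clm_apply
      contDiffOn_snd
    exact e1.sub (contDiffOn_const.mul e2)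
  exact (h1.clm_apply h3).neg

/-- Integral curves of smooth vector fields exist and are smooth. -/
theorem exists_contDiffOn_integralCurve {F : Type} [NormedAddCommGroup F] [NormedSpace ℝ F]
    [CompleteSpace F] {A : Set F} (hA : IsOpen A) {X : F → F} (hX : ContDiffOn ℝ ∞ X A) {x₀ : F}
    (hx₀ : x₀ ∈ A) : ∃ α : ℝ → F, α 0 = x₀ ∧ ∃ δ > 0, ContDiffOn ℝ ∞ α (Ioo (-δ) δ) ∧
      ∀ t ∈ Ioo (-δ) δ, α t ∈ A ∧ HasDerivAt α (X (α t)) t := by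
  obtain ⟨α, hα0, ε, hε, hα⟩ :=
    ((hX.contDiffAt (hA.mem_nhds hx₀)).of_le
      (by simp)).exists_forall_mem_closedBall_exists_eq_forall_mem_Ioo_hasDerivAt₀ 0
  have hc : ContinuousAt α 0 := (hα 0 (by simp [hε])).continuousAt
  have hev : ∀ᶠ t in 𝓝 (0 : ℝ), α t ∈ A := hc (by rw [hα0]; exact hA.mem_nhds hx₀)
  obtain ⟨r, hr, hrA⟩ := Metric.eventually_nhds_iff.1 hev
  refine ⟨α, hα0, min ε r, lt_min hε hr, ?_⟩
  have hall : ∀ t ∈ Ioo (-(min ε r)) (min ε r), α t ∈ A ∧ HasDerivAt α (X (α t)) t := by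
    intro t ht
    have h1 := abs_lt.2 ht
    refine ⟨hrA (by simpa using h1.trans_le (min_le_right _ _)), hα t ?_⟩
    rw [zero_sub, zero_add]
    exact abs_lt.1 (h1.trans_le (min_le_left _ _))
  refine ⟨?_, hall⟩
  rw [contDiffOn_infty]
  intro m
  induction m with
  | zero =>
    rw [Nat.cast_zero, contDiffOn_zero]
    exact fun t ht => (hall t ht).2.continuousAt.continuousWithinAt
  | succ m ih =>
    rw [Nat.cast_succ, contDiffOn_succ_iff_deriv_of_isOpen isOpen_Ioo]
    refine ⟨fun t ht => (hall t ht).2.differentiableAt.differentiableWithinAt,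
      fun h => by simp at h, ?_⟩
    refine ((hX.of_le (by exact_mod_cast le_top)).comp ih fun t ht => (hall t ht).1).congr
      fun t ht => (hall t ht).2.deriv

theorem exists_curve_spray (hO : IsOpen O) (hG : ContDiffOn ℝ ∞ G O)
    (hpos : ∀ z ∈ O, ∀ v ≠ 0, 0 < G z v v) {z₀ : E} (hz₀ : z₀ ∈ O) (a₀ : E) :
    ∃ c : ℝ → E, c 0 = z₀ ∧ deriv c 0 = a₀ ∧ ∃ δ > 0, ContDiffOn ℝ ∞ c (Ioo (-δ) δ) ∧
      ∀ t ∈ Ioo (-δ) δ, c t ∈ O ∧ deriv (deriv c) t = spray G (c t) (deriv c t) := by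
  have hX : ContDiffOn ℝ ∞ (fun w : E × E => (w.2, spray G w.1 w.2)) {w | w.1 ∈ O} :=
    contDiffOn_snd.prodMk (contDiffOn_spray hO hG hpos)
  obtain ⟨α, hα0, δ, hδ, hsm, hα⟩ := exists_contDiffOn_integralCurve
    (hO.preimage continuous_fst) hX (x₀ := (z₀, a₀)) hz₀
  have hd : ∀ t ∈ Ioo (-δ) δ, deriv (fun t => (α t).1) t = (α t).2 := fun t ht =>
    (HasFDerivAt.comp_hasDerivAt (f := α) t hasFDerivAt_fst (hα t ht).2).deriv
  refine ⟨fun t => (α t).1, by simp [hα0], ?_, δ, hδ, hsm.fst, fun t ht => ⟨(hα t ht).1, ?_⟩⟩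
  · rw [hd 0 (by simp [hδ]), hα0]
  · have h1 : deriv (fun t => (α t).1) =ᶠ[𝓝 t] fun t => (α t).2 := by
      filter_upwards [isOpen_Ioo.mem_nhds ht] with s hs using hd s hs
    rw [h1.deriv_eq, hd t ht]
    exact (HasFDerivAt.comp_hasDerivAt (f := α) t hasFDerivAt_snd (hα t ht).2).deriv

/-- The derivative of a function on the tangent bundle along the geodesic flow. -/
def geodesicDeriv (G : E → E →L[ℝ] E →L[ℝ] ℝ) (W : E × E → ℝ) (w : E × E) : ℝ :=
  fderiv ℝ W w (w.2, spray G w.1 w.2)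

/-- The function whose value at `(z, a)` is the `j`-th derivative at `0` of `u` along the geodesic
that starts at `z` with velocity `a`. -/
def geodesicIter (G : E → E →L[ℝ] E →L[ℝ] ℝ) (u : E → ℝ) : ℕ → E × E → ℝ
  | 0 => fun w => u w.1
  | j + 1 => geodesicDeriv G (geodesicIter G u j)

theorem contDiffOn_geodesicIter (hO : IsOpen O) (hG : ContDiffOn ℝ ∞ G O)
    (hpos : ∀ z ∈ O, ∀ v ≠ 0, 0 < G z v v) {u : E → ℝ} (hu : ContDiffOn ℝ ∞ u O) (j : ℕ) :
    ContDiffOn ℝ ∞ (geodesicIter G u j) {w | w.1 ∈ O} := by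
  induction j with
  | zero => exact hu.comp contDiffOn_fst fun _ h => h
  | succ j ih =>
    exact (ih.fderiv_of_isOpen (hO.preimage continuous_fst) (by simp)).clm_apply
      (contDiffOn_snd.prodMk (contDiffOn_spray hO hG hpos))

/-- The `j`-th derivative along a geodesic is homogeneous of degree `j` in the initial velocity,
since the spray is homogeneous of degree `2`. -/
theorem geodesicIter_smul (hO : IsOpen O) (hG : ContDiffOn ℝ ∞ G O)
    (hpos : ∀ z ∈ O, ∀ v ≠ 0, 0 < G z v v) {u : E → ℝ} (hu : ContDiffOn ℝ ∞ u O) (j : ℕ) (r : ℝ)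
    {z : E} (hz : z ∈ O) (a : E) :
    geodesicIter G u j (z, r • a) = r ^ j * geodesicIter G u j (z, a) := by
  have hA : IsOpen {w : E × E | w.1 ∈ O} := hO.preimage continuous_fst
  induction j generalizing z a with
  | zero => simp [geodesicIter]
  | succ j ih =>
    let m : E × E →L[ℝ] E × E := (ContinuousLinearMap.fst ℝ E E).prod
      (r • ContinuousLinearMap.snd ℝ E E)
    have hd := (contDiffOn_geodesicIter hO hG hpos hu j).differentiableOn (by simp)
    have h1 : (fun w => geodesicIter G u j (m w)) =ᶠ[𝓝 (z, a)]
        fun w => r ^ j * geodesicIter G u j w := by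
      filter_upwards [hA.mem_nhds (show (z, a) ∈ {w : E × E | w.1 ∈ O} from hz)] with w hw
      exact ih hw w.2
    have h2 : HasFDerivAt (geodesicIter G u j) (fderiv ℝ (geodesicIter G u j) (z, r • a))
        (m (z, a)) :=
      (hd.differentiableAt
        (hA.mem_nhds (show (z, r • a) ∈ {w : E × E | w.1 ∈ O} from hz))).hasFDerivAt
    have h3 := (h2.comp (z, a) m.hasFDerivAt).congr_of_eventuallyEq h1.symm
    have h4 := ((hd.differentiableAt (hA.mem_nhds
      (show (z, a) ∈ {w : E × E | w.1 ∈ O} from hz))).hasFDerivAt).const_mul (r ^ j)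
    have h5 := DFunLike.congr_fun (h3.unique h4) (r • (a, spray G z a))
    simp only [geodesicIter, geodesicDeriv, spray_smul]
    have h6 : m (r • (a, spray G z a)) = (r • a, r ^ 2 • spray G z a) := by
      simp [m, smul_smul, pow_two]
    rw [ContinuousLinearMap.comp_apply, h6, map_smul, smul_apply, smul_eq_mul, smul_eq_mul] at h5
    rw [h5]
    ring

/-- `geodesicIter` computes the derivatives along geodesics. -/
theorem iteratedDerivWithin_comp_curve (hO : IsOpen O) (hG : ContDiffOn ℝ ∞ G O)
    (hpos : ∀ z ∈ O, ∀ v ≠ 0, 0 < G z v v) {u : E → ℝ} (hu : ContDiffOn ℝ ∞ u O) {c : ℝ → E}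
    {δ : ℝ} (hc : ContDiffOn ℝ ∞ c (Ioo (-δ) δ))
    (hc' : ∀ t ∈ Ioo (-δ) δ, c t ∈ O ∧ deriv (deriv c) t = spray G (c t) (deriv c t)) (j : ℕ)
    {t : ℝ} (ht : t ∈ Ico 0 δ) :
    iteratedDerivWithin j (fun t => u (c t)) (Ico 0 δ) t
      = geodesicIter G u j (c t, deriv c t) := by
  have hA : IsOpen {w : E × E | w.1 ∈ O} := hO.preimage continuous_fst
  induction j generalizing t with
  | zero => simp [geodesicIter]
  | succ j ih =>
    have ht' : t ∈ Ioo (-δ) δ := ⟨by linarith [ht.1, ht.2], ht.2⟩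
    have hcd : ContDiffOn ℝ ∞ (deriv c) (Ioo (-δ) δ) := hc.deriv_of_isOpen isOpen_Ioo (by simp)
    rw [iteratedDerivWithin_succ, derivWithin_congr (fun s hs => ih hs) (ih ht)]
    have h1 : HasDerivAt c (deriv c t) t :=
      ((hc.differentiableOn (by simp)).differentiableAt (isOpen_Ioo.mem_nhds ht')).hasDerivAt
    have h2 : HasDerivAt (deriv c) (deriv (deriv c) t) t :=
      ((hcd.differentiableOn (by simp)).differentiableAt (isOpen_Ioo.mem_nhds ht')).hasDerivAt
    have h3 := ((contDiffOn_geodesicIter hO hG hpos hu j).differentiableOn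
      (by simp)).differentiableAt (hA.mem_nhds
      (show (c t, deriv c t) ∈ {w : E × E | w.1 ∈ O} from (hc' t ht').1))
    have h4 := h3.hasFDerivAt.comp_hasDerivAt t (h1.prodMk h2)
    refine (h4.hasDerivWithinAt.derivWithin (uniqueDiffOn_Ico 0 δ t ht)).trans ?_
    rw [(hc' t ht').2]
    rfl

end Spray

/-! ### The geodesic equation under isometries -/

section Isometry

open Set

set_option maxSynthPendingDepth 6

variable {E : Type} [NormedAddCommGroup E] [NormedSpace ℝ E] [FiniteDimensional ℝ E]
  {G H : E → E →L[ℝ] E →L[ℝ] ℝ} {τ : E → E} {A B : Set E}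

/-- The transformation rule of the Christoffel symbols under a local isometry `τ`. -/
theorem sprayCovector_of_isometry (hA : IsOpen A) (hB : IsOpen B) (hτ : ContDiffOn ℝ ∞ τ A)
    (hAB : MapsTo τ A B) (hH : ContDiffOn ℝ ∞ H B) (hHs : ∀ z ∈ B, ∀ a b, H z a b = H z b a)
    (hG : ContDiffOn ℝ ∞ G A)
    (hiso : ∀ z ∈ A, ∀ a b, G z a b = H (τ z) (fderiv ℝ τ z a) (fderiv ℝ τ z b))
    {z : E} (hz : z ∈ A) (a c : E) :
    sprayCovector G z a c = sprayCovector H (τ z) (fderiv ℝ τ z a) (fderiv ℝ τ z c)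
      + H (τ z) (fderiv ℝ (fderiv ℝ τ) z a a) (fderiv ℝ τ z c) := by
  have hzA := hA.mem_nhds hz
  have dτ : HasFDerivAt τ (fderiv ℝ τ z) z :=
    ((hτ.differentiableOn (by simp)).differentiableAt hzA).hasFDerivAt
  have d2τ : HasFDerivAt (fderiv ℝ τ) (fderiv ℝ (fderiv ℝ τ) z) z :=
    (((hτ.fderiv_of_isOpen (m := ∞) hA (by simp)).differentiableOn
      (by simp)).differentiableAt hzA).hasFDerivAt
  have dG : HasFDerivAt G (fderiv ℝ G z) z :=
    ((hG.differentiableOn (by simp)).differentiableAt hzA).hasFDerivAt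
  have dH : HasFDerivAt H (fderiv ℝ H (τ z)) (τ z) :=
    ((hH.differentiableOn (by simp)).differentiableAt (hB.mem_nhds (hAB hz))).hasFDerivAt
  have key : ∀ e a b, fderiv ℝ G z e a b
      = fderiv ℝ H (τ z) (fderiv ℝ τ z e) (fderiv ℝ τ z a) (fderiv ℝ τ z b)
        + H (τ z) (fderiv ℝ (fderiv ℝ τ) z e a) (fderiv ℝ τ z b)
        + H (τ z) (fderiv ℝ τ z a) (fderiv ℝ (fderiv ℝ τ) z e b) := by
    intro e a b
    have h1 : HasFDerivAt (fun x => G x a b) _ z :=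
      (dG.clm_apply (hasFDerivAt_const a z)).clm_apply (hasFDerivAt_const b z)
    have h2 : HasFDerivAt (fun x => H (τ x) (fderiv ℝ τ x a) (fderiv ℝ τ x b)) _ z :=
      ((dH.comp z dτ).clm_apply (d2τ.clm_apply (hasFDerivAt_const a z))).clm_apply
        (d2τ.clm_apply (hasFDerivAt_const b z))
    have h3 : (fun x => G x a b) =ᶠ[𝓝 z] fun x => H (τ x) (fderiv ℝ τ x a) (fderiv ℝ τ x b) := by
      filter_upwards [hzA] with x hx using hiso x hx a b
    have h4 := DFunLike.congr_fun ((h1.congr_of_eventuallyEq h3.symm).unique h2) e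
    simpa [add_comm, add_left_comm, add_assoc] using h4
  have hsymm : ∀ e a, fderiv ℝ (fderiv ℝ τ) z e a = fderiv ℝ (fderiv ℝ τ) z a e := fun e a =>
    ((hτ.contDiffAt hzA).isSymmSndFDerivAt
      (by simpa using ENat.LEInfty.out (m := (2 : WithTop ℕ∞)))).eq e a
  rw [sprayCovector_apply, sprayCovector_apply, key, key, hsymm c a,
    hHs _ (hAB hz) (fderiv ℝ (fderiv ℝ τ) z a c)]
  ring

/-- Local isometries map geodesics to geodesics. -/
theorem deriv_deriv_comp_of_isometry (hA : IsOpen A) (hB : IsOpen B) (hτ : ContDiffOn ℝ ∞ τ A)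
    (hAB : MapsTo τ A B) (hH : ContDiffOn ℝ ∞ H B) (hHs : ∀ z ∈ B, ∀ a b, H z a b = H z b a)
    (hG : ContDiffOn ℝ ∞ G A)
    (hiso : ∀ z ∈ A, ∀ a b, G z a b = H (τ z) (fderiv ℝ τ z a) (fderiv ℝ τ z b))
    {c : ℝ → E} {I : Set ℝ} (hI : IsOpen I) (hc : ContDiffOn ℝ ∞ c I) {t : ℝ} (ht : t ∈ I)
    (hcA : c t ∈ A)
    (hgeo : ∀ w, G (c t) (deriv (deriv c) t) w + sprayCovector G (c t) (deriv c t) w = 0) (w : E) :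
    H (τ (c t)) (deriv (deriv (τ ∘ c)) t) (fderiv ℝ τ (c t) w)
      + sprayCovector H (τ (c t)) (deriv (τ ∘ c) t) (fderiv ℝ τ (c t) w) = 0 := by
  have hIt := hI.mem_nhds ht
  have hcd : ∀ s ∈ I, HasDerivAt c (deriv c s) s := fun s hs =>
    ((hc.differentiableOn (by simp)).differentiableAt (hI.mem_nhds hs)).hasDerivAt
  have hcd2 : HasDerivAt (deriv c) (deriv (deriv c) t) t :=
    (((hc.deriv_of_isOpen (m := ∞) hI (by simp)).differentiableOn (by simp)).differentiableAt
      hIt).hasDerivAt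
  have dτ : ∀ z ∈ A, HasFDerivAt τ (fderiv ℝ τ z) z := fun z hz =>
    ((hτ.differentiableOn (by simp)).differentiableAt (hA.mem_nhds hz)).hasFDerivAt
  have d2τ : HasFDerivAt (fderiv ℝ τ) (fderiv ℝ (fderiv ℝ τ) (c t)) (c t) :=
    (((hτ.fderiv_of_isOpen (m := ∞) hA (by simp)).differentiableOn
      (by simp)).differentiableAt (hA.mem_nhds hcA)).hasFDerivAt
  have hev : ∀ᶠ s in 𝓝 t, s ∈ I ∧ c s ∈ A :=
    (Filter.eventually_of_mem hIt fun _ h => h).and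
      ((hcd t ht).continuousAt (hA.mem_nhds hcA))
  have h1 : deriv (τ ∘ c) =ᶠ[𝓝 t] fun s => fderiv ℝ τ (c s) (deriv c s) := by
    filter_upwards [hev] with s hs
    exact ((dτ _ hs.2).comp_hasDerivAt s (hcd s hs.1)).deriv
  have h2 : deriv (deriv (τ ∘ c)) t = fderiv ℝ (fderiv ℝ τ) (c t) (deriv c t) (deriv c t)
      + fderiv ℝ τ (c t) (deriv (deriv c) t) := by
    rw [h1.deriv_eq]
    have := (d2τ.comp_hasDerivAt t (hcd t ht)).clm_apply hcd2
    exact this.deriv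
  have h3 := hgeo w
  rw [hiso _ hcA, sprayCovector_of_isometry hA hB hτ hAB hH hHs hG hiso hcA] at h3
  rw [h2, h1.eq_of_nhds, map_add, add_apply]
  linarith

end Isometry

/-! ### The metric in charts -/

section Charts

open Set

set_option maxSynthPendingDepth 6

variable {n k : ℕ} {M : Type*} [TopologicalSpace M] [ChartedSpace (Model n k) M]
  [IsManifold (𝓡 (n + k)) ∞ M] {φ ψ : OpenPartialHomeomorph M (Model n k)}

theorem mdifferentiable_of_mem_maximalAtlas
    (hφ : φ ∈ IsManifold.maximalAtlas (𝓡 (n + k)) ∞ M) :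
    φ.MDifferentiable (𝓡 (n + k)) (𝓡 (n + k)) :=
  ⟨(contMDiffOn_of_mem_maximalAtlas hφ).mdifferentiableOn (by simp),
    (contMDiffOn_symm_of_mem_maximalAtlas hφ).mdifferentiableOn (by simp)⟩

/-- The differential at `p` of a chart. -/
def chartDeriv (φ : OpenPartialHomeomorph M (Model n k)) (p : M) : Model n k →L[ℝ] Model n k :=
  mfderiv (𝓡 (n + k)) (𝓡 (n + k)) φ p

/-- The differential at `z` of the inverse of a chart. -/
def chartDerivSymm (φ : OpenPartialHomeomorph M (Model n k)) (z : Model n k) :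
    Model n k →L[ℝ] Model n k :=
  mfderiv (𝓡 (n + k)) (𝓡 (n + k)) φ.symm z

theorem chartDerivSymm_chartDeriv (hφ : φ ∈ IsManifold.maximalAtlas (𝓡 (n + k)) ∞ M) {p : M}
    (hp : p ∈ φ.source) (v : Model n k) : chartDerivSymm φ (φ p) (chartDeriv φ p v) = v :=
  DFunLike.congr_fun ((mdifferentiable_of_mem_maximalAtlas hφ).symm_comp_deriv hp) v

theorem chartDeriv_chartDerivSymm (hφ : φ ∈ IsManifold.maximalAtlas (𝓡 (n + k)) ∞ M)
    {z : Model n k} (hz : z ∈ φ.target) (v : Model n k) :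
    chartDeriv φ (φ.symm z) (chartDerivSymm φ z v) = v :=
  DFunLike.congr_fun ((mdifferentiable_of_mem_maximalAtlas hφ).comp_symm_deriv hz) v

/-- The metric at `p`, as a bilinear form on the model space. -/
def innerAt (g : Metric n k M) (p : M) : Model n k →L[ℝ] Model n k →L[ℝ] ℝ := g.inner p

/-- The metric in the chart `φ`, as a function with values in the continuous bilinear forms. -/
def metricForm (g : Metric n k M) (φ : OpenPartialHomeomorph M (Model n k)) (z : Model n k) :
    Model n k →L[ℝ] Model n k →L[ℝ] ℝ :=
  (innerAt g (φ.symm z)).bilinearComp (chartDerivSymm φ z) (chartDerivSymm φ z)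

variable (g : Metric n k M)

theorem metricForm_apply (z a b : Model n k) : metricForm g φ z a b
    = innerAt g (φ.symm z) (chartDerivSymm φ z a) (chartDerivSymm φ z b) := rfl

theorem innerAt_eq_metricForm (hφ : φ ∈ IsManifold.maximalAtlas (𝓡 (n + k)) ∞ M) {p : M}
    (hp : p ∈ φ.source) (v w : Model n k) :
    innerAt g p v w = metricForm g φ (φ p) (chartDeriv φ p v) (chartDeriv φ p w) := by
  rw [metricForm_apply, φ.left_inv hp, chartDerivSymm_chartDeriv hφ hp,
    chartDerivSymm_chartDeriv hφ hp]

theorem metricForm_symm (z a b : Model n k) : metricForm g φ z a b = metricForm g φ z b a :=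
  g.symm (φ.symm z) (chartDerivSymm φ z a) (chartDerivSymm φ z b)

theorem metricForm_pos (hφ : φ ∈ IsManifold.maximalAtlas (𝓡 (n + k)) ∞ M) {z : Model n k}
    (hz : z ∈ φ.target) (v : Model n k) (hv : v ≠ 0) : 0 < metricForm g φ z v v := by
  refine g.pos (φ.symm z) (chartDerivSymm φ z v) fun h => hv ?_
  rw [← chartDeriv_chartDerivSymm hφ hz v]
  exact (congrArg (chartDeriv φ (φ.symm z)) h).trans (map_zero _)

theorem contDiffOn_metricForm (hφ : φ ∈ IsManifold.maximalAtlas (𝓡 (n + k)) ∞ M) :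
    ContDiffOn ℝ ∞ (metricForm g φ) φ.target := by
  have hV : ∀ a : Model n k, ContMDiffOn (𝓡 (n + k)) ((𝓡 (n + k)).prod 𝓘(ℝ, Model n k)) ∞
      (fun z => (TotalSpace.mk' (Model n k) (φ.symm z)
        (mfderiv (𝓡 (n + k)) (𝓡 (n + k)) φ.symm z a) : TangentBundle (𝓡 (n + k)) M))
      φ.target := by
    intro a
    have h1 := (contMDiffOn_symm_of_mem_maximalAtlas hφ).contMDiffOn_tangentMapWithin (m := ∞)
      (by simp) φ.open_target.uniqueMDiffOn
    have h2 : ContMDiffOn (𝓡 (n + k)) ((𝓡 (n + k)).prod 𝓘(ℝ, Model n k)) ∞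
        (fun z : Model n k => (TotalSpace.mk' (Model n k) z a
          : TangentBundle (𝓡 (n + k)) (Model n k))) φ.target :=
      contMDiffOn_vectorSpace_iff_contDiffOn.2 contDiffOn_const
    refine (h1.comp h2 fun z hz => hz).congr fun z hz => ?_
    simp only [Function.comp_apply, tangentMapWithin]
    rw [mfderivWithin_of_isOpen φ.open_target hz]
  rw [contDiffOn_clm_apply]
  intro a
  rw [contDiffOn_clm_apply]
  intro b
  have h3 : ContMDiffOn (𝓡 (n + k)) ((𝓡 (n + k)).prod 𝓘(ℝ, ℝ)) ∞
      (fun z => TotalSpace.mk' ℝ (E := Bundle.Trivial M ℝ) (φ.symm z) (metricForm g φ z a b))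
      φ.target :=
    ContMDiffOn.clm_bundle_apply₂ (F₁ := Model n k) (F₂ := Model n k)
      (g.contMDiff.comp_contMDiffOn (contMDiffOn_symm_of_mem_maximalAtlas hφ)) (hV a) (hV b)
  rw [← contMDiffOn_iff_contDiffOn]
  intro z hz
  have h4 := h3 z hz
  simp only [contMDiffWithinAt_totalSpace] at h4
  exact h4.2

theorem christoffel_eq_sprayCovector (hφ : φ ∈ IsManifold.maximalAtlas (𝓡 (n + k)) ∞ M)
    {z : Model n k} (hz : z ∈ φ.target) (a c : Model n k) :
    christoffel g φ z a a c = sprayCovector (metricForm g φ) z a c := by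
  have hd : HasFDerivAt (metricForm g φ) (fderiv ℝ (metricForm g φ) z) z :=
    (((contDiffOn_metricForm g hφ).differentiableOn (by simp)).differentiableAt
      (φ.open_target.mem_nhds hz)).hasFDerivAt
  have key : ∀ a b e, fderiv ℝ (fun x => metricInChart g φ x a b) z e
      = fderiv ℝ (metricForm g φ) z e a b := by
    intro a b e
    have h1 : HasFDerivAt (fun x => metricForm g φ x a b) _ z :=
      (hd.clm_apply (hasFDerivAt_const a z)).clm_apply (hasFDerivAt_const b z)
    have h2 := DFunLike.congr_fun h1.fderiv e
    refine Eq.trans ?_ (h2.trans (by simp))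
    rfl
  rw [christoffel, sprayCovector_apply, key, key]
  ring

end Charts

/-! ### Existence of geodesics -/

section Geodesics

open Set

set_option maxSynthPendingDepth 6

variable {n k : ℕ} {M : Type*} [TopologicalSpace M] [ChartedSpace (Model n k) M]
  [IsManifold (𝓡 (n + k)) ∞ M] {φ ψ : OpenPartialHomeomorph M (Model n k)}

/-- The domain, in the coordinates of `φ`, of the change of charts from `φ` to `ψ`. -/
def overlap (φ ψ : OpenPartialHomeomorph M (Model n k)) : Set (Model n k) :=
  φ.target ∩ φ.symm ⁻¹' ψ.source

theorem isOpen_overlap (φ ψ : OpenPartialHomeomorph M (Model n k)) : IsOpen (overlap φ ψ) :=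
  φ.symm.continuousOn.isOpen_inter_preimage φ.open_target ψ.open_source

theorem contDiffOn_transition (hφ : φ ∈ IsManifold.maximalAtlas (𝓡 (n + k)) ∞ M)
    (hψ : ψ ∈ IsManifold.maximalAtlas (𝓡 (n + k)) ∞ M) :
    ContDiffOn ℝ ∞ (ψ ∘ φ.symm) (overlap φ ψ) := by
  rw [← contMDiffOn_iff_contDiffOn]
  exact (contMDiffOn_of_mem_maximalAtlas hψ).comp
    ((contMDiffOn_symm_of_mem_maximalAtlas hφ).mono inter_subset_left) fun _ hz => hz.2

theorem fderiv_transition (hφ : φ ∈ IsManifold.maximalAtlas (𝓡 (n + k)) ∞ M)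
    (hψ : ψ ∈ IsManifold.maximalAtlas (𝓡 (n + k)) ∞ M) {z : Model n k} (hz : z ∈ overlap φ ψ) :
    fderiv ℝ (ψ ∘ φ.symm) z = (chartDeriv ψ (φ.symm z)).comp (chartDerivSymm φ z) := by
  rw [← mfderiv_eq_fderiv]
  exact mfderiv_comp z ((mdifferentiable_of_mem_maximalAtlas hψ).mdifferentiableAt hz.2)
    ((mdifferentiable_of_mem_maximalAtlas hφ).mdifferentiableAt_symm hz.1)

theorem chartDeriv_eq_fderiv_transition (hφ : φ ∈ IsManifold.maximalAtlas (𝓡 (n + k)) ∞ M)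
    (hψ : ψ ∈ IsManifold.maximalAtlas (𝓡 (n + k)) ∞ M) {p : M} (hp : p ∈ φ.source)
    (hp' : p ∈ ψ.source) (v : Model n k) :
    chartDeriv ψ p v = fderiv ℝ (ψ ∘ φ.symm) (φ p) (chartDeriv φ p v) := by
  have h1 : φ p ∈ overlap φ ψ :=
    ⟨φ.map_source hp, by rw [mem_preimage, φ.left_inv hp]; exact hp'⟩
  rw [fderiv_transition hφ hψ h1, ContinuousLinearMap.comp_apply, φ.left_inv hp,
    chartDerivSymm_chartDeriv hφ hp]

variable (g : Metric n k M)

theorem metricForm_transition (hφ : φ ∈ IsManifold.maximalAtlas (𝓡 (n + k)) ∞ M)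
    (hψ : ψ ∈ IsManifold.maximalAtlas (𝓡 (n + k)) ∞ M) {z : Model n k} (hz : z ∈ overlap φ ψ)
    (a b : Model n k) :
    metricForm g φ z a b = metricForm g ψ ((ψ ∘ φ.symm) z) (fderiv ℝ (ψ ∘ φ.symm) z a)
      (fderiv ℝ (ψ ∘ φ.symm) z b) := by
  rw [metricForm_apply, innerAt_eq_metricForm g hψ hz.2, fderiv_transition hφ hψ hz]
  rfl

/-- Every tangent vector is the initial velocity of a geodesic. -/
theorem exists_isGeodesicFrom (v : TangentBundle (𝓡 (n + k)) M) : ∃ γ, IsGeodesicFrom g v γ := by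
  obtain ⟨p, v⟩ := v
  let φ := chartAt (Model n k) p
  have hφ : φ ∈ IsManifold.maximalAtlas (𝓡 (n + k)) ∞ M := IsManifold.chart_mem_maximalAtlas p
  have hp : p ∈ φ.source := mem_chart_source _ p
  obtain ⟨c, hc0, hc1, δ, hδ, hc, hgeo⟩ := exists_curve_spray φ.open_target
    (contDiffOn_metricForm g hφ) (fun z hz => metricForm_pos g hφ hz) (φ.map_source hp)
    (chartDeriv φ p v)
  have h0 : (0 : ℝ) ∈ Ioo (-δ) δ := by simp [hδ]
  refine ⟨φ.symm ∘ c, ?_, δ, hδ, ?_, ?_⟩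
  · have hd : HasFDerivAt c (ContinuousLinearMap.toSpanSingleton ℝ (deriv c 0)) 0 :=
      ((hc.differentiableOn (by simp)).differentiableAt
        (isOpen_Ioo.mem_nhds h0)).hasDerivAt.hasFDerivAt
    have h1 : mfderiv 𝓘(ℝ, ℝ) (𝓡 (n + k)) (φ.symm ∘ c) 0 = _ :=
      mfderiv_comp 0 ((mdifferentiable_of_mem_maximalAtlas hφ).mdifferentiableAt_symm
        (hgeo 0 h0).1) hd.differentiableAt.mdifferentiableAt
    rw [mfderiv_eq_fderiv, hd.fderiv] at h1
    have h2 : (mfderiv 𝓘(ℝ, ℝ) (𝓡 (n + k)) (φ.symm ∘ c) 0 (1 : ℝ) : Model n k) = v := by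
      refine (DFunLike.congr_fun h1 (1 : ℝ)).trans ?_
      refine Eq.trans ?_ (chartDerivSymm_chartDeriv hφ hp v)
      rw [← hc1, ← hc0]
      refine congrArg (chartDerivSymm φ (c 0)) ?_
      exact one_smul ℝ (deriv c 0)
    have h3 : (φ.symm ∘ c) 0 = p := by
      rw [Function.comp_apply, hc0, φ.left_inv hp]
    exact TotalSpace.ext h3 (heq_of_eq h2)
  · exact (contMDiffOn_symm_of_mem_maximalAtlas hφ).comp hc.contMDiffOn fun t ht => (hgeo t ht).1
  · intro s hs ψ hψ hsψ w
    have hA : c s ∈ overlap φ ψ := ⟨(hgeo s hs).1, hsψ⟩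
    have h1 := (eq_spray_iff (metricForm_pos g hφ (hgeo s hs).1) _ _).1 (hgeo s hs).2
    have h2 := deriv_deriv_comp_of_isometry (isOpen_overlap φ ψ) ψ.open_target
      (contDiffOn_transition hφ hψ) (fun z hz => ψ.map_source hz.2) (contDiffOn_metricForm g hψ)
      (fun z _ => metricForm_symm g z) ((contDiffOn_metricForm g hφ).mono inter_subset_left)
      (fun z hz => metricForm_transition g hφ hψ hz) isOpen_Ioo hc hs hA h1
      (chartDeriv φ (φ.symm (c s)) (chartDerivSymm ψ (ψ (φ.symm (c s))) w))
    have h3 : fderiv ℝ (ψ ∘ φ.symm) (c s)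
        (chartDeriv φ (φ.symm (c s)) (chartDerivSymm ψ (ψ (φ.symm (c s))) w)) = w := by
      have := chartDeriv_eq_fderiv_transition hφ hψ (φ.map_target hA.1) hsψ
        (chartDerivSymm ψ (ψ (φ.symm (c s))) w)
      rw [φ.right_inv hA.1] at this
      rw [← this]
      have h4 := chartDeriv_chartDerivSymm hψ (ψ.map_source hsψ) w
      rwa [show ψ.symm (ψ ((φ.symm ∘ c) s)) = φ.symm (c s) from ψ.left_inv hsψ] at h4
    rw [h3] at h2
    rw [christoffel_eq_sprayCovector g hψ (ψ.map_source hsψ)]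
    exact h2

/-- In a chart, geodesics solve the equation `c'' = spray c c'`. -/
theorem IsGeodesicFrom.exists_curve {g : Metric n k M} {v : TangentBundle (𝓡 (n + k)) M}
    {γ : ℝ → M} (h : IsGeodesicFrom g v γ) (hφ : φ ∈ IsManifold.maximalAtlas (𝓡 (n + k)) ∞ M)
    (hv : v.proj ∈ φ.source) :
    γ 0 = v.proj ∧ deriv (φ ∘ γ) 0 = chartDeriv φ v.proj v.snd ∧ ∃ δ > 0,
      ContDiffOn ℝ ∞ (φ ∘ γ) (Ioo (-δ) δ) ∧ ∀ t ∈ Ioo (-δ) δ, γ t ∈ φ.source ∧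
        deriv (deriv (φ ∘ γ)) t = spray (metricForm g φ) ((φ ∘ γ) t) (deriv (φ ∘ γ) t) := by
  obtain ⟨rfl, δ, hδ, hγ, hgeo⟩ := h
  have h0 : (0 : ℝ) ∈ Ioo (-δ) δ := by simp [hδ]
  have hc0 : ContinuousAt γ 0 := hγ.continuousOn.continuousAt (isOpen_Ioo.mem_nhds h0)
  have hev : ∀ᶠ t in 𝓝 (0 : ℝ), γ t ∈ φ.source := hc0 (φ.open_source.mem_nhds hv)
  obtain ⟨r, hr, hrs⟩ := Metric.eventually_nhds_iff.1 hev
  refine ⟨rfl, ?_, min δ r, lt_min hδ hr, ?_, ?_⟩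
  · have h1 : mfderiv 𝓘(ℝ, ℝ) (𝓡 (n + k)) (φ ∘ γ) 0 = _ :=
      mfderiv_comp 0 ((mdifferentiable_of_mem_maximalAtlas hφ).mdifferentiableAt hv)
        ((hγ.contMDiffAt (isOpen_Ioo.mem_nhds h0)).mdifferentiableAt (by simp))
    rw [mfderiv_eq_fderiv] at h1
    exact DFunLike.congr_fun h1 (1 : ℝ)
  · rw [← contMDiffOn_iff_contDiffOn]
    refine (contMDiffOn_of_mem_maximalAtlas hφ).comp (hγ.mono ?_) ?_
    · exact Ioo_subset_Ioo (neg_le_neg (min_le_left _ _)) (min_le_left _ _)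
    · intro t ht
      exact hrs (by simpa using (abs_lt.2 ht).trans_le (min_le_right _ _))
  · intro t ht
    have hs : γ t ∈ φ.source := hrs (by simpa using (abs_lt.2 ht).trans_le (min_le_right _ _))
    refine ⟨hs, (eq_spray_iff (metricForm_pos g hφ (φ.map_source hs)) _ _).2 fun w => ?_⟩
    have := hgeo t (Ioo_subset_Ioo (neg_le_neg (min_le_left _ _)) (min_le_left _ _) ht) φ hφ hs w
    rw [christoffel_eq_sprayCovector g hφ (φ.map_source hs)] at this
    exact this

theorem isGeodesicFrom_geodesic (v : TangentBundle (𝓡 (n + k)) M) :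
    IsGeodesicFrom g v (geodesic g v) := by
  have h := exists_isGeodesicFrom g v
  rw [geodesic, dif_pos h]
  exact h.choose_spec

end Geodesics

/-! ### Orthogonal complements of kernels -/

section NormalLift

open Set

set_option maxSynthPendingDepth 6

variable {E : Type} [NormedAddCommGroup E] [NormedSpace ℝ E] [FiniteDimensional ℝ E]
  {Y : Type} [NormedAddCommGroup Y] [InnerProductSpace ℝ Y] [FiniteDimensional ℝ Y]

/-- The vectors that are `B`-orthogonal to the kernel of `ν`, as images of covectors on `Y`:
`B (conormal B ν η) b = ⟪η, ν b⟫`. -/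
def conormal (B : E →L[ℝ] E →L[ℝ] ℝ) (ν : E →L[ℝ] Y) : Y →L[ℝ] E :=
  B.inverse.comp (((ContinuousLinearMap.compL ℝ E Y ℝ).flip ν).comp (innerSL ℝ))

/-- The Gram operator of the metric induced by `B` on the conormal space. -/
def conormalGram (B : E →L[ℝ] E →L[ℝ] ℝ) (ν : E →L[ℝ] Y) : Y →L[ℝ] Y := ν.comp (conormal B ν)

/-- The right inverse of `ν` with values in the `B`-orthogonal complement of the kernel of `ν`. -/
def normalLift (B : E →L[ℝ] E →L[ℝ] ℝ) (ν : E →L[ℝ] Y) : Y →L[ℝ] E :=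
  (conormal B ν).comp (conormalGram B ν).inverse

variable {B : E →L[ℝ] E →L[ℝ] ℝ} {ν : E →L[ℝ] Y}

theorem apply_conormal (hpos : ∀ v ≠ 0, 0 < B v v) (η : Y) (b : E) :
    B (conormal B ν η) b = inner ℝ η (ν b) := by
  obtain ⟨e, he⟩ := exists_equiv_of_pos hpos
  have h : B (conormal B ν η) = (innerSL ℝ η).comp ν := by
    rw [conormal, ← he, ContinuousLinearMap.inverse_equiv]
    simp [ContinuousLinearMap.compL]
  rw [h]
  rfl

theorem inner_conormalGram (hpos : ∀ v ≠ 0, 0 < B v v) (η η' : Y) :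
    inner ℝ η (conormalGram B ν η') = B (conormal B ν η) (conormal B ν η') := by
  rw [apply_conormal hpos]
  rfl

theorem conormalGram_pos (hpos : ∀ v ≠ 0, 0 < B v v) (hν : Function.Surjective ν) {η : Y}
    (hη : η ≠ 0) : 0 < inner ℝ η (conormalGram B ν η) := by
  rw [inner_conormalGram hpos]
  refine hpos _ fun h => hη ?_
  obtain ⟨b, hb⟩ := hν η
  have h1 := apply_conormal (ν := ν) hpos η b
  rw [h, map_zero, hb, zero_apply] at h1
  exact inner_self_eq_zero.1 h1.symm

theorem exists_equiv_conormalGram (hpos : ∀ v ≠ 0, 0 < B v v) (hν : Function.Surjective ν) :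
    ∃ e : Y ≃L[ℝ] Y, (e : Y →L[ℝ] Y) = conormalGram B ν := by
  have hinj : Function.Injective (conormalGram B ν : Y →ₗ[ℝ] Y) := by
    rw [injective_iff_map_eq_zero]
    intro η h
    by_contra hη
    have := conormalGram_pos hpos hν hη
    rw [show conormalGram B ν η = 0 from h, inner_zero_right] at this
    exact this.false
  refine ⟨(LinearEquiv.ofInjectiveEndo _ hinj).toContinuousLinearEquiv, ?_⟩
  ext v
  rfl

theorem conormalGram_inverse (hpos : ∀ v ≠ 0, 0 < B v v) (hν : Function.Surjective ν) (y : Y) :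
    conormalGram B ν ((conormalGram B ν).inverse y) = y := by
  obtain ⟨e, he⟩ := exists_equiv_conormalGram hpos hν
  rw [← he, ContinuousLinearMap.inverse_equiv]
  simp

theorem inverse_conormalGram (hpos : ∀ v ≠ 0, 0 < B v v) (hν : Function.Surjective ν) (y : Y) :
    (conormalGram B ν).inverse (conormalGram B ν y) = y := by
  obtain ⟨e, he⟩ := exists_equiv_conormalGram hpos hν
  rw [← he, ContinuousLinearMap.inverse_equiv]
  simp

theorem apply_normalLift (hpos : ∀ v ≠ 0, 0 < B v v) (hν : Function.Surjective ν) (y : Y) :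
    ν (normalLift B ν y) = y := conormalGram_inverse hpos hν y

theorem bilin_normalLift (hpos : ∀ v ≠ 0, 0 < B v v) (y : Y) (b : E) :
    B (normalLift B ν y) b = inner ℝ ((conormalGram B ν).inverse y) (ν b) :=
  apply_conormal hpos _ b

/-- A vector orthogonal to the kernel of `ν` is determined by its image under `ν`. -/
theorem eq_normalLift (hpos : ∀ v ≠ 0, 0 < B v v) (hν : Function.Surjective ν) {a : E}
    (ha : ∀ b, ν b = 0 → B a b = 0) : a = normalLift B ν (ν a) := by
  by_contra h
  have h0 : ν (a - normalLift B ν (ν a)) = 0 := by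
    rw [map_sub, apply_normalLift hpos hν, sub_self]
  have h1 := hpos _ (sub_ne_zero.2 h)
  rw [map_sub B, sub_apply, ha _ h0, bilin_normalLift hpos, h0, inner_zero_right] at h1
  simp at h1

theorem bilin_normalLift_pos (hpos : ∀ v ≠ 0, 0 < B v v) (hν : Function.Surjective ν) {y : Y}
    (hy : y ≠ 0) : 0 < B (normalLift B ν y) (normalLift B ν y) := by
  refine hpos _ fun h => hy ?_
  rw [← apply_normalLift hpos hν y, h, map_zero]

/-- In a frame `L` that is orthonormal for the metric induced by `B`, the Gram operator is
`L L†`; this is the change of variables in the trace of a bilinear form. -/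
theorem sum_bilin_eq_of_isometry (hpos : ∀ v ≠ 0, 0 < B v v) (hν : Function.Surjective ν)
    {L : Y →L[ℝ] Y} (hL : ∀ y, B (normalLift B ν (L y)) (normalLift B ν (L y)) = ‖y‖ ^ 2)
    (hs : ∀ a b, B a b = B b a)
    {ι : Type} [Fintype ι] (e : OrthonormalBasis ι ℝ Y) (D : Y →L[ℝ] Y →L[ℝ] ℝ) :
    ∑ i, D (L (e i)) (L (e i)) = ∑ i, D (conormalGram B ν (e i)) (e i) := by
  set R := (conormalGram B ν).inverse
  have h1 : ∀ y y', inner ℝ (R (L y)) (L y') = inner ℝ y y' := by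
    have hb : ∀ y y', B (normalLift B ν (L y)) (normalLift B ν (L y')) = inner ℝ (R (L y)) (L y') :=
      fun y y' => by rw [bilin_normalLift hpos, apply_normalLift hpos hν]
    intro y y'
    have h2 := hL (y + y')
    rw [map_add, map_add, map_add B, add_apply, map_add, map_add, hL, hL,
      hs (normalLift B ν (L y')), norm_add_sq_real] at h2
    rw [← hb]
    linarith
  have h3 : (ContinuousLinearMap.adjoint L).comp (R.comp L) = ContinuousLinearMap.id ℝ Y := by
    ext y
    refine ext_inner_right ℝ fun y' => ?_
    rw [ContinuousLinearMap.comp_apply, ContinuousLinearMap.adjoint_inner_left]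
    exact h1 y y'
  have h4 : ∀ a, L (ContinuousLinearMap.adjoint L (R a)) = a := by
    have : ((L : Y →ₗ[ℝ] Y) * ((ContinuousLinearMap.adjoint L).comp R : Y →ₗ[ℝ] Y)) = 1 := by
      rw [mul_eq_one_comm]
      ext y
      exact DFunLike.congr_fun h3 y
    exact fun a => DFunLike.congr_fun this a
  have h5 : ∀ a, L (ContinuousLinearMap.adjoint L a) = conormalGram B ν a := by
    intro a
    have := h4 (conormalGram B ν a)
    rwa [show R (conormalGram B ν a) = a from inverse_conormalGram hpos hν a] at this
  calc ∑ i, D (L (e i)) (L (e i))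
      = ∑ i, ∑ j, inner ℝ (e j) (L (e i)) * D (L (e i)) (e j) := by
        refine Finset.sum_congr rfl fun i _ => ?_
        conv_lhs => rw [← e.sum_repr' (L (e i)), map_sum]
        refine Finset.sum_congr rfl fun j _ => ?_
        rw [map_smul, smul_eq_mul, e.sum_repr' (L (e i))]
    _ = ∑ j, ∑ i, inner ℝ (e i) (ContinuousLinearMap.adjoint L (e j)) * D (L (e i)) (e j) := by
        rw [Finset.sum_comm]
        refine Finset.sum_congr rfl fun j _ => Finset.sum_congr rfl fun i _ => ?_
        rw [ContinuousLinearMap.adjoint_inner_right, real_inner_comm]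
    _ = ∑ j, D (conormalGram B ν (e j)) (e j) := by
        refine Finset.sum_congr rfl fun j _ => ?_
        rw [← h5]
        conv_rhs => rw [← e.sum_repr' (ContinuousLinearMap.adjoint L (e j))]
        simp [map_sum, sum_apply]

variable {X : Type} [NormedAddCommGroup X] [NormedSpace ℝ X] {G : X → E →L[ℝ] E →L[ℝ] ℝ}
  {U : Set X}

theorem contDiffOn_conormal (hG : ContDiffOn ℝ ∞ G U) (hpos : ∀ z ∈ U, ∀ v ≠ 0, 0 < G z v v) :
    ContDiffOn ℝ ∞ (fun x => conormal (G x) ν) U := by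
  have h1 : ContDiffOn ℝ ∞ (fun x => (G x).inverse) U := by
    intro x hx
    obtain ⟨e, he⟩ := exists_equiv_of_pos (hpos x hx)
    have h2 := contDiffAt_map_inverse (n := ∞) e
    rw [he] at h2
    exact h2.comp_contDiffWithinAt x (hG x hx)
  exact h1.clm_comp contDiffOn_const

theorem contDiffOn_conormalGram (hG : ContDiffOn ℝ ∞ G U)
    (hpos : ∀ z ∈ U, ∀ v ≠ 0, 0 < G z v v) :
    ContDiffOn ℝ ∞ (fun x => conormalGram (G x) ν) U :=
  contDiffOn_const.clm_comp (contDiffOn_conormal hG hpos)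

theorem contDiffOn_normalLift (hG : ContDiffOn ℝ ∞ G U) (hpos : ∀ z ∈ U, ∀ v ≠ 0, 0 < G z v v)
    (hν : Function.Surjective ν) : ContDiffOn ℝ ∞ (fun x => normalLift (G x) ν) U := by
  have h1 : ContDiffOn ℝ ∞ (fun x => (conormalGram (G x) ν).inverse) U := by
    intro x hx
    obtain ⟨e, he⟩ := exists_equiv_conormalGram (hpos x hx) hν
    have h2 := contDiffAt_map_inverse (n := ∞) e
    rw [he] at h2
    exact h2.comp_contDiffWithinAt x (contDiffOn_conormalGram hG hpos x hx)
  exact (contDiffOn_conormal hG hpos).clm_comp h1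

/-- An inner product on a finite-dimensional space has an orthonormal frame. -/
theorem exists_linearEquiv_bilin_eq_norm_sq {W : Type} [AddCommGroup W] [Module ℝ W]
    [FiniteDimensional ℝ W] (B : W →ₗ[ℝ] W →ₗ[ℝ] ℝ) (hs : ∀ a b, B a b = B b a)
    (hpos : ∀ v ≠ 0, 0 < B v v) :
    ∃ L : EuclideanSpace ℝ (Fin (Module.finrank ℝ W)) ≃ₗ[ℝ] W, ∀ y, B (L y) (L y) = ‖y‖ ^ 2 := by
  have h0 : ∀ v, 0 ≤ B v v := fun v => by
    by_cases hv : v = 0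
    · simp [hv]
    · exact (hpos v hv).le
  let core : InnerProductSpace.Core ℝ W :=
    { inner := fun a b => B a b
      conj_inner_symm := fun a b => hs b a
      re_inner_nonneg := h0
      add_left := fun a b c => by simp
      smul_left := fun a b r => by simp
      definite := fun v hv => by
        by_contra h
        exact (hpos v h).ne' hv }
  let _ : NormedAddCommGroup W := core.toNormedAddCommGroup
  let _ : InnerProductSpace ℝ W := InnerProductSpace.ofCore core.toCore
  let e := stdOrthonormalBasis ℝ W
  refine ⟨e.repr.symm.toLinearEquiv, fun y => ?_⟩
  have h1 : inner ℝ (e.repr.symm y) (e.repr.symm y) = ‖y‖ ^ 2 := by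
    rw [real_inner_self_eq_norm_sq, LinearIsometryEquiv.norm_map]
  exact h1

end NormalLift

/-! ### Normal vectors in slice charts -/

section SliceCharts

open Set

set_option maxSynthPendingDepth 6

variable {n k : ℕ}

theorem exists_linearMap_bilin_eq_norm_sq {E : Type} [NormedAddCommGroup E] [NormedSpace ℝ E]
    (B : E →L[ℝ] E →L[ℝ] ℝ) (N : EuclideanSpace ℝ (Fin k) →L[ℝ] E)
    (hs : ∀ a b, B a b = B b a) (hpos : ∀ v ≠ 0, 0 < B (N v) (N v)) :
    ∃ L : EuclideanSpace ℝ (Fin k) →ₗ[ℝ] EuclideanSpace ℝ (Fin k),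
      ∀ y, B (N (L y)) (N (L y)) = ‖y‖ ^ 2 := by
  have h := exists_linearEquiv_bilin_eq_norm_sq (LinearMap.mk₂ ℝ (fun a b => B (N a) (N b))
    (fun a b c => by rw [map_add, map_add, add_apply])
    (fun r a b => by rw [map_smul, map_smul, smul_apply])
    (fun a b c => by rw [map_add, map_add]) (fun r a b => by rw [map_smul, map_smul]))
    (fun a b => hs _ _) hpos
  rw [finrank_euclideanSpace_fin] at h
  obtain ⟨L, hL⟩ := h
  exact ⟨L, hL⟩

@[simp]
theorem tangentialCoord_joinCoord (x : EuclideanSpace ℝ (Fin n)) (y : EuclideanSpace ℝ (Fin k)) :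
    tangentialCoord n k (joinCoord n k x y) = x := by
  simp [tangentialCoord, joinCoord]

@[simp]
theorem normalCoord_joinCoord (x : EuclideanSpace ℝ (Fin n)) (y : EuclideanSpace ℝ (Fin k)) :
    normalCoord n k (joinCoord n k x y) = y := by
  simp [normalCoord, joinCoord]

@[simp]
theorem joinCoord_coord (z : Model n k) :
    joinCoord n k (tangentialCoord n k z) (normalCoord n k z) = z :=
  (EuclideanSpace.finAddEquivProd (𝕜 := ℝ) (n := n) (m := k)).symm_apply_apply z

theorem joinCoord_eq {z : Model n k} (hz : normalCoord n k z = 0) :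
    joinCoord n k (tangentialCoord n k z) 0 = z := by
  rw [← hz, joinCoord_coord]

theorem normalCoord_surjective : Function.Surjective (normalCoord n k) := fun y =>
  ⟨joinCoord n k 0 y, normalCoord_joinCoord 0 y⟩

theorem contDiff_joinCoord : ContDiff ℝ ∞
    (fun z : EuclideanSpace ℝ (Fin n) × EuclideanSpace ℝ (Fin k) => joinCoord n k z.1 z.2) :=
  (EuclideanSpace.finAddEquivProd (𝕜 := ℝ) (n := n) (m := k)).symm.contDiff

variable {M : Type*} [TopologicalSpace M] [ChartedSpace (Model n k) M]
  {φ ψ : OpenPartialHomeomorph M (Model n k)} {S : Set M}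

/-- The range of the tangential coordinates of a slice chart on the submanifold. -/
def sliceBase (φ : OpenPartialHomeomorph M (Model n k)) : Set (EuclideanSpace ℝ (Fin n)) :=
  {x | joinCoord n k x 0 ∈ φ.target}

theorem contDiff_joinCoord_zero : ContDiff ℝ ∞
    (fun x : EuclideanSpace ℝ (Fin n) => joinCoord n k x 0) :=
  contDiff_joinCoord.comp (f := fun x => (x, (0 : EuclideanSpace ℝ (Fin k))))
    (contDiff_id.prodMk contDiff_const)

theorem isOpen_sliceBase (φ : OpenPartialHomeomorph M (Model n k)) : IsOpen (sliceBase φ) :=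
  φ.open_target.preimage contDiff_joinCoord_zero.continuous

theorem IsSliceChart.joinCoord_eq (hφ : IsSliceChart n k S φ) {p : M} (hp : p ∈ φ.source)
    (hpS : p ∈ S) : joinCoord n k (tangentialCoord n k (φ p)) 0 = φ p :=
  SphericalBlowup.joinCoord_eq ((hφ.mem_iff p hp).1 hpS)

theorem IsSliceChart.mem_sliceBase (hφ : IsSliceChart n k S φ) {p : M} (hp : p ∈ φ.source)
    (hpS : p ∈ S) : tangentialCoord n k (φ p) ∈ sliceBase φ := by
  rw [sliceBase, mem_ofPred_eq, hφ.joinCoord_eq hp hpS]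
  exact φ.map_source hp

theorem IsSliceChart.symm_mem (hφ : IsSliceChart n k S φ) {x : EuclideanSpace ℝ (Fin n)}
    (hx : x ∈ sliceBase φ) : φ.symm (joinCoord n k x 0) ∈ S := by
  rw [hφ.mem_iff _ (φ.map_target hx), φ.right_inv hx, normalCoord_joinCoord]

variable [IsManifold (𝓡 (n + k)) ∞ M]

/-- Changes of slice charts preserve `{y = 0}`, hence so do their differentials on it. -/
theorem IsSliceChart.normalCoord_fderiv_transition (hφ : IsSliceChart n k S φ)
    (hψ : IsSliceChart n k S ψ) {p : M} (hp : p ∈ φ.source) (hp' : p ∈ ψ.source) (hpS : p ∈ S)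
    {a : Model n k} (ha : normalCoord n k a = 0) :
    normalCoord n k (fderiv ℝ (ψ ∘ φ.symm) (φ p) a) = 0 := by
  have hz : φ p ∈ overlap φ ψ :=
    ⟨φ.map_source hp, by rw [mem_preimage, φ.left_inv hp]; exact hp'⟩
  have hd : HasFDerivAt (ψ ∘ φ.symm) (fderiv ℝ (ψ ∘ φ.symm) (φ p)) (φ p) :=
    (((contDiffOn_transition hφ.mem_maximalAtlas hψ.mem_maximalAtlas).differentiableOn
      (by simp)).differentiableAt ((isOpen_overlap φ ψ).mem_nhds hz)).hasFDerivAt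
  have hl : HasDerivAt (fun t : ℝ => φ p + t • a) a 0 := by
    simpa using ((hasDerivAt_id (0 : ℝ)).smul_const a).const_add (φ p)
  have h1 := (normalCoord n k).hasFDerivAt.comp_hasDerivAt (0 : ℝ)
    (HasFDerivAt.comp_hasDerivAt (f := fun t : ℝ => φ p + t • a) 0 (by simpa using hd) hl)
  have hev : ∀ᶠ t in 𝓝 (0 : ℝ), φ p + t • a ∈ overlap φ ψ :=
    hl.continuousAt ((isOpen_overlap φ ψ).mem_nhds (by simpa using hz))
  have h2 : (fun t : ℝ => normalCoord n k ((ψ ∘ φ.symm) (φ p + t • a))) =ᶠ[𝓝 0] fun _ => 0 := by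
    filter_upwards [hev] with t ht
    refine (hψ.mem_iff _ ht.2).1 ((hφ.mem_iff _ (φ.map_target ht.1)).2 ?_)
    rw [φ.right_inv ht.1, map_add, map_smul, ha, (hφ.mem_iff p hp).1 hpS, smul_zero, add_zero]
  exact (h1.congr_of_eventuallyEq h2.symm).unique (hasDerivAt_const 0 0)

/-- Tangency can be tested in a single slice chart. -/
theorem IsSliceChart.isTangent_iff (hφ : IsSliceChart n k S φ) {p : M} (hp : p ∈ φ.source)
    (hpS : p ∈ S) (w : TangentSpace (𝓡 (n + k)) p) : IsTangent S p w ↔ dNormal φ p w = 0 := by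
  refine ⟨fun h => h φ hφ hp, fun h ψ hψ hp' => ?_⟩
  have h1 := chartDeriv_eq_fderiv_transition hφ.mem_maximalAtlas hψ.mem_maximalAtlas hp hp' w
  exact (congrArg (normalCoord n k) h1).trans
    (hφ.normalCoord_fderiv_transition hψ hp hp' hpS h)

variable (g : Metric n k M)

/-- The normal vector, in the coordinates of the slice chart `φ`, at the point `(x, 0)` of the
submanifold, with the given normal components. -/
def sliceLift (φ : OpenPartialHomeomorph M (Model n k)) (x : EuclideanSpace ℝ (Fin n)) :
    EuclideanSpace ℝ (Fin k) →L[ℝ] Model n k :=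
  normalLift (metricForm g φ (joinCoord n k x 0)) (normalCoord n k)

/-- The squared length of the normal vector with normal components `y`. -/
def sliceNormSq (φ : OpenPartialHomeomorph M (Model n k)) (x : EuclideanSpace ℝ (Fin n))
    (y : EuclideanSpace ℝ (Fin k)) : ℝ :=
  metricForm g φ (joinCoord n k x 0) (sliceLift g φ x y) (sliceLift g φ x y)

theorem sliceNormSq_smul (x : EuclideanSpace ℝ (Fin n)) (c : ℝ) (y : EuclideanSpace ℝ (Fin k)) :
    sliceNormSq g φ x (c • y) = c ^ 2 * sliceNormSq g φ x y := by
  simp only [sliceNormSq, map_smul, smul_apply, smul_eq_mul]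
  ring

variable {g}

theorem IsSliceChart.normalCoord_sliceLift (hφ : IsSliceChart n k S φ)
    {x : EuclideanSpace ℝ (Fin n)} (hx : x ∈ sliceBase φ) (y : EuclideanSpace ℝ (Fin k)) :
    normalCoord n k (sliceLift g φ x y) = y :=
  apply_normalLift (metricForm_pos g hφ.mem_maximalAtlas hx) normalCoord_surjective y

theorem IsSliceChart.sliceNormSq_pos (hφ : IsSliceChart n k S φ)
    {x : EuclideanSpace ℝ (Fin n)} (hx : x ∈ sliceBase φ) {y : EuclideanSpace ℝ (Fin k)}
    (hy : y ≠ 0) : 0 < sliceNormSq g φ x y :=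
  bilin_normalLift_pos (metricForm_pos g hφ.mem_maximalAtlas hx) normalCoord_surjective hy

theorem IsSliceChart.contDiffOn_metricForm_slice (hφ : IsSliceChart n k S φ) :
    ContDiffOn ℝ ∞ (fun x => metricForm g φ (joinCoord n k x 0)) (sliceBase φ) :=
  (contDiffOn_metricForm g hφ.mem_maximalAtlas).comp contDiff_joinCoord_zero.contDiffOn
    fun _ h => h

theorem IsSliceChart.contDiffOn_sliceLift (hφ : IsSliceChart n k S φ) :
    ContDiffOn ℝ ∞ (sliceLift g φ) (sliceBase φ) :=
  contDiffOn_normalLift hφ.contDiffOn_metricForm_slice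
    (fun _ hx => metricForm_pos g hφ.mem_maximalAtlas hx) normalCoord_surjective

theorem IsSliceChart.contDiffOn_sliceNormSq (hφ : IsSliceChart n k S φ) :
    ContDiffOn ℝ ∞ (fun z : EuclideanSpace ℝ (Fin n) × EuclideanSpace ℝ (Fin k) =>
      sliceNormSq g φ z.1 z.2) {z | z.1 ∈ sliceBase φ} := by
  have h1 : ContDiffOn ℝ ∞ (fun z : EuclideanSpace ℝ (Fin n) × EuclideanSpace ℝ (Fin k) =>
      sliceLift g φ z.1 z.2) {z | z.1 ∈ sliceBase φ} :=
    ((hφ.contDiffOn_sliceLift).comp contDiffOn_fst fun _ h => h).clm_apply contDiffOn_snd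
  exact (((hφ.contDiffOn_metricForm_slice (g := g)).comp contDiffOn_fst
    fun _ h => h).clm_apply h1).clm_apply h1

/-- In a slice chart, the normal vectors at a point are parametrized linearly by their normal
components, through `sliceLift`. -/
theorem IsSliceChart.isNormal_iff (hφ : IsSliceChart n k S φ) {p : M} (hp : p ∈ φ.source)
    (hpS : p ∈ S) (v : TangentSpace (𝓡 (n + k)) p) : IsNormal g S p v ↔
      chartDeriv φ p v = sliceLift g φ (tangentialCoord n k (φ p)) (dNormal φ p v) := by
  have hz := φ.map_source hp
  constructor
  · intro h
    rw [sliceLift, hφ.joinCoord_eq hp hpS]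
    refine eq_normalLift (metricForm_pos g hφ.mem_maximalAtlas hz) normalCoord_surjective
      fun b hb => ?_
    have h1 := chartDeriv_chartDerivSymm hφ.mem_maximalAtlas hz b
    rw [φ.left_inv hp] at h1
    have h2 := h (chartDerivSymm φ (φ p) b) ((hφ.isTangent_iff hp hpS _).2
      ((congrArg (normalCoord n k) h1).trans hb))
    have h3 := innerAt_eq_metricForm g hφ.mem_maximalAtlas hp v (chartDerivSymm φ (φ p) b)
    rw [h1] at h3
    rw [← h3]
    exact h2
  · intro h w hw
    refine (innerAt_eq_metricForm g hφ.mem_maximalAtlas hp v w).trans ?_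
    have hw' : normalCoord n k (chartDeriv φ p w) = 0 := (hφ.isTangent_iff hp hpS w).1 hw
    rw [h, sliceLift, hφ.joinCoord_eq hp hpS,
      bilin_normalLift (metricForm_pos g hφ.mem_maximalAtlas hz), hw', inner_zero_right]

theorem IsSliceChart.inner_self_eq (hφ : IsSliceChart n k S φ) {p : M} (hp : p ∈ φ.source)
    (hpS : p ∈ S) {v : TangentSpace (𝓡 (n + k)) p} (hv : IsNormal g S p v) :
    g.inner p v v = sliceNormSq g φ (tangentialCoord n k (φ p)) (dNormal φ p v) := by
  refine (innerAt_eq_metricForm g hφ.mem_maximalAtlas hp v v).trans ?_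
  rw [sliceNormSq, ← (hφ.isNormal_iff hp hpS v).1 hv, hφ.joinCoord_eq hp hpS]

/-- The tangential coordinates of the foot point of a normal vector. -/
def baseCoord (φ : OpenPartialHomeomorph M (Model n k)) (v : NormalSphere g S) :
    EuclideanSpace ℝ (Fin n) := tangentialCoord n k (φ v.1.proj)

/-- The normal components of a normal vector. -/
def fibreCoord (φ : OpenPartialHomeomorph M (Model n k)) (v : NormalSphere g S) :
    EuclideanSpace ℝ (Fin k) := dNormal φ v.1.proj v.1.snd

theorem IsSliceChart.baseCoord_mem (hφ : IsSliceChart n k S φ) {v : NormalSphere g S}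
    (hv : v.1.proj ∈ φ.source) : baseCoord φ v ∈ sliceBase φ := hφ.mem_sliceBase hv v.2.1

theorem IsSliceChart.joinCoord_baseCoord (hφ : IsSliceChart n k S φ) {v : NormalSphere g S}
    (hv : v.1.proj ∈ φ.source) : joinCoord n k (baseCoord φ v) 0 = φ v.1.proj :=
  hφ.joinCoord_eq hv v.2.1

theorem IsSliceChart.chartDeriv_eq (hφ : IsSliceChart n k S φ) {v : NormalSphere g S}
    (hv : v.1.proj ∈ φ.source) :
    chartDeriv φ v.1.proj v.1.snd = sliceLift g φ (baseCoord φ v) (fibreCoord φ v) :=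
  (hφ.isNormal_iff hv v.2.1 _).1 v.2.2.1

theorem IsSliceChart.sliceNormSq_fibreCoord (hφ : IsSliceChart n k S φ) {v : NormalSphere g S}
    (hv : v.1.proj ∈ φ.source) : sliceNormSq g φ (baseCoord φ v) (fibreCoord φ v) = 1 :=
  (hφ.inner_self_eq hv v.2.1 v.2.2.1).symm.trans v.2.2.2

theorem IsSliceChart.fibreCoord_ne_zero (hφ : IsSliceChart n k S φ) {v : NormalSphere g S}
    (hv : v.1.proj ∈ φ.source) : fibreCoord φ v ≠ 0 := by
  intro h
  have := hφ.sliceNormSq_fibreCoord hv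
  rw [h, sliceNormSq] at this
  simp at this

theorem baseCoord_neg (v : NormalSphere g S) : baseCoord φ v.neg = baseCoord φ v := rfl

theorem fibreCoord_neg (v : NormalSphere g S) : fibreCoord φ v.neg = -fibreCoord φ v := by
  have : chartDeriv φ v.1.proj (-v.1.snd) = -chartDeriv φ v.1.proj v.1.snd := map_neg _ _
  exact (congrArg (normalCoord n k) this).trans (map_neg _ _)

/-- Any normal components are those of a normal vector. -/
theorem IsSliceChart.isNormal_chartDerivSymm (hφ : IsSliceChart n k S φ) {p : M}
    (hp : p ∈ φ.source) (hpS : p ∈ S) (y : EuclideanSpace ℝ (Fin k)) :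
    IsNormal g S p (chartDerivSymm φ (φ p) (sliceLift g φ (tangentialCoord n k (φ p)) y)) ∧
    dNormal φ p (chartDerivSymm φ (φ p) (sliceLift g φ (tangentialCoord n k (φ p)) y)) = y := by
  have h1 := chartDeriv_chartDerivSymm hφ.mem_maximalAtlas (φ.map_source hp)
    (sliceLift g φ (tangentialCoord n k (φ p)) y)
  rw [φ.left_inv hp] at h1
  have h2 : dNormal φ p (chartDerivSymm φ (φ p) (sliceLift g φ (tangentialCoord n k (φ p)) y))
      = y := by
    refine (congrArg (normalCoord n k) h1).trans ?_
    exact hφ.normalCoord_sliceLift (hφ.mem_sliceBase hp hpS) y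
  refine ⟨(hφ.isNormal_iff hp hpS _).2 ?_, h2⟩
  rw [h2]
  exact h1

theorem IsSliceChart.exists_normalSphere (hφ : IsSliceChart n k S φ) {p : M}
    (hp : p ∈ φ.source) (hpS : p ∈ S) {y : EuclideanSpace ℝ (Fin k)}
    (hy : sliceNormSq g φ (tangentialCoord n k (φ p)) y = 1) :
    ∃ v : NormalSphere g S, v.1.proj = p ∧ fibreCoord φ v = y := by
  obtain ⟨h1, h2⟩ := hφ.isNormal_chartDerivSymm (g := g) hp hpS y
  refine ⟨⟨⟨p, chartDerivSymm φ (φ p) (sliceLift g φ (tangentialCoord n k (φ p)) y)⟩, hpS, h1,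
    ?_⟩, rfl, h2⟩
  refine (hφ.inner_self_eq hp hpS h1).trans ?_
  rw [h2, hy]

/-- The normal components, in a slice chart, of the vectors of a normal frame. -/
def NormalFrame.coord (A : NormalFrame g S) (φ : OpenPartialHomeomorph M (Model n k)) :
    EuclideanSpace ℝ (Fin k) →L[ℝ] EuclideanSpace ℝ (Fin k) :=
  LinearMap.toContinuousLinearMap (((normalCoord n k).comp (chartDeriv φ A.base) :
    Model n k →ₗ[ℝ] EuclideanSpace ℝ (Fin k)) ∘ₗ
    (A.toLin : EuclideanSpace ℝ (Fin k) →ₗ[ℝ] Model n k))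

theorem NormalFrame.fibreCoord_point (A : NormalFrame g S)
    (ξ : Metric.sphere (0 : EuclideanSpace ℝ (Fin k)) 1) :
    fibreCoord φ (A.point ξ) = A.coord φ ξ := rfl

theorem NormalFrame.baseCoord_point (A : NormalFrame g S)
    (ξ : Metric.sphere (0 : EuclideanSpace ℝ (Fin k)) 1) :
    baseCoord φ (A.point ξ) = tangentialCoord n k (φ A.base) := rfl

theorem NormalFrame.sliceNormSq_coord (A : NormalFrame g S) (hφ : IsSliceChart n k S φ)
    (hA : A.base ∈ φ.source) (y : EuclideanSpace ℝ (Fin k)) :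
    sliceNormSq g φ (tangentialCoord n k (φ A.base)) (A.coord φ y) = ‖y‖ ^ 2 :=
  (hφ.inner_self_eq hA A.base_mem (A.normal y)).symm.trans (A.isometry y)

theorem NormalFrame.injective_coord (A : NormalFrame g S) (hφ : IsSliceChart n k S φ)
    (hA : A.base ∈ φ.source) : Function.Injective (A.coord φ) := by
  rw [injective_iff_map_eq_zero]
  intro y hy
  have := A.sliceNormSq_coord hφ hA y
  rw [hy, sliceNormSq] at this
  simpa using this.symm

/-- The matrix of a normal frame in the coordinates of a slice chart has a right inverse. -/
theorem NormalFrame.exists_inverse_coord (A : NormalFrame g S) (hφ : IsSliceChart n k S φ)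
    (hA : A.base ∈ φ.source) :
    ∃ T : EuclideanSpace ℝ (Fin k) →L[ℝ] EuclideanSpace ℝ (Fin k), ∀ y, A.coord φ (T y) = y := by
  let e := LinearEquiv.ofInjectiveEndo
    (A.coord φ : EuclideanSpace ℝ (Fin k) →ₗ[ℝ] EuclideanSpace ℝ (Fin k)) (A.injective_coord hφ hA)
  refine ⟨LinearMap.toContinuousLinearMap
    (e.symm : EuclideanSpace ℝ (Fin k) →ₗ[ℝ] EuclideanSpace ℝ (Fin k)), fun y => ?_⟩
  exact e.apply_symm_apply y

theorem IsSliceChart.exists_normalFrame (hφ : IsSliceChart n k S φ) {p : M}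
    (hp : p ∈ φ.source) (hpS : p ∈ S) : ∃ A : NormalFrame g S, A.base = p := by
  have hx := hφ.mem_sliceBase hp hpS
  obtain ⟨L, hL⟩ := exists_linearMap_bilin_eq_norm_sq
    (metricForm g φ (joinCoord n k (tangentialCoord n k (φ p)) 0))
    (sliceLift g φ (tangentialCoord n k (φ p))) (metricForm_symm g _)
    fun v hv => hφ.sliceNormSq_pos hx hv
  obtain ⟨T, hT⟩ : ∃ T : EuclideanSpace ℝ (Fin k) →ₗ[ℝ] Model n k, ∀ y, T y
      = chartDerivSymm φ (φ p) (sliceLift g φ (tangentialCoord n k (φ p)) (L y)) :=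
    ⟨((chartDerivSymm φ (φ p)).comp
      (sliceLift g φ (tangentialCoord n k (φ p)))).toLinearMap.comp L, fun y => rfl⟩
  have hN : ∀ y, IsNormal g S p (T y) := fun y => by
    rw [hT]
    exact (hφ.isNormal_chartDerivSymm hp hpS (L y)).1
  have hI : ∀ y, g.inner p (T y) (T y) = ‖y‖ ^ 2 := fun y => by
    refine (hφ.inner_self_eq hp hpS (hN y)).trans ?_
    rw [hT, (hφ.isNormal_chartDerivSymm hp hpS (L y)).2]
    exact hL y
  exact ⟨⟨p, hpS, T, hN, hI⟩, rfl⟩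

/-- Normal vectors at the same point that have the same normal components are equal. -/
theorem IsSliceChart.normalSphere_ext (hφ : IsSliceChart n k S φ) {v w : NormalSphere g S}
    (hp : v.1.proj = w.1.proj) (hv : v.1.proj ∈ φ.source)
    (hf : fibreCoord φ v = fibreCoord φ w) : v = w := by
  obtain ⟨⟨p, v⟩, hv'⟩ := v
  obtain ⟨⟨q, w⟩, hw'⟩ := w
  obtain rfl : p = q := hp
  have h1 := hφ.chartDeriv_eq (v := ⟨⟨p, v⟩, hv'⟩) hv
  have h2 := hφ.chartDeriv_eq (v := ⟨⟨p, w⟩, hw'⟩) hv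
  rw [hf] at h1
  have h3 : chartDerivSymm φ (φ p) (chartDeriv φ p v) = chartDerivSymm φ (φ p) (chartDeriv φ p w) :=
    congrArg _ (h1.trans h2.symm)
  obtain rfl : v = w := (chartDerivSymm_chartDeriv hφ.mem_maximalAtlas hv v).symm.trans
    (h3.trans (chartDerivSymm_chartDeriv hφ.mem_maximalAtlas hv w))
  rfl

theorem NormalFrame.exists_point (A : NormalFrame g S) (hφ : IsSliceChart n k S φ)
    {v : NormalSphere g S} (hA : A.base = v.1.proj) (hv : v.1.proj ∈ φ.source) :
    ∃ ξ, A.point ξ = v := by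
  have hA' : A.base ∈ φ.source := hA ▸ hv
  obtain ⟨T, hT⟩ := A.exists_inverse_coord hφ hA'
  have h1 := A.sliceNormSq_coord hφ hA' (T (fibreCoord φ v))
  rw [hT, hA] at h1
  have h2 : sliceNormSq g φ (tangentialCoord n k (φ v.1.proj)) (fibreCoord φ v) = 1 :=
    hφ.sliceNormSq_fibreCoord hv
  rw [h2] at h1
  have h3 : ‖T (fibreCoord φ v)‖ = 1 := by
    exact (pow_eq_one_iff_of_nonneg (norm_nonneg _) two_ne_zero).1 h1.symm
  exact ⟨⟨T (fibreCoord φ v), by simpa using h3⟩,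
    hφ.normalSphere_ext hA hA' ((A.fibreCoord_point _).trans (hT _))⟩

end SliceCharts

/-! ### Fibrewise polynomials and their harmonic decomposition -/

section FibrePolynomials

open Set Laplacian InnerProductSpace

set_option maxSynthPendingDepth 6

variable {n k : ℕ} {M : Type*} [TopologicalSpace M] [ChartedSpace (Model n k) M]
  {φ : OpenPartialHomeomorph M (Model n k)} {S : Set M} [IsManifold (𝓡 (n + k)) ∞ M]
  {g : Metric n k M}

/-- A function on the sphere bundle that is smooth in slice charts is smooth on the fibres. -/
theorem IsSmoothOnSphere.contDiffOn_radialExtension {h : NormalSphere g S → ℝ}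
    (hh : IsSmoothOnSphere h) (hS : IsEmbeddedSubmanifold n k S) (A : NormalFrame g S) :
    ContDiffOn ℝ ∞ (radialExtension fun η => h (A.point η)) {y | y ≠ 0} := by
  obtain ⟨φ, hφ, hA⟩ := hS A.base A.base_mem
  obtain ⟨F, hF, hhF⟩ := hh φ hφ
  have hL : ∀ y ≠ 0, A.coord φ (direction y) ≠ 0 := fun y hy h0 =>
    direction_ne_zero hy (A.injective_coord hφ hA (h0.trans (map_zero _).symm))
  have h1 : ContDiffOn ℝ ∞ (fun y : EuclideanSpace ℝ (Fin k) => A.coord φ (direction y))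
      {y | y ≠ 0} := (A.coord φ).contDiff.comp_contDiffOn contDiffOn_direction
  have h2 : ContDiffOn ℝ ∞ (fun y : EuclideanSpace ℝ (Fin k) =>
      (tangentialCoord n k (φ A.base), direction (A.coord φ (direction y)))) {y | y ≠ 0} :=
    contDiffOn_const.prodMk (contDiffOn_direction.comp h1 hL)
  refine (hF.comp h2 fun y hy =>
    ⟨direction_ne_zero (hL y hy), hφ.mem_sliceBase hA A.base_mem⟩).congr fun y hy => ?_
  rw [radialExtension_of_ne_zero _ hy]
  exact hhF (A.point ⟨direction y, by simpa using norm_direction hy⟩) hA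

theorem IsSmoothOnSphere.add {h₁ h₂ : NormalSphere g S → ℝ} (hh₁ : IsSmoothOnSphere h₁)
    (hh₂ : IsSmoothOnSphere h₂) : IsSmoothOnSphere fun v => h₁ v + h₂ v := by
  intro φ hφ
  obtain ⟨F₁, hF₁, h1⟩ := hh₁ φ hφ
  obtain ⟨F₂, hF₂, h2⟩ := hh₂ φ hφ
  exact ⟨_, hF₁.add hF₂, fun v hv => congrArg₂ (· + ·) (h1 v hv) (h2 v hv)⟩

theorem IsSmoothOnSphere.const_mul {h : NormalSphere g S → ℝ} (c : ℝ)
    (hh : IsSmoothOnSphere h) : IsSmoothOnSphere fun v => c * h v := by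
  intro φ hφ
  obtain ⟨F, hF, h1⟩ := hh φ hφ
  exact ⟨_, contDiffOn_const.mul hF, fun v hv => congrArg (c * ·) (h1 v hv)⟩

theorem isSmoothOnSphere_zero : IsSmoothOnSphere fun _ : NormalSphere g S => (0 : ℝ) :=
  fun _ _ => ⟨fun _ => 0, contDiffOn_const, fun _ _ => rfl⟩

theorem IsSmoothOnSphere.sum {ι : Type*} (T : Finset ι) {H : ι → NormalSphere g S → ℝ}
    (hH : ∀ i, IsSmoothOnSphere (H i)) : IsSmoothOnSphere fun v => ∑ i ∈ T, H i v := by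
  classical
  induction T using Finset.induction_on with
  | empty => simpa using isSmoothOnSphere_zero
  | insert i T hi ih => simpa only [Finset.sum_insert hi] using (hH i).add ih

/-- The Laplacian of the round metric of the fibre, read on `𝕊^{k-1}` by means of the frame `A`. -/
def fibreLaplacian (A : NormalFrame g S) (h : NormalSphere g S → ℝ)
    (ξ : Metric.sphere (0 : EuclideanSpace ℝ (Fin k)) 1) : ℝ :=
  sphericalLaplacian (fun η => h (A.point η)) ξ

theorem fibreLaplacian_add (hS : IsEmbeddedSubmanifold n k S) (A : NormalFrame g S)
    (ξ : Metric.sphere (0 : EuclideanSpace ℝ (Fin k)) 1) {h₁ h₂ : NormalSphere g S → ℝ}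
    (hh₁ : IsSmoothOnSphere h₁) (hh₂ : IsSmoothOnSphere h₂) :
    fibreLaplacian A (fun v => h₁ v + h₂ v) ξ
      = fibreLaplacian A h₁ ξ + fibreLaplacian A h₂ ξ := by
  have hξ : (ξ : EuclideanSpace ℝ (Fin k)) ≠ 0 := ne_zero_of_mem_unit_sphere ξ
  rw [fibreLaplacian, sphericalLaplacian, show radialExtension (fun η => h₁ (A.point η)
    + h₂ (A.point η)) = radialExtension (fun η => h₁ (A.point η))
      + radialExtension (fun η => h₂ (A.point η)) from ?_]
  · exact ContDiffAt.laplacian_add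
      (contDiffAt_two_of_contDiffOn (hh₁.contDiffOn_radialExtension hS A) hξ)
      (contDiffAt_two_of_contDiffOn (hh₂.contDiffOn_radialExtension hS A) hξ)
  · funext y
    simp only [radialExtension, Pi.add_apply]
    split_ifs <;> simp

theorem fibreLaplacian_const_mul (hS : IsEmbeddedSubmanifold n k S) (A : NormalFrame g S)
    (ξ : Metric.sphere (0 : EuclideanSpace ℝ (Fin k)) 1) {h : NormalSphere g S → ℝ} (c : ℝ)
    (hh : IsSmoothOnSphere h) :
    fibreLaplacian A (fun v => c * h v) ξ = c * fibreLaplacian A h ξ := by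
  have hξ : (ξ : EuclideanSpace ℝ (Fin k)) ≠ 0 := ne_zero_of_mem_unit_sphere ξ
  rw [fibreLaplacian, sphericalLaplacian, show radialExtension (fun η => c * h (A.point η))
    = c • radialExtension (fun η => h (A.point η)) from ?_]
  · exact laplacian_smul c
      (contDiffAt_two_of_contDiffOn (hh.contDiffOn_radialExtension hS A) hξ)
  · funext y
    simp only [radialExtension, Pi.smul_apply]
    split_ifs <;> simp

theorem fibreLaplacian_sum (hS : IsEmbeddedSubmanifold n k S) (A : NormalFrame g S)
    (ξ : Metric.sphere (0 : EuclideanSpace ℝ (Fin k)) 1) {ι : Type*} (T : Finset ι)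
    {H : ι → NormalSphere g S → ℝ}
    (hH : ∀ i, IsSmoothOnSphere (H i)) :
    fibreLaplacian A (fun v => ∑ i ∈ T, H i v) ξ = ∑ i ∈ T, fibreLaplacian A (H i) ξ := by
  classical
  induction T using Finset.induction_on with
  | empty =>
    have := fibreLaplacian_const_mul (h := fun _ : NormalSphere g S => 0) hS A ξ 0
      isSmoothOnSphere_zero
    simpa using this
  | insert i T hi ih =>
    simp only [Finset.sum_insert hi]
    rw [fibreLaplacian_add hS A ξ (hH i) (IsSmoothOnSphere.sum T hH), ih]

theorem const_mul_mem_sphericalHarmonics {m : ℕ} {h : NormalSphere g S → ℝ} (c : ℝ)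
    (hS : IsEmbeddedSubmanifold n k S) (hh : h ∈ sphericalHarmonics g S m) :
    (fun v => c * h v) ∈ sphericalHarmonics g S m := by
  refine ⟨hh.1.const_mul c, fun A ξ => ?_, fun hk v => ?_⟩
  · have h1 := fibreLaplacian_const_mul hS A ξ c hh.1
    have h2 := hh.2.1 A ξ
    rw [fibreLaplacian, fibreLaplacian] at h1
    rw [h1]
    linear_combination c * h2
  · beta_reduce
    rw [hh.2.2 hk v]
    ring

theorem zero_mem_sphericalHarmonics (hS : IsEmbeddedSubmanifold n k S) (m : ℕ) :
    (fun _ => 0) ∈ sphericalHarmonics g S m := by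
  refine ⟨isSmoothOnSphere_zero, fun A ξ => ?_, fun _ _ => by simp⟩
  have := fibreLaplacian_const_mul (h := fun _ : NormalSphere g S => 0) hS A ξ 0
    isSmoothOnSphere_zero
  rw [fibreLaplacian, fibreLaplacian, zero_mul] at this
  simp only [zero_mul] at this
  rw [this]
  simp

/-- Functions on the unit normal sphere bundle that are the restrictions to the fibres of
homogeneous polynomials of degree `j` on the normal spaces, with smooth coefficients. The
polynomials are given in the fibre coordinates of the slice charts. -/
def IsFibrePoly (j : ℕ) (h : NormalSphere g S → ℝ) : Prop :=
  ∀ φ : OpenPartialHomeomorph M (Model n k), IsSliceChart n k S φ →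
    ∃ P : EuclideanSpace ℝ (Fin n) → EuclideanSpace ℝ (Fin k) → ℝ,
      ContDiffOn ℝ ∞ (fun z : EuclideanSpace ℝ (Fin n) × EuclideanSpace ℝ (Fin k) => P z.1 z.2)
        {z | z.1 ∈ sliceBase φ} ∧
      (∀ x ∈ sliceBase φ, ∀ (c : ℝ) y, P x (c • y) = c ^ j * P x y) ∧
      ∀ v : NormalSphere g S, v.1.proj ∈ φ.source → h v = P (baseCoord φ v) (fibreCoord φ v)

theorem isHomPoly_of_contDiffOn {X Y : Type} [NormedAddCommGroup X] [NormedSpace ℝ X]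
    [NormedAddCommGroup Y] [NormedSpace ℝ Y] {U : Set X} {j : ℕ} {P : X → Y → ℝ}
    (hP : ContDiffOn ℝ ∞ (fun z : X × Y => P z.1 z.2) {z | z.1 ∈ U})
    (hh : ∀ x ∈ U, ∀ (c : ℝ) y, P x (c • y) = c ^ j * P x y) {x : X} (hx : x ∈ U) :
    IsHomPoly j (P x) := by
  refine ⟨?_, hh x hx⟩
  rw [← contDiffOn_univ]
  exact hP.comp (f := fun y : Y => (x, y)) (contDiff_const.prodMk contDiff_id).contDiffOn
    fun _ _ => hx

theorem contDiffOn_fderiv_snd_apply {X Y : Type} [NormedAddCommGroup X] [NormedSpace ℝ X]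
    [NormedAddCommGroup Y] [NormedSpace ℝ Y] {U : Set X} (hU : IsOpen U) {P : X → Y → ℝ}
    (hP : ContDiffOn ℝ ∞ (fun z : X × Y => P z.1 z.2) {z | z.1 ∈ U}) {a : X → Y}
    (ha : ContDiffOn ℝ ∞ a U) :
    ContDiffOn ℝ ∞ (fun z : X × Y => fderiv ℝ (P z.1) z.2 (a z.1)) {z | z.1 ∈ U} := by
  have hopen : IsOpen {z : X × Y | z.1 ∈ U} := hU.preimage continuous_fst
  have h1 : ContDiffOn ℝ ∞ (fun z : X × Y =>
      fderiv ℝ (fun z : X × Y => P z.1 z.2) z ((0 : X), a z.1)) {z | z.1 ∈ U} :=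
    (hP.fderiv_of_isOpen hopen (by simp)).clm_apply
      (contDiffOn_const.prodMk (ha.comp contDiffOn_fst fun _ h => h))
  refine h1.congr fun z hz => ?_
  have h3 := ((hP.differentiableOn (by simp)).differentiableAt (hopen.mem_nhds hz)).hasFDerivAt
  have h4 : HasFDerivAt (fun y : Y => ((z.1, y) : X × Y)) (ContinuousLinearMap.inr ℝ X Y)
      z.2 := hasFDerivAt_prodMk_right _ _
  have h5 := DFunLike.congr_fun (h3.comp z.2 h4).fderiv (a z.1)
  exact h5

/-- The Laplacian of the normal space at the point with coordinates `(x, 0)` in a slice chart,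
applied to the function `P x` of the normal components `y`: the trace of the Hessian with respect
to the metric of the normal space. -/
def normalLaplacian (g : Metric n k M) (φ : OpenPartialHomeomorph M (Model n k))
    (P : EuclideanSpace ℝ (Fin n) → EuclideanSpace ℝ (Fin k) → ℝ)
    (x : EuclideanSpace ℝ (Fin n)) (y : EuclideanSpace ℝ (Fin k)) : ℝ :=
  ∑ i, fderiv ℝ (fun y' => fderiv ℝ (P x) y' (EuclideanSpace.basisFun (Fin k) ℝ i)) y
    (conormalGram (metricForm g φ (joinCoord n k x 0)) (normalCoord n k)
      (EuclideanSpace.basisFun (Fin k) ℝ i))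

theorem IsSliceChart.contDiffOn_normalLaplacian (hφ : IsSliceChart n k S φ)
    {P : EuclideanSpace ℝ (Fin n) → EuclideanSpace ℝ (Fin k) → ℝ}
    (hP : ContDiffOn ℝ ∞ (fun z : EuclideanSpace ℝ (Fin n) × EuclideanSpace ℝ (Fin k) =>
      P z.1 z.2) {z | z.1 ∈ sliceBase φ}) :
    ContDiffOn ℝ ∞ (fun z : EuclideanSpace ℝ (Fin n) × EuclideanSpace ℝ (Fin k) =>
      normalLaplacian g φ P z.1 z.2) {z | z.1 ∈ sliceBase φ} := by
  refine ContDiffOn.sum fun i _ => ?_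
  refine contDiffOn_fderiv_snd_apply (isOpen_sliceBase φ)
    (P := fun x y' => fderiv ℝ (P x) y' (EuclideanSpace.basisFun (Fin k) ℝ i))
    (a := fun x => conormalGram (metricForm g φ (joinCoord n k x 0)) (normalCoord n k)
      (EuclideanSpace.basisFun (Fin k) ℝ i)) ?_ ?_
  · exact contDiffOn_fderiv_snd_apply (isOpen_sliceBase φ) hP contDiffOn_const
  · exact (contDiffOn_conormalGram hφ.contDiffOn_metricForm_slice
      (fun _ hx => metricForm_pos g hφ.mem_maximalAtlas hx)).clm_apply contDiffOn_const

theorem normalLaplacian_of_lt_two [Nontrivial (EuclideanSpace ℝ (Fin k))] {j : ℕ} (hj : j < 2)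
    {P : EuclideanSpace ℝ (Fin n) → EuclideanSpace ℝ (Fin k) → ℝ}
    {x : EuclideanSpace ℝ (Fin n)} (hP : IsHomPoly j (P x)) (y : EuclideanSpace ℝ (Fin k)) :
    normalLaplacian g φ P x y = 0 := by
  refine Finset.sum_eq_zero fun i _ => ?_
  have hconst : ∃ c, ∀ y', fderiv ℝ (P x) y' = c := by
    interval_cases j
    · refine ⟨0, fun y' => ?_⟩
      rw [show P x = fun _ => P x 0 from funext fun y => hP.eq_const y]
      simp
    · exact ⟨_, hP.fderiv.eq_const⟩
  obtain ⟨c, hc⟩ := hconst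
  simp [hc]

theorem normalLaplacian_smul [Nontrivial (EuclideanSpace ℝ (Fin k))] {j : ℕ}
    {P : EuclideanSpace ℝ (Fin n) → EuclideanSpace ℝ (Fin k) → ℝ}
    {x : EuclideanSpace ℝ (Fin n)} (hP : IsHomPoly (j + 2) (P x)) (c : ℝ)
    (y : EuclideanSpace ℝ (Fin k)) :
    normalLaplacian g φ P x (c • y) = c ^ j * normalLaplacian g φ P x y := by
  rw [normalLaplacian, normalLaplacian, Finset.mul_sum]
  refine Finset.sum_congr rfl fun i _ => ?_
  have h1 : IsHomPoly (j + 1) (fun y' => fderiv ℝ (P x) y'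
      (EuclideanSpace.basisFun (Fin k) ℝ i)) :=
    ⟨hP.fderiv.contDiff.clm_apply contDiff_const, fun c y => by
      rw [hP.fderiv.map_smul, smul_apply]⟩
  rw [h1.fderiv.map_smul, smul_apply, smul_eq_mul]

/-- In an orthonormal frame, `normalLaplacian` is the Euclidean Laplacian. -/
theorem laplacian_comp_coord (hφ : IsSliceChart n k S φ) (A : NormalFrame g S)
    (hA : A.base ∈ φ.source) {P : EuclideanSpace ℝ (Fin n) → EuclideanSpace ℝ (Fin k) → ℝ}
    (hP : ContDiff ℝ ∞ (P (tangentialCoord n k (φ A.base)))) (y : EuclideanSpace ℝ (Fin k)) :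
    Δ (fun y => P (tangentialCoord n k (φ A.base)) (A.coord φ y)) y
      = normalLaplacian g φ P (tangentialCoord n k (φ A.base)) (A.coord φ y) := by
  set x := tangentialCoord n k (φ A.base)
  have hx : x ∈ sliceBase φ := hφ.mem_sliceBase hA A.base_mem
  set L := A.coord φ
  have h2 : ContDiff ℝ ∞ (fun y => P x (L y)) := hP.comp L.contDiff
  have hd : ∀ y, HasFDerivAt (P x) (fderiv ℝ (P x) y) y := fun y =>
    (hP.differentiable (by simp) y).hasFDerivAt
  have hd2 : ∀ y, HasFDerivAt (fderiv ℝ (P x)) (fderiv ℝ (fderiv ℝ (P x)) y) y := fun y =>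
    ((hP.fderiv_right (m := ∞) (by simp)).differentiable (by simp) y).hasFDerivAt
  have h3 := sum_bilin_eq_of_isometry (metricForm_pos g hφ.mem_maximalAtlas hx)
    normalCoord_surjective (A.sliceNormSq_coord hφ hA) (metricForm_symm g _)
    (EuclideanSpace.basisFun (Fin k) ℝ) (fderiv ℝ (fderiv ℝ (P x)) (L y))
  rw [laplacian_eq_sum_fderiv_apply (EuclideanSpace.basisFun (Fin k) ℝ)
    (h2.contDiffAt.of_le ENat.LEInfty.out), normalLaplacian]
  refine Eq.trans ?_ (h3.trans ?_)
  · refine Finset.sum_congr rfl fun i _ => ?_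
    have h4 : (fun y => fderiv ℝ (fun y => P x (L y)) y (EuclideanSpace.basisFun (Fin k) ℝ i))
        = fun y => fderiv ℝ (P x) (L y) (L (EuclideanSpace.basisFun (Fin k) ℝ i)) := by
      funext z
      exact DFunLike.congr_fun ((hd (L z)).comp z L.hasFDerivAt).fderiv _
    rw [h4]
    have h5 := ((hd2 (L y)).comp y L.hasFDerivAt).clm_apply
      (hasFDerivAt_const (L (EuclideanSpace.basisFun (Fin k) ℝ i)) y)
    refine (DFunLike.congr_fun h5.fderiv _).trans ?_
    simp [L]
  · refine Finset.sum_congr rfl fun i _ => ?_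
    have h5 := (hd2 (L y)).clm_apply (hasFDerivAt_const (EuclideanSpace.basisFun (Fin k) ℝ i) (L y))
    refine Eq.trans ?_ (DFunLike.congr_fun h5.fderiv _).symm
    simp

/-- On a fibre, `Δ + j (j + k - 2)` applied to the restriction of a homogeneous polynomial of degree
`j` is the restriction of the Laplacian of the polynomial. -/
theorem fibreLaplacian_add_of_eq (hφ : IsSliceChart n k S φ) (A : NormalFrame g S)
    (hA : A.base ∈ φ.source) {P : EuclideanSpace ℝ (Fin n) → EuclideanSpace ℝ (Fin k) → ℝ} {j : ℕ}
    (hP : IsHomPoly j (P (tangentialCoord n k (φ A.base)))) {h : NormalSphere g S → ℝ}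
    (hh : ∀ v : NormalSphere g S, v.1.proj ∈ φ.source → h v = P (baseCoord φ v) (fibreCoord φ v))
    (ξ : Metric.sphere (0 : EuclideanSpace ℝ (Fin k)) 1) :
    fibreLaplacian A h ξ + (j : ℝ) * ((j : ℝ) + (k : ℝ) - 2) * h (A.point ξ)
      = normalLaplacian g φ P (baseCoord φ (A.point ξ)) (fibreCoord φ (A.point ξ)) := by
  have hp := hP.comp_continuousLinearMap (A.coord φ)
  have hu : ∀ ξ : Metric.sphere (0 : EuclideanSpace ℝ (Fin k)) 1,
      P (tangentialCoord n k (φ A.base)) (A.coord φ ξ) = h (A.point ξ) := fun ξ =>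
    (hh (A.point ξ) hA).symm
  have h1 := laplacian_homExtension j (contDiffOn_radialExtension hp hu) ξ
  refine h1.symm.trans (Eq.trans ?_ (laplacian_comp_coord hφ A hA hP.contDiff _))
  refine (laplacian_congr_nhds ?_).self_of_nhds.symm
  filter_upwards [isOpen_ne.mem_nhds (ne_zero_of_mem_unit_sphere ξ)] with y hy
  exact eq_homExtension_of_isPosHom hp.isPosHom hu hy

/-- On fibre polynomials of degree `j`, the operator `Δ + j (j + k - 2)` of the sphere is the
restriction of the Laplacian of the normal spaces, hence lowers the degree by `2`. -/
theorem IsFibrePoly.exists_laplacian (hS : IsEmbeddedSubmanifold n k S)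
    [Nontrivial (EuclideanSpace ℝ (Fin k))] {j : ℕ} {h : NormalSphere g S → ℝ}
    (hh : IsFibrePoly j h) : ∃ h' : NormalSphere g S → ℝ,
      (2 ≤ j → IsFibrePoly (j - 2) h') ∧ (j < 2 → ∀ v, h' v = 0) ∧
      ∀ (A : NormalFrame g S) ξ, fibreLaplacian A h ξ
        + (j : ℝ) * ((j : ℝ) + (k : ℝ) - 2) * h (A.point ξ) = h' (A.point ξ) := by
  -- the left-hand side does not depend on a slice chart, so that the Laplacians computed in
  -- different charts fit together to a function on the sphere bundle
  have hex : ∀ v : NormalSphere g S, ∃ a : ℝ, ∀ φ, IsSliceChart n k S φ → v.1.proj ∈ φ.source →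
      ∀ P : EuclideanSpace ℝ (Fin n) → EuclideanSpace ℝ (Fin k) → ℝ,
      IsHomPoly j (P (baseCoord φ v)) →
      (∀ v : NormalSphere g S, v.1.proj ∈ φ.source → h v = P (baseCoord φ v) (fibreCoord φ v)) →
      a = normalLaplacian g φ P (baseCoord φ v) (fibreCoord φ v) := by
    intro v
    obtain ⟨φ, hφ, hv⟩ := hS v.1.proj v.2.1
    obtain ⟨A, hA⟩ := hφ.exists_normalFrame (g := g) hv v.2.1
    obtain ⟨ξ, hξ⟩ := A.exists_point hφ hA hv
    refine ⟨fibreLaplacian A h ξ + (j : ℝ) * ((j : ℝ) + (k : ℝ) - 2) * h (A.point ξ),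
      fun ψ hψ hv' P hP hhP => ?_⟩
    subst hξ
    exact fibreLaplacian_add_of_eq hψ A hv' hP hhP ξ
  choose h' hh' using hex
  refine ⟨h', fun hj φ hφ => ?_, fun hj v => ?_, fun A ξ => ?_⟩
  · obtain ⟨P, hP, hhom, hhP⟩ := hh φ hφ
    obtain ⟨i, rfl⟩ : ∃ i, j = i + 2 := ⟨j - 2, by omega⟩
    rw [Nat.add_sub_cancel]
    refine ⟨normalLaplacian g φ P, hφ.contDiffOn_normalLaplacian hP, fun x hx =>
      normalLaplacian_smul (isHomPoly_of_contDiffOn hP hhom hx), fun v hv => ?_⟩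
    exact hh' v φ hφ hv P (isHomPoly_of_contDiffOn hP hhom (hφ.baseCoord_mem hv)) hhP
  · obtain ⟨φ, hφ, hv⟩ := hS v.1.proj v.2.1
    obtain ⟨P, hP, hhom, hhP⟩ := hh φ hφ
    have h1 := isHomPoly_of_contDiffOn hP hhom (hφ.baseCoord_mem hv)
    rw [hh' v φ hφ hv P h1 hhP, normalLaplacian_of_lt_two hj h1]
  · obtain ⟨φ, hφ, hA⟩ := hS A.base A.base_mem
    obtain ⟨P, hP, hhom, hhP⟩ := hh φ hφ
    have h1 := isHomPoly_of_contDiffOn hP hhom (hφ.mem_sliceBase hA A.base_mem)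
    rw [fibreLaplacian_add_of_eq hφ A hA h1 hhP]
    exact (hh' (A.point ξ) φ hφ hA P h1 hhP).symm

theorem IsFibrePoly.isSmoothOnSphere {j : ℕ} {h : NormalSphere g S → ℝ}
    (hh : IsFibrePoly j h) : IsSmoothOnSphere h := by
  intro φ hφ
  obtain ⟨P, hP, hhom, hhP⟩ := hh φ hφ
  have hsub : {z : EuclideanSpace ℝ (Fin n) × EuclideanSpace ℝ (Fin k) |
      z.2 ≠ 0 ∧ joinCoord n k z.1 0 ∈ φ.target} ⊆ {z | z.1 ∈ sliceBase φ} := fun z hz => hz.2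
  have hq := (hφ.contDiffOn_sliceNormSq (g := g)).mono hsub
  -- the unit normal vector in the direction of `y` has normal components `y / |y|_g`
  refine ⟨fun z => ((√(sliceNormSq g φ z.1 z.2))⁻¹) ^ j * P z.1 z.2, ?_, fun v hv => ?_⟩
  · refine ContDiffOn.mul (ContDiffOn.pow (ContDiffOn.inv (hq.sqrt fun z hz => ?_)
      fun z hz => ?_) j) (hP.mono hsub)
    · exact (hφ.sliceNormSq_pos hz.2 hz.1).ne'
    · exact (Real.sqrt_pos.2 (hφ.sliceNormSq_pos hz.2 hz.1)).ne'
  · have hy := hφ.fibreCoord_ne_zero hv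
    have h1 := hφ.sliceNormSq_fibreCoord hv
    have hx := hφ.baseCoord_mem hv
    rw [hhP v hv]
    change _ = ((√(sliceNormSq g φ (baseCoord φ v) (‖fibreCoord φ v‖⁻¹ • fibreCoord φ v)))⁻¹) ^ j
      * P (baseCoord φ v) (‖fibreCoord φ v‖⁻¹ • fibreCoord φ v)
    rw [sliceNormSq_smul, h1, mul_one, Real.sqrt_sq (by positivity), inv_inv, hhom _ hx,
      ← mul_assoc, ← mul_pow, mul_inv_cancel₀ (norm_ne_zero_iff.2 hy), one_pow, one_mul]

theorem IsFibrePoly.neg_apply (hS : IsEmbeddedSubmanifold n k S) {j : ℕ}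
    {h : NormalSphere g S → ℝ} (hh : IsFibrePoly j h) (v : NormalSphere g S) :
    h v.neg = (-1) ^ j * h v := by
  obtain ⟨φ, hφ, hv⟩ := hS v.1.proj v.2.1
  obtain ⟨P, hP, hhom, hhP⟩ := hh φ hφ
  rw [hhP v hv, hhP v.neg hv, fibreCoord_neg, baseCoord_neg, ← hhom _ (hφ.baseCoord_mem hv),
    neg_one_smul]

/-- If `(Δ + j (j + k - 2)) h` is a sum of spherical harmonics of degrees `m`, each multiplied by
the difference of the eigenvalues of degrees `j` and `m`, then `h` minus the sum of these harmonics
is a spherical harmonic of degree `j`. -/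
theorem sub_sum_mem_sphericalHarmonics (hS : IsEmbeddedSubmanifold n k S) {j : ℕ}
    {h : NormalSphere g S → ℝ} (hh : IsSmoothOnSphere h) (T : Finset ℕ)
    {H : ℕ → NormalSphere g S → ℝ} (hH : ∀ m, H m ∈ sphericalHarmonics g S m)
    (hT : ∀ m ∈ T, m % 2 = j % 2)
    (hΔ : ∀ (A : NormalFrame g S) ξ, fibreLaplacian A h ξ
      + (j : ℝ) * ((j : ℝ) + (k : ℝ) - 2) * h (A.point ξ)
        = ∑ m ∈ T, (((j : ℝ) - m) * ((j : ℝ) + m + k - 2)) * H m (A.point ξ))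
    (hneg : ∀ v, h v.neg = (-1) ^ j * h v) :
    (fun v => h v + -1 * ∑ m ∈ T, H m v) ∈ sphericalHarmonics g S j := by
  have hsm : ∀ m, IsSmoothOnSphere (H m) := fun m => (hH m).1
  have hsub : IsSmoothOnSphere fun v => -1 * ∑ m ∈ T, H m v :=
    (IsSmoothOnSphere.sum T hsm).const_mul (-1)
  refine ⟨hh.add hsub, fun A ξ => ?_, fun hk1 v => ?_⟩
  · have e1 := fibreLaplacian_add hS A ξ hh hsub
    rw [fibreLaplacian_const_mul hS A ξ (-1) (IsSmoothOnSphere.sum T hsm),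
      fibreLaplacian_sum hS A ξ T hsm] at e1
    have e3 : ∑ i ∈ T, fibreLaplacian A (H i) ξ
        = ∑ m ∈ T, (((j : ℝ) - m) * ((j : ℝ) + m + k - 2)) * H m (A.point ξ)
          - (j : ℝ) * ((j : ℝ) + (k : ℝ) - 2) * ∑ m ∈ T, H m (A.point ξ) := by
      rw [Finset.mul_sum, ← Finset.sum_sub_distrib]
      refine Finset.sum_congr rfl fun i _ => ?_
      have e4 : fibreLaplacian A (H i) ξ
          + (i : ℝ) * ((i : ℝ) + (k : ℝ) - 2) * H i (A.point ξ) = 0 :=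
        (hH i).2.1 A ξ
      linear_combination e4
    have e2 := hΔ A ξ
    rw [e3] at e1
    refine (congrArg₂ (· + ·) e1 rfl).trans ?_
    beta_reduce
    linear_combination e2
  · beta_reduce
    have e : ∀ m ∈ T, H m v.neg = (-1) ^ j * H m v := fun m hm => by
      rw [(hH m).2.2 hk1 v, neg_one_pow_eq_pow_mod_two, hT m hm, ← neg_one_pow_eq_pow_mod_two]
    rw [hneg, Finset.sum_congr rfl e, ← Finset.mul_sum]
    ring

/-- A homogeneous polynomial restricted to the sphere is a sum of spherical harmonics of the same
parity and of at most the same degree. By induction on `j`, this holds for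
`(Δ + j (j + k - 2)) h`; the component of degree `m < j` is to be divided by the difference of
eigenvalues `(j - m) (j + m + k - 2) ≠ 0`. -/
theorem IsFibrePoly.mem_parityHarmonics (hS : IsEmbeddedSubmanifold n k S)
    [Nontrivial (EuclideanSpace ℝ (Fin k))] {j : ℕ} {h : NormalSphere g S → ℝ}
    (hh : IsFibrePoly j h) : h ∈ parityHarmonics g S j := by
  have hk : 1 ≤ k := one_le_of_nontrivial
  induction j using Nat.strong_induction_on generalizing h with
  | _ j ih =>
    obtain ⟨h', h1, h2, h3⟩ := hh.exists_laplacian hS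
    set T := (Finset.range j).filter (fun m => m % 2 = j % 2) with hT
    obtain ⟨H', hH', hsum⟩ : ∃ H' : ℕ → NormalSphere g S → ℝ,
        (∀ m, H' m ∈ sphericalHarmonics g S m) ∧ ∀ v, h' v = ∑ m ∈ T, H' m v := by
      rcases lt_or_ge j 2 with hj | hj
      · exact ⟨fun _ _ => 0, zero_mem_sphericalHarmonics hS, fun v => by simp [h2 hj v]⟩
      · obtain ⟨H', hH', hsum⟩ := ih (j - 2) (by omega) (h1 hj)
        refine ⟨H', hH', fun v => (hsum v).trans (Finset.sum_congr ?_ fun _ _ => rfl)⟩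
        ext m
        simp only [hT, Finset.mem_filter, Finset.mem_range]
        omega
    -- the eigenvalues of degrees `j` and `m` differ by `c m`
    let c : ℕ → ℝ := fun m => ((j : ℝ) - m) * ((j : ℝ) + m + k - 2)
    have hc : ∀ m ∈ T, c m ≠ 0 := by
      intro m hm
      simp only [hT, Finset.mem_filter, Finset.mem_range] at hm
      have e1 : (m : ℝ) + 2 ≤ j := by
        have : m + 2 ≤ j := by omega
        exact_mod_cast this
      have e2 : (1 : ℝ) ≤ k := by exact_mod_cast hk
      have e3 : (0 : ℝ) ≤ m := by positivity
      exact mul_ne_zero (by linarith) (by linarith)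
    have hG : ∀ m, (fun v => (c m)⁻¹ * H' m v) ∈ sphericalHarmonics g S m := fun m =>
      const_mul_mem_sphericalHarmonics _ hS (hH' m)
    have hmain : (fun v => h v + -1 * ∑ m ∈ T, (c m)⁻¹ * H' m v) ∈ sphericalHarmonics g S j := by
      refine sub_sum_mem_sphericalHarmonics hS hh.isSmoothOnSphere T hG (fun m hm => ?_)
        (fun A ξ => ?_) (hh.neg_apply hS)
      · rw [hT, Finset.mem_filter] at hm
        exact hm.2
      · rw [h3, hsum]
        exact Finset.sum_congr rfl fun m hm => (mul_inv_cancel_left₀ (hc m hm) _).symm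
    refine ⟨fun m => if m = j then fun v => h v + -1 * ∑ m ∈ T, (c m)⁻¹ * H' m v
      else fun v => (c m)⁻¹ * H' m v, fun m => ?_, fun v => ?_⟩
    · rcases eq_or_ne m j with rfl | hm
      · beta_reduce
        rw [if_pos rfl]
        exact hmain
      · beta_reduce
        rw [if_neg hm]
        exact hG m
    · have e1 : (Finset.range (j + 1)).filter (fun m => m % 2 = j % 2) = insert j T := by
        ext m
        simp only [hT, Finset.mem_filter, Finset.mem_range, Finset.mem_insert]
        omega
      have e2 : ∀ m ∈ T, m ≠ j := by
        rintro m hm rfl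
        simp [hT] at hm
      have e3 : ∀ m ∈ T, (if m = j then fun v => h v + -1 * ∑ m ∈ T, (c m)⁻¹ * H' m v
          else fun v => (c m)⁻¹ * H' m v) v = (c m)⁻¹ * H' m v := fun m hm => by
        rw [if_neg (e2 m hm)]
      beta_reduce
      rw [e1, Finset.sum_insert fun hj => e2 j hj rfl, if_pos rfl, Finset.sum_congr rfl e3]
      ring

end FibrePolynomials

/-! ### Normal geodesics and derivatives along them -/

section NormalRays

open Set

set_option maxSynthPendingDepth 6

/-- A smooth curve through the origin is `t • w t` with `w` smooth and `w 0` its velocity. -/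
theorem exists_contDiffOn_eq_smul {F : Type} [NormedAddCommGroup F] [NormedSpace ℝ F]
    [CompleteSpace F] {b : ℝ → F} {δ : ℝ} (hδ : 0 < δ) (hb : ContDiffOn ℝ ∞ b (Ioo (-δ) δ))
    (hb0 : b 0 = 0) : ∃ w : ℝ → F, ContDiffOn ℝ ∞ w (Ico 0 δ) ∧ w 0 = deriv b 0 ∧
      ∀ t ∈ Ico 0 δ, b t = t • w t := by
  have h0 : (0 : ℝ) ∈ Ioo (-δ) δ := by simp [hδ]
  have hΩ : IsOpen {z : ℝ × ℝ | z.2 ∈ Ioo (-δ) δ} := isOpen_Ioo.preimage continuous_snd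
  obtain ⟨f', hf', h⟩ := exists_contDiffOn_eq_add_smul hΩ (fun _ _ _ => h0)
    (f := fun z : ℝ × ℝ => b z.2) ((hb.comp contDiffOn_snd fun _ h => h).mono inter_subset_left)
  have hw : ContDiffOn ℝ ∞ (fun t : ℝ => f' ((0 : ℝ), t)) (Ico 0 δ) :=
    hf'.comp (contDiffOn_const.prodMk contDiffOn_id) fun t ht =>
      ⟨⟨by linarith [ht.1, ht.2], ht.2⟩, ht.1⟩
  have heq : ∀ t ∈ Ico 0 δ, b t = t • f' ((0 : ℝ), t) := fun t ht => by
    have := h ((0 : ℝ), t) ⟨⟨by linarith [ht.1, ht.2], ht.2⟩, ht.1⟩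
    simpa [hb0] using this
  refine ⟨_, hw, ?_, heq⟩
  have hm : (0 : ℝ) ∈ Ico 0 δ := ⟨le_rfl, hδ⟩
  have h1 : HasDerivWithinAt b (deriv b 0) (Ico 0 δ) 0 :=
    ((hb.differentiableOn (by simp)).differentiableAt
      (isOpen_Ioo.mem_nhds h0)).hasDerivAt.hasDerivWithinAt
  have h2 := (hasDerivWithinAt_id (0 : ℝ) (Ico 0 δ)).smul
    ((hw.differentiableOn (by simp) 0 hm).hasDerivWithinAt)
  have h3 := h2.congr (f₁ := b) (fun t ht => heq t ht) (heq 0 hm)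
  simpa using (uniqueDiffOn_Ico 0 δ 0 hm).eq_deriv _ h3 h1

variable {n k : ℕ} {M : Type*} [TopologicalSpace M] [ChartedSpace (Model n k) M]
  {φ : OpenPartialHomeomorph M (Model n k)} {S : Set M} [IsManifold (𝓡 (n + k)) ∞ M]
  {g : Metric n k M}

/-- The normal geodesic with initial velocity `v`, in a slice chart; for small positive times it
lies outside the submanifold, because its normal components have nonzero velocity. -/
theorem IsSliceChart.exists_ray (hφ : IsSliceChart n k S φ) {v : NormalSphere g S}
    (hv : v.1.proj ∈ φ.source) : ∃ c : ℝ → Model n k, ∃ δ > 0, c 0 = φ v.1.proj ∧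
      deriv c 0 = sliceLift g φ (baseCoord φ v) (fibreCoord φ v) ∧
      ContDiffOn ℝ ∞ c (Ioo (-δ) δ) ∧
      (∀ t ∈ Ioo (-δ) δ, c t ∈ φ.target ∧
        deriv (deriv c) t = spray (metricForm g φ) (c t) (deriv c t)) ∧
      normalRay v 0 = Sum.inr v ∧
      ∀ t ∈ Ioo 0 δ, normalCoord n k (c t) ≠ 0 ∧ ∃ q : {q : M // q ∉ S},
        normalRay v t = Sum.inl q ∧ q.1 ∈ φ.source ∧ φ q.1 = c t := by
  obtain ⟨h0, h1, δ, hδ, hc, hgeo⟩ :=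
    (isGeodesicFrom_geodesic g v.1).exists_curve hφ.mem_maximalAtlas hv
  set γ := geodesic g v.1 with hγ
  have hm : (0 : ℝ) ∈ Ioo (-δ) δ := by simp [hδ]
  have hd : HasDerivAt (φ ∘ γ) (chartDeriv φ v.1.proj v.1.snd) 0 := by
    rw [← h1]
    exact ((hc.differentiableOn (by simp)).differentiableAt (isOpen_Ioo.mem_nhds hm)).hasDerivAt
  have hn : HasDerivAt (fun t => normalCoord n k ((φ ∘ γ) t)) (fibreCoord φ v) 0 :=
    (normalCoord n k).hasFDerivAt.comp_hasDerivAt 0 hd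
  have hne := hn.eventually_ne (c := 0) (hφ.fibreCoord_ne_zero hv)
  rw [eventually_nhdsWithin_iff] at hne
  obtain ⟨r, hr, hrs⟩ := Metric.eventually_nhds_iff.1 hne
  have hmono : Ioo (-(min δ r)) (min δ r) ⊆ Ioo (-δ) δ :=
    Ioo_subset_Ioo (neg_le_neg (min_le_left _ _)) (min_le_left _ _)
  refine ⟨φ ∘ γ, min δ r, lt_min hδ hr, congrArg φ h0, h1.trans (hφ.chartDeriv_eq hv),
    hc.mono hmono, fun t ht => ⟨φ.map_source (hgeo t (hmono ht)).1, (hgeo t (hmono ht)).2⟩,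
    ?_, fun t ht => ?_⟩
  · have : γ 0 ∈ S := by
      rw [h0]
      exact v.2.1
    exact dif_neg (not_not.2 this)
  · have ht' : t ∈ Ioo (-(min δ r)) (min δ r) := ⟨by linarith [ht.1, ht.2], ht.2⟩
    have hn0 : normalCoord n k ((φ ∘ γ) t) ≠ 0 :=
      hrs (by simpa using (abs_lt.2 ht').trans_le (min_le_right _ _)) ht.1.ne'
    have hs := (hgeo t (hmono ht')).1
    have hγS : γ t ∉ S := fun h => hn0 ((hφ.mem_iff _ hs).1 h)
    exact ⟨hn0, ⟨γ t, hγS⟩, dif_pos hγS, hs, rfl⟩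

/-- The normal derivatives of a smooth function on `M` are fibre polynomials: the `j`-th derivative
along the geodesic with initial velocity `a` is homogeneous of degree `j` in `a`. -/
theorem isFibrePoly_tDeriv {u : M → ℝ} (hu : ContMDiff (𝓡 (n + k)) 𝓘(ℝ, ℝ) ∞ u)
    {f : Blowup g S → ℝ} (hf : ∀ q, f q = u (blowdown q)) (j : ℕ) : IsFibrePoly j (tDeriv f j) := by
  intro φ hφ
  have hG := contDiffOn_metricForm g hφ.mem_maximalAtlas
  have hpos := fun z (hz : z ∈ φ.target) => metricForm_pos g hφ.mem_maximalAtlas hz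
  have hu' : ContDiffOn ℝ ∞ (fun z => u (φ.symm z)) φ.target := by
    rw [← contMDiffOn_iff_contDiffOn]
    exact hu.comp_contMDiffOn (contMDiffOn_symm_of_mem_maximalAtlas hφ.mem_maximalAtlas)
  refine ⟨fun x y => geodesicIter (metricForm g φ) (fun z => u (φ.symm z)) j
    (joinCoord n k x 0, sliceLift g φ x y), ?_, fun x hx c y => ?_, fun v hv => ?_⟩
  · refine (contDiffOn_geodesicIter φ.open_target hG hpos hu' j).comp
      (f := fun z : EuclideanSpace ℝ (Fin n) × EuclideanSpace ℝ (Fin k) =>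
        (joinCoord n k z.1 0, sliceLift g φ z.1 z.2)) ?_ fun z hz => hz
    exact (contDiff_joinCoord_zero.contDiffOn.comp contDiffOn_fst fun _ _ => mem_univ _).prodMk
      ((hφ.contDiffOn_sliceLift.comp contDiffOn_fst fun _ h => h).clm_apply contDiffOn_snd)
  · beta_reduce
    rw [map_smul, geodesicIter_smul φ.open_target hG hpos hu' j c hx]
  · obtain ⟨c, δ, hδ, hc0, hc1, hc, hgeo, hr0, hr⟩ := hφ.exists_ray hv
    have h1 := iteratedDerivWithin_comp_curve φ.open_target hG hpos hu' hc hgeo j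
      (t := 0) ⟨le_rfl, hδ⟩
    rw [hc0, hc1, ← hφ.joinCoord_baseCoord hv] at h1
    rw [tDeriv, iteratedDerivWithin_Ici_eq hδ]
    refine Eq.trans ?_ h1
    refine iteratedDerivWithin_congr (fun t ht => ?_) ⟨le_rfl, hδ⟩
    rw [hf]
    rcases ht.1.eq_or_lt with rfl | ht0
    · rw [hr0, hc0, φ.left_inv hv]
      rfl
    · obtain ⟨-, q, hq, hqs, hqc⟩ := hr t ⟨ht0, ht.2⟩
      rw [hq, ← hqc, φ.left_inv hqs]
      rfl

end NormalRays

/-! ### Taylor's formula in the radial variable -/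

section RadialTaylor

open Set

variable {X Y : Type} [NormedAddCommGroup X] [NormedSpace ℝ X] [FiniteDimensional ℝ X]
  [NormedAddCommGroup Y] [InnerProductSpace ℝ Y] [FiniteDimensional ℝ Y] {O : Set (X × Y)}

theorem contDiffOn_comp_direction {f : (X × Y) × ℝ → ℝ}
    (hf : ContDiffOn ℝ ∞ f (polarNhd O ∩ {w | 0 ≤ w.2})) :
    ContDiffOn ℝ ∞ (fun w : (X × Y) × ℝ => f ((w.1.1, direction w.1.2), w.2))
      (polarNhd O ∩ {w | 0 ≤ w.2}) := by
  refine hf.comp (f := fun w : (X × Y) × ℝ => ((w.1.1, direction w.1.2), w.2)) ?_ fun w hw => ?_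
  · refine ContDiffOn.prodMk (ContDiffOn.prodMk (by fun_prop) ?_) (by fun_prop)
    exact contDiffOn_direction.comp (f := fun w : (X × Y) × ℝ => w.1.2) (by fun_prop)
      fun w hw => hw.1.1
  · refine ⟨⟨direction_ne_zero hw.1.1, hw.1.2.1, ?_⟩, hw.2⟩
    rw [direction_of_norm_eq_one (norm_direction hw.1.1)]
    exact hw.1.2.2

/-- Taylor's formula in the radial variable, up to the boundary `t = 0`. -/
theorem exists_radial_taylor (hO : IsOpen O) {f : (X × Y) × ℝ → ℝ}
    (hf : ContDiffOn ℝ ∞ f (polarNhd O ∩ {w | 0 ≤ w.2})) :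
    ∃ R : ℕ → (X × Y) × ℝ → ℝ, (∀ N, ContDiffOn ℝ ∞ (R N) (polarNhd O ∩ {w | 0 ≤ w.2})) ∧
      ∀ N, ∀ w ∈ polarNhd O ∩ {w | 0 ≤ w.2},
        f w = ∑ i ∈ Finset.range N, w.2 ^ i * R i (w.1, 0) + w.2 ^ N * R N w := by
  have step : ∀ h : {h : (X × Y) × ℝ → ℝ // ContDiffOn ℝ ∞ h (polarNhd O ∩ {w | 0 ≤ w.2})},
      ∃ h' : {h : (X × Y) × ℝ → ℝ // ContDiffOn ℝ ∞ h (polarNhd O ∩ {w | 0 ≤ w.2})},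
      ∀ w ∈ polarNhd O ∩ {w | 0 ≤ w.2}, h.1 w = h.1 (w.1, 0) + w.2 * h'.1 w := fun h => by
    obtain ⟨h', hh', heq⟩ := exists_contDiffOn_eq_add_smul (E := X × Y) (F := ℝ)
      (Ω := polarNhd O) (isOpen_polarNhd hO) (fun w hw _ => polarNhd_zero hw) (f := h.1) h.2
    exact ⟨⟨h', hh'⟩, heq⟩
  choose T hT using step
  refine ⟨fun N => (T^[N] ⟨f, hf⟩).1, fun N => (T^[N] ⟨f, hf⟩).2, fun N w hw => ?_⟩
  induction N with
  | zero => simp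
  | succ N ih =>
    have h1 := hT (T^[N] ⟨f, hf⟩) w hw
    rw [← Function.iterate_succ_apply' T] at h1
    rw [ih, Finset.sum_range_succ]
    beta_reduce
    rw [h1]
    ring

end RadialTaylor

/-! ### Radial expansions of functions on the blow-up -/

section PolarExpansion

open Set

set_option maxSynthPendingDepth 6

variable {n k : ℕ} {M : Type*} [TopologicalSpace M] [ChartedSpace (Model n k) M]
  {φ : OpenPartialHomeomorph M (Model n k)} {S : Set M} [IsManifold (𝓡 (n + k)) ∞ M]
  {g : Metric n k M}

/-- The range of a chart, as a set of pairs `(x, y)`. -/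
def splitTarget (φ : OpenPartialHomeomorph M (Model n k)) :
    Set (EuclideanSpace ℝ (Fin n) × EuclideanSpace ℝ (Fin k)) :=
  {z | joinCoord n k z.1 z.2 ∈ φ.target}

theorem isOpen_splitTarget (φ : OpenPartialHomeomorph M (Model n k)) : IsOpen (splitTarget φ) :=
  φ.open_target.preimage contDiff_joinCoord.continuous

/-- The domain of the Taylor coefficients of a smooth function on the blow-up. -/
def polarBox (φ : OpenPartialHomeomorph M (Model n k)) :
    Set ((EuclideanSpace ℝ (Fin n) × EuclideanSpace ℝ (Fin k)) × ℝ) :=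
  polarNhd (splitTarget φ) ∩ {w | 0 ≤ w.2}

/-- `R` are the coefficients and remainders of the Taylor expansions of `f` in the radial variable
of polar coordinates, extended from the unit sphere to functions constant on rays. -/
structure IsPolarTaylor (f : Blowup g S → ℝ) (φ : OpenPartialHomeomorph M (Model n k))
    (R : ℕ → (EuclideanSpace ℝ (Fin n) × EuclideanSpace ℝ (Fin k)) × ℝ → ℝ) : Prop where
  contDiffOn : ∀ N, ContDiffOn ℝ ∞ (R N) (polarBox φ)
  radial : ∀ N x y t, R N ((x, direction y), t) = R N ((x, y), t)
  eq : ∀ N, ∀ w ∈ polarBox φ, ∀ q : Blowup g S, blowdown q ∈ φ.source →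
    polarChart φ q = (w.1.1, direction w.1.2, w.2) →
    f q = ∑ i ∈ Finset.range N, w.2 ^ i * R i (w.1, 0) + w.2 ^ N * R N w

theorem direction_direction {Y : Type} [NormedAddCommGroup Y] [InnerProductSpace ℝ Y] (y : Y) :
    direction (direction y) = direction y := by
  rcases eq_or_ne y 0 with rfl | hy
  · simp [direction]
  · exact direction_of_norm_eq_one (norm_direction hy)

theorem IsSmooth.exists_isPolarTaylor {f : Blowup g S → ℝ} (hf : IsSmooth f)
    (hφ : IsSliceChart n k S φ) : ∃ R, IsPolarTaylor f φ R := by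
  obtain ⟨F, hF, hfF⟩ := hf.2 φ hφ
  have hF' : ContDiffOn ℝ ∞ (fun w : (EuclideanSpace ℝ (Fin n) × EuclideanSpace ℝ (Fin k)) × ℝ =>
      F (w.1.1, direction w.1.2, w.2)) (polarBox φ) := by
    refine hF.comp (f := fun w : (EuclideanSpace ℝ (Fin n) × EuclideanSpace ℝ (Fin k)) × ℝ =>
      (w.1.1, direction w.1.2, w.2)) ?_ fun w hw => ?_
    · refine ContDiffOn.prodMk (by fun_prop) (ContDiffOn.prodMk ?_ (by fun_prop))
      exact contDiffOn_direction.comp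
        (f := fun w : (EuclideanSpace ℝ (Fin n) × EuclideanSpace ℝ (Fin k)) × ℝ => w.1.2)
        (by fun_prop) fun w hw => hw.1.1
    · refine ⟨direction_ne_zero hw.1.1, hw.2, ?_⟩
      change joinCoord n k w.1.1 (w.2 • direction (direction w.1.2)) ∈ φ.target
      rw [direction_direction]
      exact hw.1.2.2
  obtain ⟨R, hR, heq⟩ := exists_radial_taylor (isOpen_splitTarget φ) hF'
  refine ⟨fun N w => R N ((w.1.1, direction w.1.2), w.2),
    fun N => contDiffOn_comp_direction (hR N), fun N x y t => ?_, fun N w hw q hq hqw => ?_⟩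
  · simp only [direction_direction]
  · have hw' : ((w.1.1, direction w.1.2), w.2) ∈ polarBox φ := by
      refine ⟨⟨direction_ne_zero hw.1.1, hw.1.2.1, ?_⟩, hw.2⟩
      rw [direction_direction]
      exact hw.1.2.2
    have := heq N _ hw'
    simp only [direction_direction] at this
    rw [hfF q hq, hqw, this]

variable {f : Blowup g S → ℝ}
  {R : ℕ → (EuclideanSpace ℝ (Fin n) × EuclideanSpace ℝ (Fin k)) × ℝ → ℝ}

theorem IsPolarTaylor.eq_inl (hR : IsPolarTaylor f φ R) (q : {q : M // q ∉ S})
    (hφ : IsSliceChart n k S φ) (hq : q.1 ∈ φ.source)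
    (hx : tangentialCoord n k (φ q.1) ∈ sliceBase φ) (N : ℕ) :
    f (Sum.inl q) = ∑ i ∈ Finset.range N, ‖normalCoord n k (φ q.1)‖ ^ i
        * R i ((tangentialCoord n k (φ q.1), normalCoord n k (φ q.1)), 0)
      + ‖normalCoord n k (φ q.1)‖ ^ N
        * R N (polar (tangentialCoord n k (φ q.1), normalCoord n k (φ q.1))) := by
  have hy : normalCoord n k (φ q.1) ≠ 0 := fun h => q.2 ((hφ.mem_iff _ hq).2 h)
  have hw : ((tangentialCoord n k (φ q.1), normalCoord n k (φ q.1)),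
      ‖normalCoord n k (φ q.1)‖) ∈ polarBox φ := by
    refine ⟨⟨hy, hx, ?_⟩, norm_nonneg _⟩
    rw [norm_smul_direction, splitTarget, mem_ofPred_eq, joinCoord_coord]
    exact φ.map_source hq
  rw [hR.eq N _ hw (Sum.inl q) hq rfl, polar, hR.radial]

theorem IsPolarTaylor.mem_zero {x : EuclideanSpace ℝ (Fin n)} (hx : x ∈ sliceBase φ)
    {y : EuclideanSpace ℝ (Fin k)} (hy : y ≠ 0) :
    ((x, y), (0 : ℝ)) ∈ polarBox φ :=
  ⟨⟨hy, hx, by rw [zero_smul]; exact hx⟩, le_refl (0 : ℝ)⟩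

theorem IsPolarTaylor.eq_inr (hR : IsPolarTaylor f φ R) (v : NormalSphere g S)
    (hφ : IsSliceChart n k S φ) (hv : v.1.proj ∈ φ.source) :
    f (Sum.inr v) = R 0 ((baseCoord φ v, fibreCoord φ v), 0) := by
  have := hR.eq 0 _ (IsPolarTaylor.mem_zero (hφ.baseCoord_mem hv) (hφ.fibreCoord_ne_zero hv))
    (Sum.inr v) hv rfl
  simpa using this

/-- `P i x` are homogeneous polynomials that coincide with the Taylor coefficients of `f`. -/
def IsTaylorPoly (φ : OpenPartialHomeomorph M (Model n k))
    (R : ℕ → (EuclideanSpace ℝ (Fin n) × EuclideanSpace ℝ (Fin k)) × ℝ → ℝ) (i : ℕ)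
    (P : EuclideanSpace ℝ (Fin n) → EuclideanSpace ℝ (Fin k) → ℝ) : Prop :=
  ContDiffOn ℝ ∞ (fun z : EuclideanSpace ℝ (Fin n) × EuclideanSpace ℝ (Fin k) => P z.1 z.2)
    {z | z.1 ∈ sliceBase φ} ∧
  ∀ x ∈ sliceBase φ, IsHomPoly i (P x) ∧ ∀ y ≠ 0, P x y = ‖y‖ ^ i * R i ((x, y), 0)

/-- The points of the range of a chart whose projection to `{y = 0}` is in the range. -/
def tubeTarget (φ : OpenPartialHomeomorph M (Model n k)) : Set (Model n k) :=
  {z | z ∈ φ.target ∧ tangentialCoord n k z ∈ sliceBase φ}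

theorem isOpen_tubeTarget (φ : OpenPartialHomeomorph M (Model n k)) : IsOpen (tubeTarget φ) :=
  φ.open_target.inter ((isOpen_sliceBase φ).preimage (tangentialCoord n k).continuous)

theorem joinCoord_mem_tubeTarget {x : EuclideanSpace ℝ (Fin n)} (hx : x ∈ sliceBase φ) :
    joinCoord n k x 0 ∈ tubeTarget φ :=
  ⟨hx, by rw [tangentialCoord_joinCoord]; exact hx⟩

/-- A Taylor polynomial of `f` in the normal variables. -/
def taylorSum (P : ℕ → EuclideanSpace ℝ (Fin n) → EuclideanSpace ℝ (Fin k) → ℝ) (j : ℕ)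
    (z : Model n k) : ℝ :=
  ∑ i ∈ Finset.range j, P i (tangentialCoord n k z) (normalCoord n k z)

theorem contDiffOn_taylorSum {P : ℕ → EuclideanSpace ℝ (Fin n) → EuclideanSpace ℝ (Fin k) → ℝ}
    {j : ℕ} (hP : ∀ i < j, IsTaylorPoly φ R i (P i)) :
    ContDiffOn ℝ ∞ (taylorSum P j) (tubeTarget φ) := by
  refine ContDiffOn.sum fun i hi => ?_
  exact (hP i (Finset.mem_range.1 hi)).1.comp
    (f := fun z : Model n k => (tangentialCoord n k z, normalCoord n k z))
    ((tangentialCoord n k).contDiff.prodMk (normalCoord n k).contDiff).contDiffOn fun z hz => hz.2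

/-- The `j`-th normal derivative of `f` is that of the Taylor polynomial of degree `< j`, plus
`j!` times the Taylor coefficient of degree `j`. -/
theorem IsPolarTaylor.tDeriv_eq (hR : IsPolarTaylor f φ R) (hφ : IsSliceChart n k S φ)
    {v : NormalSphere g S} (hv : v.1.proj ∈ φ.source) {j : ℕ}
    {P : ℕ → EuclideanSpace ℝ (Fin n) → EuclideanSpace ℝ (Fin k) → ℝ}
    (hP : ∀ i < j, IsTaylorPoly φ R i (P i)) :
    tDeriv f j v = geodesicIter (metricForm g φ) (taylorSum P j) j
        (joinCoord n k (baseCoord φ v) 0, sliceLift g φ (baseCoord φ v) (fibreCoord φ v))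
      + j.factorial * (‖fibreCoord φ v‖ ^ j * R j ((baseCoord φ v, fibreCoord φ v), 0)) := by
  obtain ⟨c, δ, hδ, hc0, hc1, hc, hgeo, hr0, hr⟩ := hφ.exists_ray hv
  have hx := hφ.baseCoord_mem hv
  have hy := hφ.fibreCoord_ne_zero hv
  have hc0' : c 0 = joinCoord n k (baseCoord φ v) 0 := by rw [hc0, hφ.joinCoord_baseCoord hv]
  have hm : (0 : ℝ) ∈ Ioo (-δ) δ := by simp [hδ]
  obtain ⟨w, hw, hw0, hwb⟩ := exists_contDiffOn_eq_smul hδ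
    ((normalCoord n k).contDiff.comp_contDiffOn hc) (by simp [hc0'])
  have hw0' : w 0 = fibreCoord φ v := by
    have h1 := ((hc.differentiableOn (by simp)).differentiableAt
      (isOpen_Ioo.mem_nhds hm)).hasDerivAt
    have h2 := ((normalCoord n k).hasFDerivAt.comp_hasDerivAt 0 h1).deriv
    rw [hw0]
    refine h2.trans ?_
    rw [hc1, hφ.normalCoord_sliceLift hx]
  have hev1 : ∀ᶠ t in 𝓝 (0 : ℝ), c t ∈ tubeTarget φ :=
    (hc.continuousOn.continuousAt (isOpen_Ioo.mem_nhds hm))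
      ((isOpen_tubeTarget φ).mem_nhds (by rw [hc0']; exact joinCoord_mem_tubeTarget hx))
  have hev2 : ∀ᶠ t in 𝓝 (0 : ℝ), t ∈ Ico 0 δ → w t ≠ 0 := by
    have h1 : ContinuousWithinAt w (Ico 0 δ) 0 := hw.continuousOn 0 ⟨le_rfl, hδ⟩
    exact eventually_nhdsWithin_iff.1 (h1.eventually_ne (by rw [hw0']; exact hy))
  obtain ⟨r, hr', hrs⟩ := Metric.eventually_nhds_iff.1 (hev1.and hev2)
  set ε := min δ r with hε
  have hε0 : 0 < ε := lt_min hδ hr'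
  have hmono : Ioo (-ε) ε ⊆ Ioo (-δ) δ :=
    Ioo_subset_Ioo (neg_le_neg (min_le_left _ _)) (min_le_left _ _)
  have hmono' : Ico 0 ε ⊆ Ico 0 δ := Ico_subset_Ico_right (min_le_left _ _)
  have hIco : Ico 0 ε ⊆ Ioo (-ε) ε := fun t ht => ⟨by linarith [ht.1], ht.2⟩
  have htube : ∀ t ∈ Ioo (-ε) ε, c t ∈ tubeTarget φ := fun t ht =>
    (hrs (by simpa using (abs_lt.2 ht).trans_le (min_le_right _ _))).1
  have hwne : ∀ t ∈ Ico 0 ε, w t ≠ 0 := fun t ht =>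
    (hrs (by simpa using (abs_lt.2 (hIco ht)).trans_le (min_le_right _ _))).2 (hmono' ht)
  -- the normal components along the ray are `t • w t`, so that `W t` are its polar coordinates,
  -- with `w t` in place of its direction to make the curve smooth up to `t = 0`
  let W : ℝ → (EuclideanSpace ℝ (Fin n) × EuclideanSpace ℝ (Fin k)) × ℝ := fun t =>
    ((tangentialCoord n k (c t), w t), t * ‖w t‖)
  have hW : ∀ t ∈ Ico 0 ε, W t ∈ polarBox φ := by
    intro t ht
    refine ⟨⟨hwne t ht, (htube t (hIco ht)).2, ?_⟩, mul_nonneg ht.1 (norm_nonneg _)⟩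
    change joinCoord n k (tangentialCoord n k (c t)) ((t * ‖w t‖) • direction (w t)) ∈ φ.target
    rw [mul_smul, norm_smul_direction, ← hwb t (hmono' ht)]
    simp only [Function.comp_apply, joinCoord_coord]
    exact (htube t (hIco ht)).1
  let h : ℝ → ℝ := fun t => ‖w t‖ ^ j * R j (W t)
  have hcε : ContDiffOn ℝ ∞ c (Ico 0 ε) := hc.mono (hIco.trans hmono)
  have hwn : ContDiffOn ℝ ∞ (fun t => ‖w t‖) (Ico 0 ε) :=
    contDiffOn_norm_ne.comp (hw.mono hmono') hwne
  have hh : ContDiffOn ℝ ∞ h (Ico 0 ε) := by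
    refine (hwn.pow j).mul ((hR.contDiffOn j).comp ?_ hW)
    exact (((tangentialCoord n k).contDiff.comp_contDiffOn hcε).prodMk (hw.mono hmono')).prodMk
      (contDiffOn_id.mul hwn)
  have hsum := contDiffOn_taylorSum hP
  have hGo := (contDiffOn_metricForm g hφ.mem_maximalAtlas).mono
    (fun z (hz : z ∈ tubeTarget φ) => hz.1)
  have hpos := fun z (hz : z ∈ tubeTarget φ) => metricForm_pos g hφ.mem_maximalAtlas hz.1
  have heq : ∀ t ∈ Ico 0 ε, f (normalRay v t) = taylorSum P j (c t) + t ^ j • h t := by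
    intro t ht
    have hxt : tangentialCoord n k (c t) ∈ sliceBase φ := (htube t (hIco ht)).2
    have h1 : blowdown (normalRay v t) ∈ φ.source ∧
        polarChart φ (normalRay v t) = ((W t).1.1, direction (W t).1.2, (W t).2) := by
      rcases ht.1.eq_or_lt with rfl | ht0
      · rw [hr0]
        refine ⟨hv, ?_⟩
        simp only [W, hc0, hw0', zero_mul]
        rfl
      · obtain ⟨-, q, hq, hqs, hqc⟩ := hr t ⟨ht0, (hmono' ht).2⟩
        rw [hq]
        refine ⟨hqs, ?_⟩
        have h2 : normalCoord n k (c t) = t • w t := hwb t (hmono' ht)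
        change (tangentialCoord n k (φ q.1), direction (normalCoord n k (φ q.1)),
          ‖normalCoord n k (φ q.1)‖) = _
        rw [hqc, h2, direction_smul ht0, norm_smul, Real.norm_of_nonneg ht.1]
    rw [hR.eq j _ (hW t ht) _ h1.1 h1.2, taylorSum]
    congr 1
    · refine Finset.sum_congr rfl fun i hi => ?_
      obtain ⟨hp1, hp2⟩ := (hP i (Finset.mem_range.1 hi)).2 _ hxt
      have h2 : normalCoord n k (c t) = t • w t := hwb t (hmono' ht)
      rw [h2, hp1.map_smul, hp2 _ (hwne t ht), smul_eq_mul, ← mul_assoc, ← mul_pow]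
    · simp only [h, W, mul_pow, smul_eq_mul]
      ring
  have hcurve := iteratedDerivWithin_comp_curve (isOpen_tubeTarget φ) hGo hpos hsum
    (hc.mono hmono) (fun t ht => ⟨htube t ht, (hgeo t (hmono ht)).2⟩) j (t := 0) ⟨le_rfl, hε0⟩
  have h0 : (0 : ℝ) ∈ Ico 0 ε := ⟨le_rfl, hε0⟩
  rw [tDeriv, iteratedDerivWithin_Ici_eq hε0, iteratedDerivWithin_congr heq h0]
  have hadd := iteratedDerivWithin_add h0 (uniqueDiffOn_Ico 0 ε)
    (f := fun t => taylorSum P j (c t)) (g := fun t => t ^ j • h t) (n := j)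
    (((hsum.comp hcε fun t ht => htube t (hIco ht)) 0 h0).of_le (by exact_mod_cast le_top))
    ((((contDiffOn_id.pow j).smul hh) 0 h0).of_le (by exact_mod_cast le_top))
  refine hadd.trans ?_
  rw [hcurve, iteratedDerivWithin_pow_smul hε0 j hh, hc0', hc1]
  simp only [h, W, hw0', hc0', tangentialCoord_joinCoord, zero_mul, smul_eq_mul]

end PolarExpansion

/-! ### Descent of functions from the blow-up -/

section Descent

open Set

set_option maxSynthPendingDepth 6

variable {n k : ℕ} {M : Type*} [TopologicalSpace M] [ChartedSpace (Model n k) M]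
  {φ : OpenPartialHomeomorph M (Model n k)} {S : Set M} [IsManifold (𝓡 (n + k)) ∞ M]
  {g : Metric n k M}

theorem IsHomPoly.norm_sq_pow_mul {m : ℕ} {p : EuclideanSpace ℝ (Fin k) → ℝ}
    (hp : IsHomPoly m p) (i : ℕ) : IsHomPoly (2 * i + m) fun y => (‖y‖ ^ 2) ^ i * p y := by
  refine ⟨((contDiff_norm_sq ℝ).pow i).mul hp.contDiff, fun c y => ?_⟩
  rw [hp.map_smul, norm_smul, mul_pow, Real.norm_eq_abs, sq_abs, smul_eq_mul, smul_eq_mul,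
    pow_add, pow_mul]
  ring

/-- The elements of `𝓨_j` are restrictions of homogeneous polynomials of degree `j`: a spherical
harmonic of degree `m` is one of degree `m`, and is to be multiplied by `|y|^{j - m}`, which is a
polynomial because `j - m` is even. -/
theorem exists_isHomPoly_of_mem_parityHarmonics [Nontrivial (EuclideanSpace ℝ (Fin k))]
    (hS : IsEmbeddedSubmanifold n k S) {j : ℕ} {h : NormalSphere g S → ℝ}
    (hh : h ∈ parityHarmonics g S j) (A : NormalFrame g S) :
    ∃ p : EuclideanSpace ℝ (Fin k) → ℝ, IsHomPoly j p ∧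
      ∀ ξ : Metric.sphere (0 : EuclideanSpace ℝ (Fin k)) 1, p ξ = h (A.point ξ) := by
  obtain ⟨H, hH, hsum⟩ := hh
  have hex : ∀ m, ∃ p : EuclideanSpace ℝ (Fin k) → ℝ, IsHomPoly m p ∧
      ∀ ξ : Metric.sphere (0 : EuclideanSpace ℝ (Fin k)) 1, p ξ = H m (A.point ξ) := fun m => by
    refine exists_isHomPoly_of_sphericalLaplacian one_le_of_nontrivial m
      ((hH m).1.contDiffOn_radialExtension hS A) ((hH m).2.1 A) fun hk ξ => ?_
    rw [← (hH m).2.2 hk]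
    congr 1
    exact Subtype.ext (congrArg (fun w : TangentSpace (𝓡 (n + k)) A.base =>
      (⟨A.base, w⟩ : TangentBundle (𝓡 (n + k)) M)) (A.toLin.map_neg (ξ : EuclideanSpace ℝ (Fin k))))
  choose p hp hpH using hex
  refine ⟨fun y => ∑ m ∈ (Finset.range (j + 1)).filter (fun m => m % 2 = j % 2),
    (‖y‖ ^ 2) ^ ((j - m) / 2) * p m y, ?_, fun ξ => ?_⟩
  · have hm : ∀ m ∈ (Finset.range (j + 1)).filter (fun m => m % 2 = j % 2),
        IsHomPoly j fun y => (‖y‖ ^ 2) ^ ((j - m) / 2) * p m y := by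
      intro m hm
      rw [Finset.mem_filter, Finset.mem_range] at hm
      have := (hp m).norm_sq_pow_mul ((j - m) / 2)
      rwa [show 2 * ((j - m) / 2) + m = j by omega] at this
    refine ⟨ContDiff.sum fun m h => (hm m h).contDiff, fun c y => ?_⟩
    rw [Finset.smul_sum]
    exact Finset.sum_congr rfl fun m h => (hm m h).map_smul c y
  · rw [hsum]
    refine Finset.sum_congr rfl fun m _ => ?_
    rw [norm_eq_of_mem_sphere, one_pow, one_pow, one_mul, hpH]

variable {f : Blowup g S → ℝ}
  {R : ℕ → (EuclideanSpace ℝ (Fin n) × EuclideanSpace ℝ (Fin k)) × ℝ → ℝ}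

/-- The inductive step in the construction of the Taylor polynomials, at a single base point: the
formula for the `j`-th normal derivative expresses the coefficient of degree `j` by an element of
`𝓨_j` and a derivative of the Taylor polynomial of lower degree, both of which are homogeneous
polynomials of degree `j`. -/
theorem IsPolarTaylor.exists_isHomPoly [Nontrivial (EuclideanSpace ℝ (Fin k))]
    (hS : IsEmbeddedSubmanifold n k S) (hR : IsPolarTaylor f φ R) (hφ : IsSliceChart n k S φ)
    {j : ℕ} (hj : tDeriv f j ∈ parityHarmonics g S j)
    {P : ℕ → EuclideanSpace ℝ (Fin n) → EuclideanSpace ℝ (Fin k) → ℝ}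
    (hP : ∀ i < j, IsTaylorPoly φ R i (P i)) {x : EuclideanSpace ℝ (Fin n)}
    (hx : x ∈ sliceBase φ) : ∃ p : EuclideanSpace ℝ (Fin k) → ℝ, IsHomPoly j p ∧
      ∀ y ≠ 0, p y = ‖y‖ ^ j * R j ((x, y), 0) := by
  have hp : φ.symm (joinCoord n k x 0) ∈ φ.source := φ.map_target hx
  have hpS := hφ.symm_mem hx
  have hxp : tangentialCoord n k (φ (φ.symm (joinCoord n k x 0))) = x := by
    rw [φ.right_inv hx, tangentialCoord_joinCoord]
  obtain ⟨A, hA⟩ := hφ.exists_normalFrame (g := g) hp hpS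
  have hAs : A.base ∈ φ.source := hA ▸ hp
  have hAx : tangentialCoord n k (φ A.base) = x := by rw [hA, hxp]
  obtain ⟨T, hT⟩ := A.exists_inverse_coord hφ hAs
  obtain ⟨p, hpj, hpξ⟩ := exists_isHomPoly_of_mem_parityHarmonics hS hj A
  have hsum := contDiffOn_taylorSum hP
  have hGo := (contDiffOn_metricForm g hφ.mem_maximalAtlas).mono
    (fun z (hz : z ∈ tubeTarget φ) => hz.1)
  have hpos := fun z (hz : z ∈ tubeTarget φ) => metricForm_pos g hφ.mem_maximalAtlas hz.1
  have hxt := joinCoord_mem_tubeTarget hx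
  let I : EuclideanSpace ℝ (Fin k) → ℝ := fun y =>
    geodesicIter (metricForm g φ) (taylorSum P j) j (joinCoord n k x 0, sliceLift g φ x y)
  have hI : IsHomPoly j I := by
    refine ⟨?_, fun c y => ?_⟩
    · rw [← contDiffOn_univ]
      exact (contDiffOn_geodesicIter (isOpen_tubeTarget φ) hGo hpos hsum j).comp
        (f := fun y => (joinCoord n k x 0, sliceLift g φ x y))
        (contDiff_const.prodMk (sliceLift g φ x).contDiff).contDiffOn fun _ _ => hxt
    · simp only [I]
      rw [map_smul, geodesicIter_smul (isOpen_tubeTarget φ) hGo hpos hsum j c hxt, smul_eq_mul]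
  -- the coefficient of degree `j`, from the formula for the `j`-th normal derivative
  let Q : EuclideanSpace ℝ (Fin k) → ℝ := fun y =>
    (j.factorial : ℝ)⁻¹ • (p y + (-1 : ℝ) • I (A.coord φ y))
  have hQ : IsHomPoly j Q :=
    (hpj.add ((hI.comp_continuousLinearMap (A.coord φ)).const_smul (-1))).const_smul _
  have hQξ : ∀ ξ : Metric.sphere (0 : EuclideanSpace ℝ (Fin k)) 1,
      Q ξ = ‖A.coord φ ξ‖ ^ j * R j ((x, A.coord φ ξ), 0) := by
    intro ξ
    have h1 := hR.tDeriv_eq hφ (v := A.point ξ) hAs hP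
    rw [A.baseCoord_point, hAx, A.fibreCoord_point] at h1
    simp only [Q, I]
    rw [hpξ, h1, smul_eq_mul, smul_eq_mul, inv_mul_eq_iff_eq_mul₀ (by positivity)]
    ring
  refine ⟨fun y => Q (T y), hQ.comp_continuousLinearMap T, fun y hy => ?_⟩
  have hTy : T y ≠ 0 := fun h => hy (by rw [← hT y, h, map_zero])
  have h1 := hQ.map_smul ‖T y‖ (direction (T y))
  have h2 := hQξ ⟨direction (T y), by simpa using norm_direction hTy⟩
  have h3 : A.coord φ (direction (T y)) = ‖T y‖⁻¹ • y := by rw [direction, map_smul, hT]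
  simp only at h2
  have h4 : direction (‖T y‖⁻¹ • y) = direction y :=
    direction_smul (inv_pos.2 (norm_pos_iff.2 hTy)) y
  rw [norm_smul_direction, h2, h3, ← hR.radial, h4, hR.radial, norm_smul, norm_inv, norm_norm,
    smul_eq_mul, mul_pow, ← mul_assoc, ← mul_assoc, ← mul_pow,
    mul_inv_cancel₀ (norm_ne_zero_iff.2 hTy), one_pow, one_mul] at h1
  exact h1

theorem contDiffOn_taylorCoeff (hR : IsPolarTaylor f φ R) (j : ℕ) :
    ContDiffOn ℝ ∞ (fun z : EuclideanSpace ℝ (Fin n) × EuclideanSpace ℝ (Fin k) =>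
      ‖z.2‖ ^ j * R j ((z.1, z.2), 0)) {z | z.1 ∈ sliceBase φ ∧ z.2 ≠ 0} := by
  refine ContDiffOn.mul (ContDiffOn.pow ?_ j) ?_
  · exact contDiffOn_norm_ne.comp
      (f := fun z : EuclideanSpace ℝ (Fin n) × EuclideanSpace ℝ (Fin k) => z.2) (by fun_prop)
      fun z hz => hz.2
  · exact (hR.contDiffOn j).comp
      (f := fun z : EuclideanSpace ℝ (Fin n) × EuclideanSpace ℝ (Fin k) => ((z.1, z.2), (0 : ℝ)))
      (by fun_prop) fun z hz => IsPolarTaylor.mem_zero hz.1 hz.2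

/-- If the normal derivatives of `f` are in the spaces `𝓨_j`, its Taylor coefficients in the radial
variable are polynomials in the normal coordinates. -/
theorem IsPolarTaylor.exists_isTaylorPoly [Nontrivial (EuclideanSpace ℝ (Fin k))]
    (hS : IsEmbeddedSubmanifold n k S) (hR : IsPolarTaylor f φ R) (hφ : IsSliceChart n k S φ)
    (hY : ∀ j, tDeriv f j ∈ parityHarmonics g S j) (j : ℕ) : ∃ P, IsTaylorPoly φ R j P := by
  classical
  induction j using Nat.strong_induction_on with
  | _ j ih =>
    choose! P hP using ih
    have hex : ∀ x, ∃ p : EuclideanSpace ℝ (Fin k) → ℝ, x ∈ sliceBase φ → IsHomPoly j p ∧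
        ∀ y ≠ 0, p y = ‖y‖ ^ j * R j ((x, y), 0) := fun x => by
      by_cases hx : x ∈ sliceBase φ
      · obtain ⟨p, hp⟩ := hR.exists_isHomPoly hS hφ (hY j) hP hx
        exact ⟨p, fun _ => hp⟩
      · exact ⟨0, fun h => absurd h hx⟩
    choose Q hQ using hex
    refine ⟨Q, ?_, hQ⟩
    refine contDiffOn_uncurry_of_isHomPoly (isOpen_sliceBase φ) j Q (fun x hx => (hQ x hx).1) ?_
    exact (contDiffOn_taylorCoeff hR j).congr fun z hz => (hQ z.1 hz.1).2 z.2 hz.2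

theorem IsSliceChart.exists_normalSphere_proj [Nontrivial (EuclideanSpace ℝ (Fin k))]
    (hφ : IsSliceChart n k S φ) {p : M} (hp : p ∈ φ.source) (hpS : p ∈ S) :
    ∃ v : NormalSphere g S, v.1.proj = p := by
  obtain ⟨y, hy⟩ := exists_ne (0 : EuclideanSpace ℝ (Fin k))
  have hq := hφ.sliceNormSq_pos (g := g) (hφ.mem_sliceBase hp hpS) hy
  obtain ⟨v, hv, -⟩ := hφ.exists_normalSphere (g := g) hp hpS
    (y := (√(sliceNormSq g φ (tangentialCoord n k (φ p)) y))⁻¹ • y) (by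
      rw [sliceNormSq_smul, inv_pow, Real.sq_sqrt hq.le, inv_mul_cancel₀ hq.ne'])
  exact ⟨v, hv⟩

open Classical in
/-- The function on `M` induced by a function on the blow-up that is constant on the fibres over the
submanifold; its value at a point of the submanifold is read at some unit normal vector there. -/
def descend (f : Blowup g S → ℝ) (q : M) : ℝ :=
  if h : ∃ v : NormalSphere g S, v.1.proj = q then f (Sum.inr h.choose) else interiorPart f q

theorem descend_of_notMem {q : M} (hq : q ∉ S) : descend f q = interiorPart f q :=
  dif_neg fun ⟨v, hv⟩ => hq (hv ▸ v.2.1)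

theorem interiorPart_of_notMem {q : M} (hq : q ∉ S) : interiorPart f q = f (Sum.inl ⟨q, hq⟩) :=
  dif_pos hq

theorem descend_proj {a : M → ℝ} {v : NormalSphere g S}
    (h : ∀ w : NormalSphere g S, w.1.proj = v.1.proj → f (Sum.inr w) = a v.1.proj) :
    descend f v.1.proj = a v.1.proj := by
  have hex : ∃ w : NormalSphere g S, w.1.proj = v.1.proj := ⟨v, rfl⟩
  exact (dif_pos hex).trans (h _ hex.choose_spec)

theorem IsPolarTaylor.eq_taylorPoly_zero (hR : IsPolarTaylor f φ R) (hφ : IsSliceChart n k S φ)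
    {P : EuclideanSpace ℝ (Fin n) → EuclideanSpace ℝ (Fin k) → ℝ} (hP : IsTaylorPoly φ R 0 P)
    {w : NormalSphere g S} (hw : w.1.proj ∈ φ.source) :
    f (Sum.inr w) = P (tangentialCoord n k (φ w.1.proj)) 0 := by
  obtain ⟨h1, h2⟩ := hP.2 _ (hφ.baseCoord_mem hw)
  refine (hR.eq_inr w hφ hw).trans (Eq.trans ?_ (h1.eq_const (fibreCoord φ w)))
  rw [h2 _ (hφ.fibreCoord_ne_zero hw), pow_zero, one_mul]

theorem IsPolarTaylor.descend_proj (hR : IsPolarTaylor f φ R) (hφ : IsSliceChart n k S φ)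
    {P : EuclideanSpace ℝ (Fin n) → EuclideanSpace ℝ (Fin k) → ℝ} (hP : IsTaylorPoly φ R 0 P)
    {v : NormalSphere g S} (hv : v.1.proj ∈ φ.source) :
    descend f v.1.proj = P (tangentialCoord n k (φ v.1.proj)) 0 :=
  SphericalBlowup.descend_proj (a := fun q => P (tangentialCoord n k (φ q)) 0) fun w hw => by
    rw [hR.eq_taylorPoly_zero hφ hP (hw ▸ hv), hw]

/-- In a slice chart, the Taylor expansion of the induced function. -/
theorem IsPolarTaylor.descend_eq [Nontrivial (EuclideanSpace ℝ (Fin k))]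
    (hR : IsPolarTaylor f φ R) (hφ : IsSliceChart n k S φ)
    {P : ℕ → EuclideanSpace ℝ (Fin n) → EuclideanSpace ℝ (Fin k) → ℝ}
    (hP : ∀ i, IsTaylorPoly φ R i (P i)) (N : ℕ) {z : Model n k} (hz : z ∈ tubeTarget φ) :
    descend f (φ.symm z) = taylorSum P (N + 1) z + ‖normalCoord n k z‖ ^ (N + 1)
      • R (N + 1) (polar (tangentialCoord n k z, normalCoord n k z)) := by
  have hs := φ.map_target hz.1
  by_cases hy : normalCoord n k z = 0
  · have hzS : φ.symm z ∈ S := by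
      rw [hφ.mem_iff _ hs, φ.right_inv hz.1, hy]
    obtain ⟨v, hv⟩ := hφ.exists_normalSphere_proj (g := g) hs hzS
    have h1 := hR.descend_proj hφ (hP 0) (v := v) (hv ▸ hs)
    rw [hv, φ.right_inv hz.1] at h1
    rw [h1, taylorSum, hy, norm_zero, zero_pow (Nat.succ_ne_zero N), zero_smul, add_zero,
      Finset.sum_range_succ', Finset.sum_eq_zero fun i _ => ?_, zero_add]
    have := ((hP (i + 1)).2 _ hz.2).1.map_smul 0 0
    rwa [zero_smul, zero_pow (Nat.succ_ne_zero i), zero_smul] at this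
  · have hzS : φ.symm z ∉ S := by
      rw [hφ.mem_iff _ hs, φ.right_inv hz.1]
      exact hy
    have h1 := hR.eq_inl ⟨φ.symm z, hzS⟩ hφ hs
      (by simp only [φ.right_inv hz.1]; exact hz.2) (N + 1)
    simp only [φ.right_inv hz.1] at h1
    rw [descend_of_notMem hzS, interiorPart_of_notMem hzS, h1, taylorSum, smul_eq_mul]
    congr 1
    exact Finset.sum_congr rfl fun i _ => (((hP i).2 _ hz.2).2 _ hy).symm

/-- The induced function is smooth: it is the sum of a Taylor polynomial of arbitrary degree `m` and
a remainder of class `C ^ m`. -/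
theorem IsPolarTaylor.contDiffOn_descend [Nontrivial (EuclideanSpace ℝ (Fin k))]
    (hR : IsPolarTaylor f φ R) (hφ : IsSliceChart n k S φ)
    {P : ℕ → EuclideanSpace ℝ (Fin n) → EuclideanSpace ℝ (Fin k) → ℝ}
    (hP : ∀ i, IsTaylorPoly φ R i (P i)) :
    ContDiffOn ℝ ∞ (fun z => descend f (φ.symm z)) (tubeTarget φ) := by
  rw [contDiffOn_infty]
  intro m
  refine ContDiffOn.congr (f := fun z => taylorSum P (m + 1) z + ‖normalCoord n k z‖ ^ (m + 1)
      • R (m + 1) (polar (tangentialCoord n k z, normalCoord n k z))) ?_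
    fun z hz => hR.descend_eq hφ hP m hz
  refine ContDiffOn.add ((contDiffOn_taylorSum fun i _ => hP i).of_le (by exact_mod_cast le_top)) ?_
  refine (contDiffOn_norm_pow_smul_comp_polar (isOpen_splitTarget φ) m (R (m + 1))
    (hR.contDiffOn (m + 1))).comp
    (f := fun z : Model n k => (tangentialCoord n k z, normalCoord n k z))
    ((tangentialCoord n k).contDiff.prodMk (normalCoord n k).contDiff).contDiffOn fun z hz => ?_
  refine ⟨?_, hz.2⟩
  rw [splitTarget, mem_ofPred_eq, joinCoord_coord]
  exact hz.1

/-- A smooth function on the blow-up whose normal derivatives are in the spaces `𝓨_j` descends. -/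
theorem exists_contMDiff_of_tDeriv_mem [Nontrivial (EuclideanSpace ℝ (Fin k))]
    (hScl : IsClosed S) (hS : IsEmbeddedSubmanifold n k S) (hf : IsSmooth f)
    (hY : ∀ j, tDeriv f j ∈ parityHarmonics g S j) :
    ContMDiff (𝓡 (n + k)) 𝓘(ℝ, ℝ) ∞ (descend f) ∧ ∀ q, f q = descend f (blowdown q) := by
  constructor
  · intro p
    by_cases hp : p ∈ S
    · obtain ⟨φ, hφ, hps⟩ := hS p hp
      obtain ⟨R, hR⟩ := hf.exists_isPolarTaylor hφ
      choose P hP using hR.exists_isTaylorPoly hS hφ hY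
      have hpt : φ p ∈ tubeTarget φ := ⟨φ.map_source hps, hφ.mem_sliceBase hps hp⟩
      have h1 : ContMDiffAt (𝓡 (n + k)) 𝓘(ℝ, ℝ) ∞ (fun z => descend f (φ.symm z)) (φ p) :=
        ((hR.contDiffOn_descend hφ hP).contDiffAt
          ((isOpen_tubeTarget φ).mem_nhds hpt)).contMDiffAt
      have h2 := h1.comp p ((contMDiffOn_of_mem_maximalAtlas hφ.mem_maximalAtlas).contMDiffAt
        (φ.open_source.mem_nhds hps))
      refine h2.congr_of_eventuallyEq ?_
      filter_upwards [φ.open_source.mem_nhds hps] with q hq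
      rw [Function.comp_apply, φ.left_inv hq]
    · have hn := hScl.isOpen_compl.mem_nhds (show p ∈ Sᶜ from hp)
      refine (hf.1.contMDiffAt hn).congr_of_eventuallyEq ?_
      filter_upwards [hn] with q hq using descend_of_notMem hq
  · rintro (⟨q, hq⟩ | v)
    · exact ((descend_of_notMem hq).trans (interiorPart_of_notMem hq)).symm
    · obtain ⟨φ, hφ, hv⟩ := hS v.1.proj v.2.1
      obtain ⟨R, hR⟩ := hf.exists_isPolarTaylor hφ
      obtain ⟨P, hP⟩ := hR.exists_isTaylorPoly hS hφ hY 0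
      exact (hR.eq_taylorPoly_zero hφ hP hv).trans (hR.descend_proj hφ hP hv).symm

end Descent

/-! ### Codimension zero -/

section CodimensionZero

open Set

variable {n : ℕ} {M : Type*} [TopologicalSpace M] [ChartedSpace (Model n 0) M]
  {S : Set M} [IsManifold (𝓡 (n + 0)) ∞ M] {g : Metric n 0 M}

theorem isEmpty_normalSphere (hS : IsEmbeddedSubmanifold n 0 S) : IsEmpty (NormalSphere g S) := by
  refine ⟨fun v => ?_⟩
  obtain ⟨φ, hφ, hv⟩ := hS v.1.proj v.2.1
  exact hφ.fibreCoord_ne_zero hv (Subsingleton.elim _ _)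

/-- In codimension zero the submanifold is open and closed, and the extension by zero is smooth. -/
theorem contMDiff_interiorPart (hScl : IsClosed S) (hS : IsEmbeddedSubmanifold n 0 S)
    {f : Blowup g S → ℝ} (hf : IsSmooth f) :
    ContMDiff (𝓡 (n + 0)) 𝓘(ℝ, ℝ) ∞ (interiorPart f) := by
  intro p
  by_cases hp : p ∈ S
  · obtain ⟨φ, hφ, hps⟩ := hS p hp
    refine (contMDiffAt_const (c := (0 : ℝ))).congr_of_eventuallyEq ?_
    filter_upwards [φ.open_source.mem_nhds hps] with q hq
    exact dif_neg (not_not.2 ((hφ.mem_iff q hq).2 (Subsingleton.elim _ _)))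
  · exact hf.1.contMDiffAt (hScl.isOpen_compl.mem_nhds hp)

theorem mem_parityHarmonics_of_codim_zero (hS : IsEmbeddedSubmanifold n 0 S)
    (h : NormalSphere g S → ℝ) (j : ℕ) : h ∈ parityHarmonics g S j :=
  ⟨fun _ _ => 0, zero_mem_sphericalHarmonics hS, fun v => ((isEmpty_normalSphere hS).false v).elim⟩

end CodimensionZero

end SphericalBlowup

end

theorem mainTheorem5 {n k : ℕ} {M : Type*} [TopologicalSpace M] [T2Space M] [CompactSpace M]
    [ChartedSpace (SphericalBlowup.Model n k) M] [IsManifold (𝓡 (n + k)) ∞ M]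
    (g : SphericalBlowup.Metric n k M)
    (S : Set M) (hS : IsClosed S) (hSsub : SphericalBlowup.IsEmbeddedSubmanifold n k S)
    (f : SphericalBlowup.Blowup g S → ℝ) (hf : SphericalBlowup.IsSmooth f) :
    (∃ u : M → ℝ, ContMDiff (𝓡 (n + k)) 𝓘(ℝ, ℝ) ∞ u ∧
        ∀ q, f q = u (SphericalBlowup.blowdown q)) ↔
      ∀ j : ℕ, SphericalBlowup.tDeriv f j ∈ SphericalBlowup.parityHarmonics g S j := by
  rcases Nat.eq_zero_or_pos k with rfl | hk
  · have hempty := SphericalBlowup.isEmpty_normalSphere (g := g) hSsub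
    refine ⟨fun _ j => SphericalBlowup.mem_parityHarmonics_of_codim_zero hSsub _ j, fun _ =>
      ⟨_, SphericalBlowup.contMDiff_interiorPart hS hSsub hf, ?_⟩⟩
    rintro (⟨q, hq⟩ | v)
    · exact (SphericalBlowup.interiorPart_of_notMem hq).symm
    · exact (hempty.false v).elim
  · have : Nonempty (Fin k) := ⟨⟨0, hk⟩⟩
    refine ⟨fun ⟨u, hu, huf⟩ j =>
      (SphericalBlowup.isFibrePoly_tDeriv hu huf j).mem_parityHarmonics hSsub, fun hY => ?_⟩
    exact ⟨_, SphericalBlowup.exists_contMDiff_of_tDeriv_mem hS hSsub hf hY⟩
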